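/- **Theorem 2 (Hyperfast Second-Order Method).** Let $f:\mathbb R^n\to\mathbb R$ be convex and three times continuously differentiable with $\|D^3f(x)-D^3f(y)\|\le L_3\|x-y\|$ for all $x,y$, where $L_3>0$; let $x_*$ be a minimizer of $f$, $\|x_0-x_*\|\le R$ and $\varepsilon>0$. Consider the following method. *Outer method.* Put $A_0=0$, $y_0=x_0$. For $k=0,1,\dots$ find $\lambda_{k+1}>0$ and $y_{k+1}$ with $$\tfrac12\le\lambda_{k+1}\tfrac{3L_3}{4}\|y_{k+1}-\tilde x_k\|^2\le\tfrac34,$$ where $a_{k+1}=\tfrac12\big(\lambda_{k+1}+\sqrt{\lambda_{k+1}^2+4\lambda_{k+1}A_k}\big)$, $A_{k+1}=A_k+a_{k+1}$, $\tilde x_k=\frac{A_k}{A_{k+1}}y_k+\frac{a_{k+1}}{A_{k+1}}x_k$ and $y_{k+1}$ is the output of the inner method at $\tilde x_k$; then put $x_{k+1}=x_k-a_{k+1}\nabla f(y_{k+1})$. The pair is found by a line search: trial values $\lambda>0$ are proposed one after the other, as a function of $L_3,R,\varepsilon$ and of the numbers $(\lambda,\|y-\tilde x\|)$ of the rejected trials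 of the current iteration; for each of them $\tilde x$ is formed and the inner method is run from $\tilde x$; the trial is accepted if its output $y$ satisfies the displayed inequalities. *Inner method (Bregman-Distance Gradient Method) at $\tilde x$, with tolerance $\delta>0$*, which is a function of $L_3,R,\varepsilon,\|\nabla f(\tilde x)\|,\|\nabla^2f(\tilde x)\|$. Let $\tau=\frac{3\delta}{8(2+\sqrt2)\|\nabla f(\tilde x)\|}$, $S=\{z:\|z-\tilde x\|\le2(\frac{2+\sqrt2}{L_3}\|\nabla f(\tilde x)\|)^{1/3}\}$, $\rho(z)=\frac12\langle\nabla^2f(\tilde x)(z-\tilde x),z-\tilde x\rangle+\frac{L_3}4\|z-\tilde x\|^4$, $\beta_\rho(u,z)=\rho(z)-\rho(u)-\langle\nabla\rho(u),z-u\rangle$ and $$g(z)=\nabla f(\tilde x)+\nabla^2f(\tilde x)[z-\tilde x]+\tfrac1{2\tau^2}\big(\nabla f(\tilde x+\tau(z-\tilde x))+\nabla f(\tilde x-\tau(z-\tilde x))-2\nabla f(\tilde x)\big)+L_3\|z-\tilde x\|^2(z-\tilde x).$$ Start at $z_0=\tilde x$. If $\|g(z_i)\|\le\frac16\|\nabla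 f(z_i)\|-\delta$, stop and return $z_i$; otherwise take $z_{i+1}\in\arg\min_{z\in S}\{\langle g(z_i),z-z_i\rangle+2(1+\frac1{\sqrt2})\beta_\rho(z_i,z)\}$. There are a rule for proposing $\lambda$, a rule for $\delta$, and constants $C>0$, $m\in\mathbb N$, none of which depends on $n$, $f$, $x_0$ or $x_*$ (the constants are absolute), such that the method always has an execution and every execution has the following properties. 1. Each outer iteration is an iteration of NATMI with $p=3$, $\gamma=\frac16$, $\xi=\frac32$: $\lambda_{k+1}>0$, the displayed inequalities hold, and $\|\nabla\tilde\Omega(y_{k+1})\|\le\frac16\|\nabla f(y_{k+1})\|$, where $\tilde\Omega(y)=\sum_{j=0}^{3}\frac1{j!}D^jf(\tilde x_k)[y-\tilde x_k]^j+\frac{L_3}4\|y-\tilde x_k\|^4$. 2. $f(y_k)-f(x_*)\le C\,L_3R^4/k^5$ for every completed outer iteration $k\ge1$. 3. The method reaches accuracy $\varepsilon$, that is, an iterate $z$ of the inner method (a candidate for some $y_{k+1}$) with $f(z)-f(x_*)\le\varepsilon$. Up to then, the line search and the evaluations at $z$ included, it has computed $$N_1\le C\Big(1+\big(\tfrac{L_3R^4}{\varepsilon}\big)^{1/5}\Big)\log^m\!\Big(e+\tfrac{L_3R^4}{\varepsilon}\Big)$$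 Hessians and $$N_2\le C\Big(1+\big(\tfrac{L_3R^4}{\varepsilon}\big)^{1/5}\Big)\log\!\Big(e+\tfrac{G+H}{\varepsilon}\Big)\log^m\!\Big(e+R+\tfrac{L_3R^4}{\varepsilon}\Big)$$ gradients, whenever $G$ and $H$ bound $\|\nabla f\|$ and $\|\nabla^2f\|$ at the points $\tilde x$ formed by the outer method up to then. That is, $N_1=\tilde O\big((L_3R^4/\varepsilon)^{1/5}\big)$ and $N_2=\tilde O\big((L_3R^4/\varepsilon)^{1/5}\log\frac{G+H}{\varepsilon}\big)$. -/

import Mathlib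

/-- The Euclidean space `ℝⁿ`. -/
abbrev Vec (n : ℕ) := EuclideanSpace ℝ (Fin n)

noncomputable section

namespace Hyperfast

/-! ### Derivatives, Taylor models, inexact subproblem solutions -/

/-- The Hessian of `f` at `x`, as a linear operator: the derivative of the gradient map. -/
def hess {n : ℕ} (f : Vec n → ℝ) (x : Vec n) : Vec n →L[ℝ] Vec n :=
  fderiv ℝ (gradient f) x

/-- The Taylor polynomial `Ω_p(f, x; y) = ∑_{k ≤ p} D^k f(x)[y - x]^k / k!`. -/
def taylor {n : ℕ} (p : ℕ) (f : Vec n → ℝ) (x y : Vec n) : ℝ :=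
  ∑ k ∈ Finset.range (p + 1),
    (1 / (Nat.factorial k : ℝ)) * iteratedFDeriv ℝ k f x (fun _ => y - x)

/-- The regularized Taylor model `Ω_p(f, x; y) + (H / p!) ‖y - x‖^(p+1)`. -/
def model {n : ℕ} (p : ℕ) (H : ℝ) (f : Vec n → ℝ) (x y : Vec n) : ℝ :=
  taylor p f x y + H / (Nat.factorial p : ℝ) * ‖y - x‖ ^ (p + 1)

/-- The set `N_{p,H}^γ(x)` of `γ`-inexact stationary points of the model at `x`. -/
def inexactSol {n : ℕ} (p : ℕ) (γ H : ℝ) (f : Vec n → ℝ) (x : Vec n) : Set (Vec n) :=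
  {T | ‖gradient (model p H f x) T‖ ≤ γ * ‖gradient f T‖}

/-! ### The outer accelerated scheme -/

/-- The data `(A_k, x_k, y_k)` carried from one outer iteration to the next. -/
structure Main (n : ℕ) where
  A : ℝ
  x : Vec n
  y : Vec n

/-- `a_{k+1}` as a function of `λ_{k+1}` and `A_k`. -/
def stepA (lam A : ℝ) : ℝ := (lam + Real.sqrt (lam ^ 2 + 4 * lam * A)) / 2

/-- The point `x̃_k = (A_k / A_{k+1}) y_k + (a_{k+1} / A_{k+1}) x_k`
determined by `λ_{k+1}`, where `A_{k+1} = A_k + a_{k+1}`. -/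
def center {n : ℕ} (s : Main n) (lam : ℝ) : Vec n :=
  (s.A / (s.A + stepA lam s.A)) • s.y + (stepA lam s.A / (s.A + stepA lam s.A)) • s.x

/-- The outer update made once the pair `(λ_{k+1}, y_{k+1})` has been found. -/
def update {n : ℕ} (f : Vec n → ℝ) (s : Main n) (lam : ℝ) (y : Vec n) : Main n where
  A := s.A + stepA lam s.A
  x := s.x - stepA lam s.A • gradient f y
  y := y

/-- One iteration of the inexact `p`-th order near-optimal accelerated tensor method (NATMI)
with accuracy `γ` and regularization `H`: it leads from `s` to `s'` through a pair
`λ > 0`, `y ∈ N_{p,H}^γ(x̃)` with `1/2 ≤ λ H ‖y - x̃‖^(p-1) / (p-1)! ≤ p / (p+1)`.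
(Used only with `p ≥ 1`.) -/
def NatmiStep {n : ℕ} (p : ℕ) (γ H : ℝ) (f : Vec n → ℝ) (s s' : Main n) : Prop :=
  ∃ (lam : ℝ) (y : Vec n), 0 < lam ∧
    y ∈ inexactSol p γ H f (center s lam) ∧
    1 / 2 ≤ lam * (H * ‖y - center s lam‖ ^ (p - 1) / (Nat.factorial (p - 1) : ℝ)) ∧
    lam * (H * ‖y - center s lam‖ ^ (p - 1) / (Nat.factorial (p - 1) : ℝ)) ≤ p / (p + 1) ∧
    s' = update f s lam y

/-! ### The Bregman-distance gradient method for the subproblem at `x`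

Here `x` is the centre `x̃_k`, `L` is the Lipschitz constant of the third derivative and `δ` is
the tolerance.  The objective is
`⟨∇f(x), z - x⟩ + ∇²f(x)[z - x]² / 2 + D³f(x)[z - x]³ / 6 + (L/4) ‖z - x‖⁴`. -/

/-- The finite-difference step `τ = 3δ / (8 (2 + √2) ‖∇f(x)‖)`. -/
def tau {n : ℕ} (f : Vec n → ℝ) (δ : ℝ) (x : Vec n) : ℝ :=
  3 * δ / (8 * (2 + Real.sqrt 2) * ‖gradient f x‖)

/-- The finite-difference approximation of `D³f(x)[z - x]²` from three gradients. -/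
def thirdDiff {n : ℕ} (f : Vec n → ℝ) (τ : ℝ) (x z : Vec n) : Vec n :=
  (1 / τ ^ 2) • (gradient f (x + τ • (z - x)) + gradient f (x - τ • (z - x))
    - (2 : ℝ) • gradient f x)

/-- The inexact gradient at `z` of the objective of the subproblem. -/
def inexactGrad {n : ℕ} (f : Vec n → ℝ) (L δ : ℝ) (x z : Vec n) : Vec n :=
  gradient f x + hess f x (z - x) + (1 / 2 : ℝ) • thirdDiff f (tau f δ x) x z
    + (L * ‖z - x‖ ^ 2) • (z - x)

/-- The feasible ball `‖z - x‖ ≤ 2 ((2 + √2) ‖∇f(x)‖ / L)^(1/3)`. -/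
def feasible {n : ℕ} (f : Vec n → ℝ) (L : ℝ) (x : Vec n) : Set (Vec n) :=
  {z | ‖z - x‖ ≤ 2 * ((2 + Real.sqrt 2) / L * ‖gradient f x‖) ^ ((1 : ℝ) / 3)}

/-- The scaling function `ρ(z) = ⟨∇²f(x)(z - x), z - x⟩ / 2 + (L/4) ‖z - x‖⁴`. -/
def scaling {n : ℕ} (f : Vec n → ℝ) (L : ℝ) (x z : Vec n) : ℝ :=
  1 / 2 * inner ℝ (hess f x (z - x)) (z - x) + L / 4 * ‖z - x‖ ^ 4

/-- The Bregman distance `β_ρ(u, z) = ρ(z) - ρ(u) - ⟨∇ρ(u), z - u⟩`. -/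
def bregman {n : ℕ} (ρ : Vec n → ℝ) (u z : Vec n) : ℝ :=
  ρ z - ρ u - inner ℝ (gradient ρ u) (z - u)

/-- The stopping test `‖g(z)‖ ≤ ‖∇f(z)‖ / 6 - δ`. -/
def Stops {n : ℕ} (f : Vec n → ℝ) (L δ : ℝ) (x z : Vec n) : Prop :=
  ‖inexactGrad f L δ x z‖ ≤ 1 / 6 * ‖gradient f z‖ - δ

/-- `z'` is a next iterate after `z`:
`z' ∈ argmin_{w ∈ S} { ⟨g(z), w - z⟩ + 2 (1 + 1/√2) β_ρ(z, w) }`. -/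
def IsNext {n : ℕ} (f : Vec n → ℝ) (L δ : ℝ) (x z z' : Vec n) : Prop :=
  z' ∈ feasible f L x ∧
    IsMinOn (fun w => inner ℝ (inexactGrad f L δ x z) (w - z)
      + 2 * (1 + 1 / Real.sqrt 2) * bregman (scaling f L x) z w) (feasible f L x) z'

/-! ### The whole method as a transition system with oracle counters

`search` proposes the next trial value of `λ` from the list of the rejected trials of the current
outer iteration (latest first), each recorded as `(λ, ‖y - x̃‖)`; `tol` gives the tolerance `δ`
from `‖∇f(x̃)‖` and `‖∇²f(x̃)‖`. -/

/-- A configuration: the number of completed outer iterations, the outer data, the rejected trials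
of the current outer iteration, the current trial value `λ`, the current iterate `z` of the inner
method, and the numbers of Hessians and of gradients computed so far (the gradients needed for the
inexact gradient and for the stopping test at `z` being included). -/
structure Config (n : ℕ) where
  iter : ℕ
  main : Main n
  rejected : List (ℝ × ℝ)
  lam : ℝ
  z : Vec n
  hessians : ℕ
  gradients : ℕ

/-- The centre `x̃` of the current trial. -/
def Config.center {n : ℕ} (c : Config n) : Vec n := Hyperfast.center c.main c.lam

/-- Begin a trial: the inner method starts at `z₀ = x̃`.  It costs one Hessian (at `x̃`) and four
gradients: at `x̃`, and at `z₀` and the two finite-difference points belonging to `z₀`. -/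
def startTrial {n : ℕ} (search : List (ℝ × ℝ) → ℝ) (iter : ℕ) (s : Main n)
    (rejected : List (ℝ × ℝ)) (hessians gradients : ℕ) : Config n where
  iter := iter
  main := s
  rejected := rejected
  lam := search rejected
  z := Hyperfast.center s (search rejected)
  hessians := hessians + 1
  gradients := gradients + 4

/-- The initial configuration: `A₀ = 0`, `y₀ = x₀`. -/
def initial {n : ℕ} (search : List (ℝ × ℝ) → ℝ) (x₀ : Vec n) : Config n :=
  startTrial search 0 ⟨0, x₀, x₀⟩ [] 0 0

/-- The tolerance `δ` of the current trial. -/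
def Config.delta {n : ℕ} (tol : ℝ → ℝ → ℝ) (f : Vec n → ℝ) (c : Config n) : ℝ :=
  tol ‖gradient f c.center‖ ‖hess f c.center‖

/-- The acceptance test `1/2 ≤ λ (3 L ‖y - x̃‖² / 4) ≤ 3/4` for `y = z`. -/
def Config.Accepts {n : ℕ} (L : ℝ) (c : Config n) : Prop :=
  1 / 2 ≤ c.lam * (3 * L * ‖c.z - c.center‖ ^ 2 / 4) ∧
    c.lam * (3 * L * ‖c.z - c.center‖ ^ 2 / 4) ≤ 3 / 4

/-- One step of the method. -/
inductive Step {n : ℕ} (search : List (ℝ × ℝ) → ℝ) (tol : ℝ → ℝ → ℝ) (f : Vec n → ℝ) (L : ℝ) :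
    Config n → Config n → Prop
  /-- The inner method has not stopped: one more inner iteration, which costs three gradients
  (at `z'` and at its two finite-difference points). -/
  | inner (c : Config n) (z' : Vec n)
      (hs : ¬ Stops f L (c.delta tol f) c.center c.z)
      (hz : IsNext f L (c.delta tol f) c.center c.z z') :
      Step search tol f L c { c with z := z', gradients := c.gradients + 3 }
  /-- The inner method has stopped and the pair `(λ, z)` is accepted: outer update (`∇f(z)` is
  already known), and the next outer iteration begins. -/
  | accept (c : Config n)
      (hs : Stops f L (c.delta tol f) c.center c.z) (ha : c.Accepts L) :
      Step search tol f L c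
        (startTrial search (c.iter + 1) (update f c.main c.lam c.z) [] c.hessians c.gradients)
  /-- The inner method has stopped and the pair `(λ, z)` is rejected: the next value of `λ` is
  tried. -/
  | reject (c : Config n)
      (hs : Stops f L (c.delta tol f) c.center c.z) (ha : ¬ c.Accepts L) :
      Step search tol f L c
        (startTrial search c.iter c.main ((c.lam, ‖c.z - c.center‖) :: c.rejected)
          c.hessians c.gradients)

/-- An execution of the method started at `x₀`. -/
def IsExecution {n : ℕ} (search : List (ℝ × ℝ) → ℝ) (tol : ℝ → ℝ → ℝ) (f : Vec n → ℝ) (L : ℝ)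
    (x₀ : Vec n) (c : ℕ → Config n) : Prop :=
  c 0 = initial search x₀ ∧ ∀ i, Step search tol f L (c i) (c (i + 1))

end Hyperfast

end

/-!
The inner method converges linearly.  Since `f` is convex, its Hessian is positive semidefinite at
`x̃ ± √2 h`, and Taylor's formula there bounds the third derivative at `x̃` by the Hessian of the
scaling function `ρ` (`Regular.abs_third_le`).  Hence the regularized Taylor model is smooth and
strongly convex relative to `ρ`, with constants `1 ± 1/√2`, and each inner iteration contracts the
Bregman distance to the minimizer of the model by the factor `11/12`, up to the error of the finite
differences (`Regular.inner_step`).  The minimizer lies within a multiple of `R` of `x̃`, so that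
the initial Bregman distance is `O(‖∇²f(x̃)‖ R² + L R⁴)`.  After logarithmically many iterations
the stopping test therefore succeeds at every iterate that is not `ε`-accurate
(`Regular.stops_of_innerIter`): if `L R⁴` is small compared with `ε`, then near minimizers of the
model are `ε`-accurate themselves; otherwise the model gradient is small compared with `ε / R`,
which the gradient of `f` at an inaccurate point cannot be.

An accepted pair `(λ, y)` is an inexact proximal step of relative error `3/5`, and the Lyapunov
function `A_k (f(y_k) - f(x_*)) + ‖x_k - x_*‖² / 2` of the accelerated proximal scheme decreases
(`Regular.energy_update`).  The decrease bounds `∑ A_i ‖y_i - x̃_{i-1}‖² / λ_i`, the acceptance test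
converts this into a bound for `∑ A_i / λ_i²`, and Hölder's inequality against `∑ √λ_i ≤ 2 √A_k`
gives `∑ A_i^{1/5} ≤ κ A_k^{2/5}`, hence `A_k ≥ c k⁵ / (L R²)` (`Regular.progress_update`,
`Progress.rate`).  The same sums keep all the centres within `9 R / 4` of `x_*`.

The line search bisects `log λ`.  The output of the inner method is not a continuous function of
`λ`, since it is only an inexact stationary point of the model.  However, two inexact stationary
points of models with neighbouring centres have squared step lengths of ratio at most `1.495`
(`Regular.sq_norm_sub_le_of_near_center`).  The two bounds of the acceptance test have the ratio
`3/2`, so that a short bracket cannot have a rejected trial with too short a step at its lower end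
and one with too long a step at its upper end; nor can one of its ends be the initial one, because
before accuracy `ε` is reached the step lengths are bounded above and below.  The bracket thus stays
longer than a constant multiple of `1 / (1 + L R⁴ / ε)`, and the number of trials is logarithmic
(`Regular.length_rejected_le`).

The number of Hessians is the number of trials: at most `O((L R⁴ / ε)^{1/5})` outer iterations with
logarithmically many trials each.  Each trial costs a logarithmic number of gradients.
-/

noncomputable section

namespace Hyperfast

/-! ### Smooth convex functions with Lipschitz third derivative -/

section Calculus

/-- A curve that starts at `0` and whose derivative is at most `C sᵏ` has norm at most
`C / (k + 1)` at time `1`. -/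
lemma norm_le_of_norm_deriv_le_pow {V : Type*} [NormedAddCommGroup V] [NormedSpace ℝ V]
    {φ φ' : ℝ → V} (C : ℝ) (k : ℕ) (h0 : φ 0 = 0) (hd : ∀ s, HasDerivAt φ (φ' s) s)
    (hb : ∀ s, 0 ≤ s → s ≤ 1 → ‖φ' s‖ ≤ C * s ^ k) : ‖φ 1‖ ≤ C / (k + 1) := by
  have hk : (k + 1 : ℝ) ≠ 0 := by positivity
  have := image_norm_le_of_norm_deriv_right_le_deriv_boundary (f := φ) (f' := φ') (a := 0) (b := 1)
    (B := fun s => C / (k + 1) * s ^ (k + 1)) (B' := fun s => C * s ^ k)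
    (fun s _ => (hd s).continuousAt.continuousWithinAt)
    (fun s _ => (hd s).hasDerivWithinAt) (by simp [h0])
    (fun s => by
      have := (hasDerivAt_pow (k + 1) s).const_mul (C / (k + 1))
      have e : C / (k + 1) * (((k + 1 : ℕ) : ℝ) * s ^ (k + 1 - 1)) = C * s ^ k := by
        rw [Nat.add_sub_cancel]
        push_cast
        field_simp
      rwa [e] at this)
    (fun s hs => hb s hs.1 hs.2.le) (Set.right_mem_Icc.2 zero_le_one)
  simpa using this

lemma hasDerivAt_line {V : Type*} [NormedAddCommGroup V] [NormedSpace ℝ V] (x h : V) (s : ℝ) :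
    HasDerivAt (fun t : ℝ => x + t • h) h s := by
  simpa using ((hasDerivAt_id s).smul_const h).const_add x

variable {V : Type*} [NormedAddCommGroup V] [InnerProductSpace ℝ V] [CompleteSpace V]

lemma HasGradientAt.hasDerivAt_line {ψ : V → ℝ} {g x h : V} {s : ℝ}
    (hg : HasGradientAt ψ g (x + s • h)) :
    HasDerivAt (fun t : ℝ => ψ (x + t • h)) (inner ℝ g h) s := by
  have := hg.hasFDerivAt.comp_hasDerivAt s (Hyperfast.hasDerivAt_line x h s)
  rw [InnerProductSpace.toDual_apply_apply] at this
  exact this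

/-- The gradient inequality for a differentiable convex function. -/
lemma le_of_convexOn {ψ : V → ℝ} {g x : V} (hc : ConvexOn ℝ Set.univ ψ)
    (hg : HasGradientAt ψ g x) (y : V) : ψ x + inner ℝ g (y - x) ≤ ψ y := by
  have hc' : ConvexOn ℝ Set.univ (fun t : ℝ => ψ (x + t • (y - x))) := by
    have e : (fun t : ℝ => ψ (x + t • (y - x))) = ψ ∘ AffineMap.lineMap x y := by
      ext t
      simp [AffineMap.lineMap_apply, add_comm]
    rw [e]
    exact hc.comp_affineMap (AffineMap.lineMap x y)
  have hd : HasDerivAt (fun t : ℝ => ψ (x + t • (y - x))) (inner ℝ g (y - x)) 0 :=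
    HasGradientAt.hasDerivAt_line (by simpa using hg)
  have := hc'.le_slope_of_hasDerivAt (Set.mem_univ 0) (Set.mem_univ 1) zero_lt_one hd
  simp [slope_def_field] at this
  linarith

/-- A function whose second derivative is positive semidefinite lies above its tangents. -/
lemma le_of_second_deriv_nonneg {ψ : V → ℝ} {G : V → V} {A : V → V →L[ℝ] V}
    (hψ : ∀ z, HasGradientAt ψ (G z) z) (hG : ∀ z, HasFDerivAt G (A z) z)
    (hA : ∀ z v, 0 ≤ inner ℝ (A z v) v) (x y : V) : ψ x + inner ℝ (G x) (y - x) ≤ ψ y := by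
  set h := y - x
  have hd : ∀ s, HasDerivAt (fun t : ℝ => ψ (x + t • h)) (inner ℝ (G (x + s • h)) h) s :=
    fun s => HasGradientAt.hasDerivAt_line (hψ _)
  have hd2 : ∀ s, HasDerivAt (fun t : ℝ => inner ℝ (G (x + t • h)) h)
      (inner ℝ (A (x + s • h) h) h) s := fun s => by
    have := ((hG _).comp_hasDerivAt s (Hyperfast.hasDerivAt_line x h s)).inner ℝ
      (hasDerivAt_const s h)
    simpa using this
  have hm : Monotone (deriv fun t : ℝ => ψ (x + t • h)) := by
    rw [show (deriv fun t : ℝ => ψ (x + t • h)) = fun s => inner ℝ (G (x + s • h)) h from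
      funext fun s => (hd s).deriv]
    exact monotone_of_hasDerivAt_nonneg hd2 fun s => hA _ _
  have hc := hm.convexOn_univ_of_deriv fun s => (hd s).differentiableAt
  have := hc.le_slope_of_hasDerivAt (Set.mem_univ 0) (Set.mem_univ 1) zero_lt_one (hd 0)
  simp [slope_def_field] at this
  simp only [h, add_sub_cancel] at this
  linarith

end Calculus

variable {n : ℕ}

/-- The third derivative of `f` at `x`, as the derivative of the Hessian. -/
def third (f : Vec n → ℝ) (x : Vec n) : Vec n →L[ℝ] Vec n →L[ℝ] Vec n :=
  fderiv ℝ (hess f) x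

/-- The standing assumptions on `f`, in the form in which they are used: the derivatives up to
order three exist and are symmetric, the third one is `L`-Lipschitz, and `f` lies above its
tangents. -/
structure Regular (f : Vec n → ℝ) (L : ℝ) : Prop where
  pos : 0 < L
  hasGradientAt : ∀ x, HasGradientAt f (gradient f x) x
  hasFDerivAt_gradient : ∀ x, HasFDerivAt (gradient f) (hess f x) x
  hasFDerivAt_hess : ∀ x, HasFDerivAt (hess f) (third f x) x
  hess_symm : ∀ x u v, inner ℝ (hess f x u) v = inner ℝ (hess f x v) u
  third_symm : ∀ x u v, third f x u v = third f x v u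
  lip : ∀ x y u v,
    ‖third f x u v - third f y u v‖ ≤ L * ‖x - y‖ * ‖u‖ * ‖v‖
  convex : ∀ x y, f x + inner ℝ (gradient f x) (y - x) ≤ f y

lemma fderiv_eq_toDual_gradient (f : Vec n → ℝ) :
    fderiv ℝ f = fun x => InnerProductSpace.toDual ℝ (Vec n) (gradient f x) :=
  toDual_comp_gradient.symm

lemma hasGradientAt_of_contDiff {f : Vec n → ℝ} (hf : ContDiff ℝ 3 f) (x : Vec n) :
    HasGradientAt f (gradient f x) x :=
  (hf.differentiable (by norm_num) x).hasGradientAt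

lemma contDiff_gradient {f : Vec n → ℝ} (hf : ContDiff ℝ 3 f) : ContDiff ℝ 2 (gradient f) := by
  have : gradient f = fun x => (InnerProductSpace.toDual ℝ (Vec n)).symm (fderiv ℝ f x) := rfl
  rw [this]
  exact (InnerProductSpace.toDual ℝ (Vec n)).symm.contDiff.comp
    (hf.fderiv_right (m := 2) (by norm_num))

lemma contDiff_hess {f : Vec n → ℝ} (hf : ContDiff ℝ 3 f) : ContDiff ℝ 1 (hess f) :=
  (contDiff_gradient hf).fderiv_right (m := 1) (by norm_num)

lemma fderiv_fderiv_apply {f : Vec n → ℝ} (hf : ContDiff ℝ 3 f) (x u v : Vec n) :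
    fderiv ℝ (fderiv ℝ f) x u v = inner ℝ (hess f x u) v := by
  have h1 : HasFDerivAt (gradient f) (hess f x) x :=
    ((contDiff_gradient hf).differentiable (by norm_num) x).hasFDerivAt
  have h2 := ((InnerProductSpace.toDual ℝ (Vec n)).toContinuousLinearEquiv.toContinuousLinearMap
    |>.hasFDerivAt).comp x h1
  rw [fderiv_eq_toDual_gradient]
  have h3 : HasFDerivAt (fun x => InnerProductSpace.toDual ℝ (Vec n) (gradient f x)) _ x := h2
  rw [h3.fderiv]
  simp

lemma iteratedFDeriv_two_eq {f : Vec n → ℝ} (hf : ContDiff ℝ 3 f) (x : Vec n) (m : Fin 2 → Vec n) :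
    iteratedFDeriv ℝ 2 f x m = inner ℝ (hess f x (m 0)) (m 1) := by
  rw [iteratedFDeriv_two_apply, fderiv_fderiv_apply hf]

lemma iteratedFDeriv_three_eq {f : Vec n → ℝ} (hf : ContDiff ℝ 3 f) (x : Vec n)
    (m : Fin 3 → Vec n) :
    iteratedFDeriv ℝ 3 f x m = inner ℝ (third f x (m 0) (m 1)) (m 2) := by
  rw [iteratedFDeriv_succ_apply_left]
  have hd : DifferentiableAt ℝ (iteratedFDeriv ℝ 2 f) x :=
    hf.differentiable_iteratedFDeriv (by norm_num) x
  have h1 : HasFDerivAt (hess f) (third f x) x :=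
    ((contDiff_hess hf).differentiable (by norm_num) x).hasFDerivAt
  have e1 : fderiv ℝ (iteratedFDeriv ℝ 2 f) x (m 0) (Fin.tail m)
      = fderiv ℝ (fun y => iteratedFDeriv ℝ 2 f y (Fin.tail m)) x (m 0) := by
    rw [fderiv_continuousMultilinear_apply_const_apply hd]
  rw [e1, show (fun y => iteratedFDeriv ℝ 2 f y (Fin.tail m))
    = fun y => inner ℝ (hess f y (m 1)) (m 2) from funext fun y => iteratedFDeriv_two_eq hf y _]
  have h2 := (h1.clm_apply (hasFDerivAt_const (m 1) x)).inner ℝ (hasFDerivAt_const (m 2) x)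
  rw [h2.fderiv]
  simp

lemma Regular.of_contDiff {f : Vec n → ℝ} {L : ℝ} (hc : ConvexOn ℝ Set.univ f)
    (hf : ContDiff ℝ 3 f) (hL : 0 < L)
    (hlip : ∀ x y, ‖iteratedFDeriv ℝ 3 f x - iteratedFDeriv ℝ 3 f y‖ ≤ L * ‖x - y‖) :
    Regular f L where
  pos := hL
  hasGradientAt := hasGradientAt_of_contDiff hf
  hasFDerivAt_gradient x := ((contDiff_gradient hf).differentiable (by norm_num) x).hasFDerivAt
  hasFDerivAt_hess x := ((contDiff_hess hf).differentiable (by norm_num) x).hasFDerivAt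
  hess_symm x u v := by
    rw [← fderiv_fderiv_apply hf, ← fderiv_fderiv_apply hf]
    exact (hf.contDiffAt.isSymmSndFDerivAt (by simp; norm_num)) u v
  third_symm x u v :=
    ((contDiff_gradient hf).contDiffAt.isSymmSndFDerivAt (by simp)) u v
  convex x y := le_of_convexOn hc (hasGradientAt_of_contDiff hf x) y
  lip x y u v := by
    -- the bound for the trilinear form is applied to `(u, v, w)`
    set w := third f x u v - third f y u v
    have h1 : (iteratedFDeriv ℝ 3 f x - iteratedFDeriv ℝ 3 f y) ![u, v, w] = ‖w‖ ^ 2 := by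
      rw [sub_apply, iteratedFDeriv_three_eq hf,
        iteratedFDeriv_three_eq hf, ← inner_sub_left]
      exact real_inner_self_eq_norm_sq w
    have h2 := (iteratedFDeriv ℝ 3 f x - iteratedFDeriv ℝ 3 f y).le_opNorm ![u, v, w]
    rw [h1, Fin.prod_univ_three] at h2
    simp only [Matrix.cons_val_zero, Matrix.cons_val_one, Matrix.cons_val] at h2
    have h3 : ‖w‖ ^ 2 ≤ L * ‖x - y‖ * (‖u‖ * ‖v‖ * ‖w‖) := by
      refine (le_trans (le_of_eq ?_) h2).trans
        (mul_le_mul_of_nonneg_right (hlip x y) (by positivity))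
      simp
    rcases (norm_nonneg w).eq_or_lt with h | h
    · rw [← h]; positivity
    · nlinarith

/-! ### Taylor models and their derivatives -/

/-- The gradient at `z` of the third-order Taylor polynomial of `f` at `x`. -/
def taylorGrad (f : Vec n → ℝ) (x z : Vec n) : Vec n :=
  gradient f x + hess f x (z - x) + (1 / 2 : ℝ) • third f x (z - x) (z - x)

/-- The gradient at `z` of the regularized model `Ω₃(f, x; ·) + (L/4) ‖· - x‖⁴`. -/
def modelGrad (f : Vec n → ℝ) (L : ℝ) (x z : Vec n) : Vec n :=
  taylorGrad f x z + (L * ‖z - x‖ ^ 2) • (z - x)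

/-- The gradient at `z` of the scaling function. -/
def scalingGrad (f : Vec n → ℝ) (L : ℝ) (x z : Vec n) : Vec n :=
  hess f x (z - x) + (L * ‖z - x‖ ^ 2) • (z - x)

section Derivatives

lemma hasFDerivAt_sub_right (x z : Vec n) :
    HasFDerivAt (fun y : Vec n => y - x) (ContinuousLinearMap.id ℝ (Vec n)) z :=
  (hasFDerivAt_id z).sub_const x

lemma hasFDerivAt_norm_sub_sq (x z : Vec n) :
    HasFDerivAt (fun y : Vec n => ‖y - x‖ ^ 2) (2 • innerSL ℝ (z - x)) z := by
  have := (hasFDerivAt_sub_right x z).norm_sq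
  simpa using this

lemma hasGradientAt_norm_sub_pow_four (x z : Vec n) :
    HasGradientAt (fun y : Vec n => ‖y - x‖ ^ 4) ((4 * ‖z - x‖ ^ 2) • (z - x)) z := by
  rw [hasGradientAt_iff_hasFDerivAt]
  have h := (hasFDerivAt_norm_sub_sq x z).pow 2
  have e : (fun y : Vec n => ‖y - x‖ ^ 4) = fun y => (‖y - x‖ ^ 2) ^ 2 := by
    ext y; ring
  rw [e]
  refine h.congr_fderiv ?_
  ext v
  simp
  ring

lemma hasFDerivAt_cube (L : ℝ) (x z : Vec n) :
    HasFDerivAt (fun y : Vec n => (L * ‖y - x‖ ^ 2) • (y - x))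
      ((L * ‖z - x‖ ^ 2) • ContinuousLinearMap.id ℝ (Vec n)
        + (L • (2 • innerSL ℝ (z - x))).smulRight (z - x)) z :=
  ((hasFDerivAt_norm_sub_sq x z).const_mul L).smul (hasFDerivAt_sub_right x z)

lemma hasFDerivAt_clm_sub (A : Vec n →L[ℝ] Vec n) (x z : Vec n) :
    HasFDerivAt (fun y => A (y - x)) A z := by
  have := A.hasFDerivAt.comp z (hasFDerivAt_sub_right x z)
  rwa [ContinuousLinearMap.comp_id] at this

lemma hasGradientAt_quadratic {A : Vec n →L[ℝ] Vec n}
    (hA : ∀ u v, inner ℝ (A u) v = inner ℝ (A v) u) (x z : Vec n) :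
    HasGradientAt (fun y => inner ℝ (A (y - x)) (y - x)) ((2 : ℝ) • A (z - x)) z := by
  rw [hasGradientAt_iff_hasFDerivAt]
  refine ((hasFDerivAt_clm_sub A x z).inner ℝ (hasFDerivAt_sub_right x z)).congr_fderiv ?_
  ext v
  generalize z - x = h
  simp [hA v h]
  ring

lemma hasFDerivAt_bilinear {T : Vec n →L[ℝ] Vec n →L[ℝ] Vec n} (hT : ∀ u v, T u v = T v u)
    (x z : Vec n) :
    HasFDerivAt (fun y => T (y - x) (y - x)) ((2 : ℝ) • T (z - x)) z := by
  have h1 : HasFDerivAt (fun y => T (y - x)) T z := by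
    have := T.hasFDerivAt.comp z (hasFDerivAt_sub_right x z)
    rwa [ContinuousLinearMap.comp_id] at this
  refine (h1.clm_apply (hasFDerivAt_sub_right x z)).congr_fderiv ?_
  ext1 v
  generalize z - x = h
  simp [hT v h, two_smul]

lemma hasGradientAt_cubic {T : Vec n →L[ℝ] Vec n →L[ℝ] Vec n} (hT : ∀ u v, T u v = T v u)
    (hT' : ∀ u v w, inner ℝ (T u v) w = inner ℝ (T u w) v) (x z : Vec n) :
    HasGradientAt (fun y => inner ℝ (T (y - x) (y - x)) (y - x))
      ((3 : ℝ) • T (z - x) (z - x)) z := by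
  rw [hasGradientAt_iff_hasFDerivAt]
  refine ((hasFDerivAt_bilinear hT x z).inner ℝ (hasFDerivAt_sub_right x z)).congr_fderiv ?_
  ext v
  generalize z - x = h
  simp [hT' h v h, inner_smul_left]
  ring

end Derivatives

variable {f : Vec n → ℝ} {L : ℝ}

lemma hasFDerivAt_scalingGrad (x z : Vec n) :
    HasFDerivAt (scalingGrad f L x) (hess f x
      + ((L * ‖z - x‖ ^ 2) • ContinuousLinearMap.id ℝ (Vec n)
        + (L • (2 • innerSL ℝ (z - x))).smulRight (z - x))) z :=
  (hasFDerivAt_clm_sub (hess f x) x z).add (hasFDerivAt_cube L x z)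

namespace Regular

lemma third_symm_right (hf : Regular f L) (x u v w : Vec n) :
    inner ℝ (third f x u v) w = inner ℝ (third f x u w) v := by
  have h : ∀ a b : Vec n, HasFDerivAt (fun y => inner ℝ (hess f y a) b) _ x := fun a b =>
    ((hf.hasFDerivAt_hess x).clm_apply (hasFDerivAt_const a x)).inner ℝ (hasFDerivAt_const b x)
  have e : (fun y => inner ℝ (hess f y v) w) = fun y => inner ℝ (hess f y w) v :=
    funext fun y => hf.hess_symm y v w
  have h1 := h v w
  rw [e] at h1
  simpa using DFunLike.congr_fun (h1.unique (h w v)) u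

lemma monotone (hf : Regular f L) (x y : Vec n) :
    0 ≤ inner ℝ (gradient f y - gradient f x) (y - x) := by
  have h1 := hf.convex x y
  have h2 := hf.convex y x
  rw [← neg_sub y x, inner_neg_right] at h2
  rw [inner_sub_left]
  linarith

lemma hess_nonneg (hf : Regular f L) (x u : Vec n) : 0 ≤ inner ℝ (hess f x u) u := by
  have hd : HasDerivAt (fun t : ℝ => inner ℝ (gradient f (x + t • u)) u)
      (inner ℝ (hess f x u) u) 0 := by
    have h1 := ((hf.hasFDerivAt_gradient (x + (0 : ℝ) • u)).comp_hasDerivAt 0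
      (hasDerivAt_line x u 0)).inner ℝ (hasDerivAt_const 0 u)
    simpa using h1
  have hm : Monotone fun t : ℝ => inner ℝ (gradient f (x + t • u)) u := by
    intro s t hst
    rcases hst.eq_or_lt with rfl | hst
    · rfl
    have := hf.monotone (x + s • u) (x + t • u)
    rw [add_sub_add_left_eq_sub, ← sub_smul, inner_smul_right, inner_sub_left] at this
    have := nonneg_of_mul_nonneg_right this (sub_pos.2 hst)
    simpa using this
  rw [← hd.deriv]
  exact hm.deriv_nonneg

/-- Taylor's formula for the Hessian. -/
lemma norm_hess_sub_le (hf : Regular f L) (x h u : Vec n) :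
    ‖hess f (x + h) u - hess f x u - third f x h u‖ ≤ L / 2 * ‖h‖ ^ 2 * ‖u‖ := by
  have key := norm_le_of_norm_deriv_le_pow
    (φ := fun s : ℝ => hess f (x + s • h) u - hess f x u - s • third f x h u)
    (φ' := fun s => third f (x + s • h) h u - third f x h u) (L * ‖h‖ ^ 2 * ‖u‖) 1 (by simp)
    (fun s => by
      have h1 : HasDerivAt (fun t : ℝ => hess f (x + t • h)) (third f (x + s • h) h) s :=
        (hf.hasFDerivAt_hess (x + s • h)).comp_hasDerivAt s (hasDerivAt_line x h s)
      have h2 : HasDerivAt (fun t : ℝ => hess f (x + t • h) u) (third f (x + s • h) h u) s := by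
        simpa using h1.clm_apply (hasDerivAt_const s u)
      have h3 : HasDerivAt (fun t : ℝ => t • third f x h u) (third f x h u) s := by
        simpa using (hasDerivAt_id s).smul_const (third f x h u)
      exact (h2.sub_const (hess f x u)).sub h3)
    (fun s hs _ => by
      refine (hf.lip _ _ h u).trans (le_of_eq ?_)
      rw [add_sub_cancel_left, norm_smul, Real.norm_of_nonneg hs]
      ring)
  simp only [one_smul] at key
  refine key.trans (le_of_eq ?_)
  norm_num
  ring

/-- Taylor's formula for the gradient. -/
lemma norm_gradient_sub_le (hf : Regular f L) (x h : Vec n) :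
    ‖gradient f (x + h) - gradient f x - hess f x h - (1 / 2 : ℝ) • third f x h h‖
      ≤ L / 6 * ‖h‖ ^ 3 := by
  have key := norm_le_of_norm_deriv_le_pow
    (φ := fun s : ℝ => gradient f (x + s • h) - gradient f x - s • hess f x h
      - (s ^ 2 / 2) • third f x h h)
    (φ' := fun s => hess f (x + s • h) h - hess f x h - third f x (s • h) h)
    (L / 2 * ‖h‖ ^ 3) 2 (by simp)
    (fun s => by
      have h1 : HasDerivAt (fun t : ℝ => gradient f (x + t • h)) (hess f (x + s • h) h) s := by
        have h0 := hf.hasFDerivAt_gradient (x + s • h)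
        exact HasFDerivAt.comp_hasDerivAt (l := gradient f) s h0 (hasDerivAt_line x h s)
      have h2 := ((h1.sub_const (gradient f x)).sub
        ((hasDerivAt_id s).smul_const (hess f x h))).sub
          (((hasDerivAt_pow 2 s).div_const 2).smul_const (third f x h h))
      exact h2.congr_deriv (by simp))
    (fun s hs _ => by
      refine (hf.norm_hess_sub_le x (s • h) h).trans (le_of_eq ?_)
      rw [norm_smul, Real.norm_of_nonneg hs]
      ring)
  simp only [one_smul, one_pow] at key
  refine key.trans (le_of_eq ?_)
  norm_num
  ring

/-- Taylor's formula for the function. -/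
lemma abs_sub_taylor_le (hf : Regular f L) (x h : Vec n) :
    |f (x + h) - f x - inner ℝ (gradient f x) h - 1 / 2 * inner ℝ (hess f x h) h
      - 1 / 6 * inner ℝ (third f x h h) h| ≤ L / 24 * ‖h‖ ^ 4 := by
  have key := norm_le_of_norm_deriv_le_pow
    (φ := fun s : ℝ => f (x + s • h) - f x - s * inner ℝ (gradient f x) h
      - s ^ 2 / 2 * inner ℝ (hess f x h) h - s ^ 3 / 6 * inner ℝ (third f x h h) h)
    (φ' := fun s => inner ℝ (gradient f (x + s • h) - gradient f x - hess f x (s • h)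
      - (1 / 2 : ℝ) • third f x (s • h) (s • h)) h)
    (L / 6 * ‖h‖ ^ 4) 3 (by simp)
    (fun s => by
      have h1 := HasGradientAt.hasDerivAt_line (hf.hasGradientAt (x + s • h))
      have h2 := (((h1.sub_const (f x)).sub
        ((hasDerivAt_id s).mul_const (inner ℝ (gradient f x) h))).sub
          (((hasDerivAt_pow 2 s).div_const 2).mul_const (inner ℝ (hess f x h) h))).sub
            (((hasDerivAt_pow 3 s).div_const 6).mul_const (inner ℝ (third f x h h) h))
      refine h2.congr_deriv ?_
      simp [inner_sub_left, inner_smul_left]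
      ring)
    (fun s hs _ => by
      refine (norm_inner_le_norm _ _).trans ((mul_le_mul_of_nonneg_right
        (hf.norm_gradient_sub_le x (s • h)) (norm_nonneg h)).trans (le_of_eq ?_))
      rw [norm_smul, Real.norm_of_nonneg hs]
      ring)
  simp only [one_smul, one_pow, one_mul, Real.norm_eq_abs] at key
  refine key.trans (le_of_eq ?_)
  norm_num
  ring

/-- The third derivative is dominated by the Hessian of the scaling function: the Hessian of `f` is
positive semidefinite at `x ± √2 h`, and Taylor's formula at these two points gives the bound. -/
lemma abs_third_le (hf : Regular f L) (x h u : Vec n) :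
    |inner ℝ (third f x h u) u|
      ≤ 1 / Real.sqrt 2 * (inner ℝ (hess f x u) u + L * ‖h‖ ^ 2 * ‖u‖ ^ 2) := by
  have h2 : (Real.sqrt 2) ^ 2 = 2 := Real.sq_sqrt (by norm_num)
  have h0 : 0 < Real.sqrt 2 := by positivity
  have key : ∀ t : ℝ, t ^ 2 = 2 →
      0 ≤ inner ℝ (hess f x u) u + t * inner ℝ (third f x h u) u + L * ‖h‖ ^ 2 * ‖u‖ ^ 2 := by
    intro t ht
    have h3 := hf.hess_nonneg (x + t • h) u
    have h4 := hf.norm_hess_sub_le x (t • h) u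
    have h5 := (real_inner_le_norm
      (hess f (x + t • h) u - hess f x u - third f x (t • h) u) u).trans
      (mul_le_mul_of_nonneg_right h4 (norm_nonneg u))
    have h6 : ‖t • h‖ ^ 2 = 2 * ‖h‖ ^ 2 := by
      rw [norm_smul, mul_pow, Real.norm_eq_abs, sq_abs, ht]
    rw [h6] at h5
    simp only [inner_sub_left, map_smul, smul_apply, inner_smul_left, RCLike.conj_to_real] at h5
    linarith
  rw [one_div, ← div_eq_inv_mul, le_div_iff₀ h0]
  nth_rewrite 1 [← abs_of_pos h0]
  rw [← abs_mul]
  have k1 := key (Real.sqrt 2) h2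
  have k2 := key (-Real.sqrt 2) (by rw [neg_sq, h2])
  exact abs_le.2 ⟨by linarith, by linarith⟩

end Regular

lemma taylor_three_eq (hf : ContDiff ℝ 3 f) (x z : Vec n) :
    taylor 3 f x z = f x + inner ℝ (gradient f x) (z - x)
      + 1 / 2 * inner ℝ (hess f x (z - x)) (z - x)
      + 1 / 6 * inner ℝ (third f x (z - x) (z - x)) (z - x) := by
  simp [taylor, Finset.sum_range_succ, iteratedFDeriv_three_eq hf, iteratedFDeriv_two_eq hf,
    Nat.factorial]

/-- The regularized model `Ω₃(f, x; ·) + (L/4) ‖· - x‖⁴`, with its derivatives written out. -/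
def cubicModel (f : Vec n → ℝ) (L : ℝ) (x z : Vec n) : ℝ :=
  f x + inner ℝ (gradient f x) (z - x) + 1 / 2 * inner ℝ (hess f x (z - x)) (z - x)
    + 1 / 6 * inner ℝ (third f x (z - x) (z - x)) (z - x) + L / 4 * ‖z - x‖ ^ 4

lemma model_eq_cubicModel (hf : ContDiff ℝ 3 f) (x : Vec n) :
    model 3 (3 / 2 * L) f x = cubicModel f L x := by
  ext z
  simp only [model, taylor_three_eq hf, cubicModel, Nat.factorial]
  push_cast
  ring

namespace Regular

lemma hasGradientAt_cubicModel (hf : Regular f L) (x z : Vec n) :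
    HasGradientAt (cubicModel f L x) (modelGrad f L x z) z := by
  have h1 : HasFDerivAt (fun y => inner ℝ (gradient f x) (y - x)) (innerSL ℝ (gradient f x)) z := by
    have := (innerSL ℝ (gradient f x)).hasFDerivAt.comp z (hasFDerivAt_sub_right x z)
    rwa [ContinuousLinearMap.comp_id] at this
  have h2 := (hasGradientAt_quadratic (hf.hess_symm x) x z).hasFDerivAt
  have h3 := (hasGradientAt_cubic (hf.third_symm x) (hf.third_symm_right x) x z).hasFDerivAt
  have h4 := (hasGradientAt_norm_sub_pow_four x z).hasFDerivAt
  rw [hasGradientAt_iff_hasFDerivAt]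
  refine ((((h1.const_add (f x)).add (h2.const_mul (1 / 2))).add (h3.const_mul (1 / 6))).add
    (h4.const_mul (L / 4))).congr_fderiv ?_
  ext v
  rw [modelGrad, taylorGrad]
  generalize z - x = h
  simp
  ring

lemma hasGradientAt_scaling (hf : Regular f L) (x z : Vec n) :
    HasGradientAt (scaling f L x) (scalingGrad f L x z) z := by
  have h2 := (hasGradientAt_quadratic (hf.hess_symm x) x z).hasFDerivAt
  have h4 := (hasGradientAt_norm_sub_pow_four x z).hasFDerivAt
  rw [hasGradientAt_iff_hasFDerivAt]
  refine ((h2.const_mul (1 / 2)).add (h4.const_mul (L / 4))).congr_fderiv ?_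
  ext v
  rw [scalingGrad]
  generalize z - x = h
  simp
  ring

lemma gradient_scaling (hf : Regular f L) (x z : Vec n) :
    gradient (scaling f L x) z = scalingGrad f L x z :=
  (hf.hasGradientAt_scaling x z).gradient

lemma hasFDerivAt_modelGrad (hf : Regular f L) (x z : Vec n) :
    HasFDerivAt (modelGrad f L x) (hess f x + third f x (z - x)
      + ((L * ‖z - x‖ ^ 2) • ContinuousLinearMap.id ℝ (Vec n)
        + (L • (2 • innerSL ℝ (z - x))).smulRight (z - x))) z := by
  have h1 := (hasFDerivAt_bilinear (hf.third_symm x) x z).const_smul (1 / 2 : ℝ)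
  have h2 := (((hasFDerivAt_clm_sub (hess f x) x z).const_add (gradient f x)).add h1).add
    (hasFDerivAt_cube L x z)
  refine h2.congr_fderiv ?_
  rw [smul_smul]
  norm_num

end Regular

/-! ### The model relative to the scaling function -/

lemma inv_sqrt_two_bounds : 0.7 < 1 / Real.sqrt 2 ∧ 1 / Real.sqrt 2 < 0.71 := by
  have h0 : 0 < Real.sqrt 2 := by positivity
  have h2 : (Real.sqrt 2) ^ 2 = 2 := Real.sq_sqrt (by norm_num)
  constructor
  · rw [lt_div_iff₀ h0]; nlinarith
  · rw [div_lt_iff₀ h0]; nlinarith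

lemma inner_scalingHess (x z v : Vec n) :
    inner ℝ ((hess f x + ((L * ‖z - x‖ ^ 2) • ContinuousLinearMap.id ℝ (Vec n)
        + (L • (2 • innerSL ℝ (z - x))).smulRight (z - x))) v) v
      = inner ℝ (hess f x v) v + L * ‖z - x‖ ^ 2 * ‖v‖ ^ 2 + 2 * L * inner ℝ (z - x) v ^ 2 := by
  generalize z - x = h
  simp [inner_add_left, inner_smul_left]
  ring

lemma inner_modelHess (x z v : Vec n) :
    inner ℝ ((hess f x + third f x (z - x)
        + ((L * ‖z - x‖ ^ 2) • ContinuousLinearMap.id ℝ (Vec n)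
        + (L • (2 • innerSL ℝ (z - x))).smulRight (z - x))) v) v
      = inner ℝ (hess f x v) v + inner ℝ (third f x (z - x) v) v
        + L * ‖z - x‖ ^ 2 * ‖v‖ ^ 2 + 2 * L * inner ℝ (z - x) v ^ 2 := by
  generalize z - x = h
  simp [inner_add_left, inner_smul_left]
  ring

namespace Regular

lemma bregman_scaling (hf : Regular f L) (x u z : Vec n) :
    bregman (scaling f L x) u z
      = scaling f L x z - scaling f L x u - inner ℝ (scalingGrad f L x u) (z - u) := by
  rw [bregman, hf.gradient_scaling]

/-- The model is smooth relative to the scaling function. -/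
lemma model_le_bregman (hf : Regular f L) (x u z : Vec n) :
    cubicModel f L x z - cubicModel f L x u - inner ℝ (modelGrad f L x u) (z - u)
      ≤ (1 + 1 / Real.sqrt 2) * bregman (scaling f L x) u z := by
  set c := 1 / Real.sqrt 2 with hc
  have hc0 := inv_sqrt_two_bounds
  rw [← hc] at hc0
  have key := le_of_second_deriv_nonneg
    (ψ := fun y => (1 + c) * scaling f L x y - cubicModel f L x y)
    (G := fun y => (1 + c) • scalingGrad f L x y - modelGrad f L x y)
    (fun y => by
      rw [hasGradientAt_iff_hasFDerivAt]
      refine (((hf.hasGradientAt_scaling x y).hasFDerivAt.const_mul (1 + c)).sub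
        (hf.hasGradientAt_cubicModel x y).hasFDerivAt).congr_fderiv ?_
      simp)
    (fun y => ((hasFDerivAt_scalingGrad x y).const_smul (1 + c)).sub
      (hf.hasFDerivAt_modelGrad x y))
    (fun y v => by
      rw [sub_apply, inner_sub_left, smul_apply, inner_smul_left, inner_scalingHess,
        inner_modelHess]
      have h := (abs_le.1 (hf.abs_third_le x (y - x) v)).2
      rw [← hc] at h
      have := mul_nonneg hf.pos.le (sq_nonneg (inner ℝ (y - x) v))
      simp only [RCLike.conj_to_real]
      nlinarith) u z
  rw [hf.bregman_scaling]
  rw [inner_sub_left, inner_smul_left] at key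
  simp only [RCLike.conj_to_real] at key
  linarith

/-- The model is strongly convex relative to the scaling function. -/
lemma bregman_le_model (hf : Regular f L) (x u z : Vec n) :
    (1 - 1 / Real.sqrt 2) * bregman (scaling f L x) u z
      ≤ cubicModel f L x z - cubicModel f L x u - inner ℝ (modelGrad f L x u) (z - u) := by
  set c := 1 / Real.sqrt 2 with hc
  have hc0 := inv_sqrt_two_bounds
  rw [← hc] at hc0
  have key := le_of_second_deriv_nonneg
    (ψ := fun y => cubicModel f L x y - (1 - c) * scaling f L x y)
    (G := fun y => modelGrad f L x y - (1 - c) • scalingGrad f L x y)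
    (fun y => by
      rw [hasGradientAt_iff_hasFDerivAt]
      refine ((hf.hasGradientAt_cubicModel x y).hasFDerivAt.sub
        ((hf.hasGradientAt_scaling x y).hasFDerivAt.const_mul (1 - c))).congr_fderiv ?_
      simp)
    (fun y => (hf.hasFDerivAt_modelGrad x y).sub
      ((hasFDerivAt_scalingGrad x y).const_smul (1 - c)))
    (fun y v => by
      rw [sub_apply, inner_sub_left, smul_apply, inner_smul_left, inner_scalingHess,
        inner_modelHess]
      have h := (abs_le.1 (hf.abs_third_le x (y - x) v)).1
      rw [← hc] at h
      have := mul_nonneg hf.pos.le (sq_nonneg (inner ℝ (y - x) v))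
      simp only [RCLike.conj_to_real]
      nlinarith) u z
  rw [hf.bregman_scaling]
  rw [inner_sub_left, inner_smul_left] at key
  simp only [RCLike.conj_to_real] at key
  linarith

/-- The fourth-power part of the Bregman distance, written as a sum of squares. -/
lemma bregman_eq (hf : Regular f L) (x u z : Vec n) :
    bregman (scaling f L x) u z = 1 / 2 * inner ℝ (hess f x (z - u)) (z - u)
      + L * (1 / 4 * (‖z - u‖ ^ 2 + 2 * inner ℝ (u - x) (z - u)) ^ 2
        + 1 / 2 * ‖u - x‖ ^ 2 * ‖z - u‖ ^ 2) := by
  rw [hf.bregman_scaling]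
  obtain ⟨a, rfl⟩ : ∃ a, u = x + a := ⟨u - x, by abel⟩
  obtain ⟨v, rfl⟩ : ∃ v, z = x + a + v := ⟨z - (x + a), by abel⟩
  have e : x + a + v - x = a + v := by abel
  simp only [scaling, scalingGrad, e, add_sub_cancel_left, inner_add_left,
    inner_smul_left, map_add, inner_add_right, RCLike.conj_to_real]
  have h4 : ‖a + v‖ ^ 4 = (‖a‖ ^ 2 + 2 * inner ℝ a v + ‖v‖ ^ 2) ^ 2 := by
    rw [← norm_add_sq_real]; ring
  rw [h4, hf.hess_symm x v a]
  ring

lemma bregman_lower (hf : Regular f L) (x u z : Vec n) :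
    L / 32 * ‖z - u‖ ^ 4 ≤ bregman (scaling f L x) u z := by
  rw [hf.bregman_eq]
  have h1 := hf.hess_nonneg x (z - u)
  have h2 := abs_real_inner_le_norm (u - x) (z - u)
  set a := ‖u - x‖
  set b := ‖z - u‖
  set p := inner ℝ (u - x) (z - u)
  have ha : 0 ≤ a := norm_nonneg _
  have hb : 0 ≤ b := norm_nonneg _
  have key : b ^ 4 / 32 ≤ 1 / 4 * (b ^ 2 + 2 * p) ^ 2 + 1 / 2 * a ^ 2 * b ^ 2 := by
    rcases le_total (b / 4) a with h | h
    · have := mul_le_mul_of_nonneg_right (pow_le_pow_left₀ (by positivity) h 2) (sq_nonneg b)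
      nlinarith [sq_nonneg (b ^ 2 + 2 * p)]
    · have h3 := neg_le_of_abs_le h2
      have h4 : b ^ 2 / 2 ≤ b ^ 2 + 2 * p := by nlinarith
      have := pow_le_pow_left₀ (by positivity) h4 2
      nlinarith [mul_nonneg (sq_nonneg a) (sq_nonneg b), sq_nonneg (b ^ 2)]
  have := mul_le_mul_of_nonneg_left key hf.pos.le
  linarith

lemma bregman_nonneg (hf : Regular f L) (x u z : Vec n) : 0 ≤ bregman (scaling f L x) u z :=
  le_trans (by have := hf.pos; positivity) (hf.bregman_lower x u z)

lemma bregman_upper (hf : Regular f L) {x u z : Vec n} {r : ℝ} (hu : ‖u - x‖ ≤ r)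
    (hz : ‖z - u‖ ≤ r) :
    bregman (scaling f L x) u z ≤ (‖hess f x‖ / 2 + 11 / 4 * L * r ^ 2) * ‖z - u‖ ^ 2 := by
  rw [hf.bregman_eq]
  have h1 : inner ℝ (hess f x (z - u)) (z - u) ≤ ‖hess f x‖ * ‖z - u‖ ^ 2 := by
    refine (real_inner_le_norm _ _).trans ?_
    have := mul_le_mul_of_nonneg_right ((hess f x).le_opNorm (z - u)) (norm_nonneg (z - u))
    nlinarith
  have h2 := abs_real_inner_le_norm (u - x) (z - u)
  set a := ‖u - x‖
  set b := ‖z - u‖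
  set p := inner ℝ (u - x) (z - u)
  have ha : 0 ≤ a := norm_nonneg _
  have hb : 0 ≤ b := norm_nonneg _
  have hr : 0 ≤ r := ha.trans hu
  have h3 : |b ^ 2 + 2 * p| ≤ 3 * r * b := by
    refine (abs_add_le _ _).trans ?_
    rw [abs_mul, abs_of_nonneg (sq_nonneg b), abs_two]
    nlinarith [mul_le_mul_of_nonneg_right hu hb, mul_le_mul_of_nonneg_right hz hb]
  have h4 : (b ^ 2 + 2 * p) ^ 2 ≤ (3 * r * b) ^ 2 :=
    sq_le_sq' (neg_le_of_abs_le h3) (le_of_abs_le h3)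
  have h5 : a ^ 2 * b ^ 2 ≤ r ^ 2 * b ^ 2 :=
    mul_le_mul_of_nonneg_right (pow_le_pow_left₀ ha hu 2) (sq_nonneg b)
  have h6 : 1 / 4 * (b ^ 2 + 2 * p) ^ 2 + 1 / 2 * a ^ 2 * b ^ 2 ≤ 11 / 4 * r ^ 2 * b ^ 2 := by
    nlinarith
  have := mul_le_mul_of_nonneg_left h6 hf.pos.le
  nlinarith

lemma le_cubicModel (hf : Regular f L) (x z : Vec n) : f z ≤ cubicModel f L x z := by
  have h := (abs_le.1 (hf.abs_sub_taylor_le x (z - x))).2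
  rw [add_sub_cancel] at h
  have := mul_nonneg hf.pos.le (pow_nonneg (norm_nonneg (z - x)) 4)
  rw [cubicModel]
  linarith

lemma cubicModel_le (hf : Regular f L) (x z : Vec n) :
    cubicModel f L x z ≤ f z + 7 / 24 * L * ‖z - x‖ ^ 4 := by
  have h := (abs_le.1 (hf.abs_sub_taylor_le x (z - x))).1
  rw [add_sub_cancel] at h
  rw [cubicModel]
  linarith

end Regular

lemma modelGrad_self (x : Vec n) : modelGrad f L x x = gradient f x := by
  simp [modelGrad, taylorGrad]

lemma cubicModel_self (x : Vec n) : cubicModel f L x x = f x := by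
  simp [cubicModel]

/-! ### The feasible ball and the minimizer of the model -/

/-- The radius of the feasible ball. -/
def radius (L g : ℝ) : ℝ := 2 * ((2 + Real.sqrt 2) / L * g) ^ ((1 : ℝ) / 3)

lemma radius_nonneg (hL : 0 < L) {g : ℝ} (hg : 0 ≤ g) : 0 ≤ radius L g := by
  rw [radius]; positivity

lemma radius_pow_three (hL : 0 < L) {g : ℝ} (hg : 0 ≤ g) :
    L * radius L g ^ 3 = 8 * (2 + Real.sqrt 2) * g := by
  have h : (((2 + Real.sqrt 2) / L * g) ^ ((1 : ℝ) / 3)) ^ 3 = (2 + Real.sqrt 2) / L * g := by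
    rw [← Real.rpow_natCast, ← Real.rpow_mul (by positivity)]
    norm_num
  rw [radius, mul_pow, h]
  field_simp
  ring

lemma mem_feasible_iff {x z : Vec n} :
    z ∈ feasible f L x ↔ ‖z - x‖ ≤ radius L ‖gradient f x‖ := Iff.rfl

lemma feasible_eq_closedBall (x : Vec n) :
    feasible f L x = Metric.closedBall x (radius L ‖gradient f x‖) := by
  ext z
  rw [mem_feasible_iff, Metric.mem_closedBall, dist_eq_norm]

lemma self_mem_feasible (hL : 0 < L) (x : Vec n) : x ∈ feasible f L x := by
  rw [mem_feasible_iff, sub_self, norm_zero]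
  exact radius_nonneg hL (norm_nonneg _)

namespace Regular

/-- The model has a global minimizer, and the feasible ball is large enough to contain it. -/
lemma exists_minimizer (hf : Regular f L) (x : Vec n) :
    ∃ w ∈ feasible f L x, (∀ z, cubicModel f L x w ≤ cubicModel f L x z)
      ∧ modelGrad f L x w = 0 := by
  have hcont : Continuous (cubicModel f L x) :=
    continuous_iff_continuousAt.2 fun z => (hf.hasGradientAt_cubicModel x z).continuousAt
  have hcomp : IsCompact (feasible f L x) := by
    rw [feasible_eq_closedBall]; exact isCompact_closedBall _ _
  obtain ⟨w, hw, hmin⟩ := hcomp.exists_isMinOn ⟨x, self_mem_feasible hf.pos x⟩ hcont.continuousOn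
  have hglob : ∀ z, cubicModel f L x w ≤ cubicModel f L x z := by
    intro z
    by_cases hz : z ∈ feasible f L x
    · exact hmin hz
    have hx : cubicModel f L x w ≤ f x := by
      have : cubicModel f L x w ≤ cubicModel f L x x := hmin (self_mem_feasible hf.pos x)
      rwa [cubicModel_self] at this
    rw [mem_feasible_iff, not_le] at hz
    -- outside the ball, relative strong convexity beats the linear term at the centre
    set G := ‖gradient f x‖
    set r := ‖z - x‖
    have hG : 0 ≤ G := norm_nonneg _
    have hr0 := radius_nonneg hf.pos hG
    have hr : 0 < r := hr0.trans_lt hz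
    have h3 : 8 * (2 + Real.sqrt 2) * G ≤ L * r ^ 3 := by
      rw [← radius_pow_three hf.pos hG]
      exact mul_le_mul_of_nonneg_left (pow_le_pow_left₀ hr0 hz.le 3) hf.pos.le
    have h4 := hf.bregman_le_model x x z
    rw [modelGrad_self, cubicModel_self, hf.bregman_eq, sub_self, norm_zero, inner_zero_left] at h4
    have h5 := (abs_le.1 (abs_real_inner_le_norm (gradient f x) (z - x))).1
    have h6 := hf.hess_nonneg x (z - x)
    set c := 1 / Real.sqrt 2 with hc
    have hc0 := inv_sqrt_two_bounds
    rw [← hc] at hc0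
    have hs : Real.sqrt 2 = 2 * c := by
      rw [hc]
      have : (Real.sqrt 2) ^ 2 = 2 := Real.sq_sqrt (by norm_num)
      field_simp
      linarith
    have hc2 : 2 * c ^ 2 = 1 := by
      rw [hc, div_pow, Real.sq_sqrt (by norm_num)]; norm_num
    rw [hs] at h3
    have h7 : 8 * (2 + 2 * c) * G * r ≤ L * r ^ 4 := by
      calc _ ≤ L * r ^ 3 * r := mul_le_mul_of_nonneg_right h3 hr.le
        _ = _ := by ring
    have h8 : (1 - c) * (8 * (2 + 2 * c) * G * r) ≤ (1 - c) * (L * r ^ 4) :=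
      mul_le_mul_of_nonneg_left h7 (by linarith)
    have h9 : (1 - c) * (8 * (2 + 2 * c) * G * r) = 8 * (G * r) := by
      linear_combination (-8 * (G * r)) * hc2
    have h10 : 0 ≤ (1 - c) * (1 / 2 * inner ℝ (hess f x (z - x)) (z - x)) :=
      mul_nonneg (by linarith) (by linarith)
    have h11 : 0 ≤ G * r := by positivity
    have h12 : (1 - c) * (1 / 2 * inner ℝ (hess f x (z - x)) (z - x)
        + L * (1 / 4 * (r ^ 2 + 2 * 0) ^ 2 + 1 / 2 * 0 ^ 2 * r ^ 2))
        = (1 - c) * (1 / 2 * inner ℝ (hess f x (z - x)) (z - x))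
          + 1 / 4 * ((1 - c) * (L * r ^ 4)) := by ring
    rw [h12] at h4
    linarith
  refine ⟨w, hw, hglob, ?_⟩
  have hloc : IsLocalMin (cubicModel f L x) w := Filter.Eventually.of_forall hglob
  have := hloc.hasFDerivAt_eq_zero (hf.hasGradientAt_cubicModel x w).hasFDerivAt
  simpa using this

/-- On the feasible ball the finite differences reproduce the gradient of the model up to `δ / 2`:
this is what `τ` is chosen for. -/
lemma norm_inexactGrad_sub_le (hf : Regular f L) {δ : ℝ} (hδ : 0 < δ) {x z : Vec n}
    (hx : gradient f x ≠ 0) (hz : z ∈ feasible f L x) :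
    ‖inexactGrad f L δ x z - modelGrad f L x z‖ ≤ δ / 2 := by
  have hG : 0 < ‖gradient f x‖ := norm_pos_iff.2 hx
  set t := tau f δ x with ht
  have ht0 : 0 < t := by rw [ht, tau]; positivity
  set h := z - x with hh
  have e : inexactGrad f L δ x z - modelGrad f L x z
      = (1 / (2 * t ^ 2)) • ((gradient f (x + t • h) - gradient f x - hess f x (t • h)
          - (1 / 2 : ℝ) • third f x (t • h) (t • h))
        + (gradient f (x + (-t) • h) - gradient f x - hess f x ((-t) • h)
          - (1 / 2 : ℝ) • third f x ((-t) • h) ((-t) • h))) := by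
    -- the terms of odd order in `t` cancel
    have e1 : x - t • h = x + (-t) • h := by rw [neg_smul, sub_eq_add_neg]
    have e2 : third f x h h = (1 / (2 * t ^ 2)) • ((t ^ 2 + t ^ 2) • third f x h h) := by
      rw [smul_smul]
      have : 1 / (2 * t ^ 2) * (t ^ 2 + t ^ 2) = 1 := by field_simp; norm_num
      rw [this, one_smul]
    rw [inexactGrad, modelGrad, taylorGrad, thirdDiff, ← hh, ← ht, e1]
    nth_rewrite 1 [e2]
    have e3 : (1 / 2 : ℝ) * (1 / t ^ 2) = 1 / (2 * t ^ 2) := by field_simp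
    have e4 : (1 / 2 : ℝ) * (1 / (2 * t ^ 2)) = 1 / (2 * t ^ 2) * (1 / 2) := by ring
    simp only [map_smul, smul_apply, smul_smul, smul_add, smul_sub]
    match_scalars <;> field_simp <;> ring
  have hb : ∀ s : ℝ, |s| = t → ‖gradient f (x + s • h) - gradient f x - hess f x (s • h)
          - (1 / 2 : ℝ) • third f x (s • h) (s • h)‖ ≤ L / 6 * (t * ‖h‖) ^ 3 := by
    intro s hs
    have := hf.norm_gradient_sub_le x (s • h)
    rwa [norm_smul s h, Real.norm_eq_abs, hs] at this
  have h1 := (norm_add_le _ _).trans (add_le_add (hb t (abs_of_pos ht0))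
    (hb (-t) (by rw [abs_neg, abs_of_pos ht0])))
  rw [e, norm_smul, Real.norm_of_nonneg (by positivity)]
  refine (mul_le_mul_of_nonneg_left h1 (by positivity)).trans ?_
  have h2 : L * ‖h‖ ^ 3 ≤ 8 * (2 + Real.sqrt 2) * ‖gradient f x‖ := by
    rw [← radius_pow_three hf.pos hG.le]
    exact mul_le_mul_of_nonneg_left (pow_le_pow_left₀ (norm_nonneg _) hz 3) hf.pos.le
  have h3 : t * (8 * (2 + Real.sqrt 2) * ‖gradient f x‖) = 3 * δ := by
    rw [ht, tau]; field_simp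
  calc 1 / (2 * t ^ 2) * (L / 6 * (t * ‖h‖) ^ 3 + L / 6 * (t * ‖h‖) ^ 3)
      = t * (L * ‖h‖ ^ 3) / 6 := by field_simp; ring
    _ ≤ 3 * δ / 6 := by
      rw [← h3]
      exact div_le_div_of_nonneg_right (mul_le_mul_of_nonneg_left h2 ht0.le) (by norm_num)
    _ = δ / 2 := by ring

end Regular

/-! ### Inexact stationary points of the model -/

namespace Regular

lemma norm_gradient_sub_taylorGrad_le (hf : Regular f L) (x y : Vec n) :
    ‖gradient f y - taylorGrad f x y‖ ≤ L / 6 * ‖y - x‖ ^ 3 := by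
  have := hf.norm_gradient_sub_le x (y - x)
  rw [add_sub_cancel] at this
  rwa [taylorGrad, ← sub_sub, ← sub_sub]

lemma sub_le_inner_gradient (hf : Regular f L) (xs y : Vec n) :
    f y - f xs ≤ inner ℝ (gradient f y) (y - xs) := by
  have h1 := hf.convex y xs
  rw [← neg_sub y xs, inner_neg_right] at h1
  linarith

/-- At an inexact stationary point `y` of the model the step `y - x` is, up to a fixed relative
error, a step of the gradient method with step size `1 / (L ‖y - x‖²)`. -/
lemma norm_gradient_add_le (hf : Regular f L) {x y : Vec n}
    (hy : ‖modelGrad f L x y‖ ≤ 1 / 6 * ‖gradient f y‖) :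
    ‖gradient f y + (L * ‖y - x‖ ^ 2) • (y - x)‖ ≤ 2 / 5 * (L * ‖y - x‖ ^ 3)
      ∧ ‖gradient f y‖ ≤ 7 / 5 * (L * ‖y - x‖ ^ 3) := by
  have hL := hf.pos
  have h1 := hf.norm_gradient_sub_taylorGrad_le x y
  set N := (L * ‖y - x‖ ^ 2) • (y - x) with hN
  have hNn : ‖N‖ = L * ‖y - x‖ ^ 3 := by
    rw [hN, norm_smul, Real.norm_of_nonneg (by positivity)]; ring
  have e : gradient f y + N = (gradient f y - taylorGrad f x y) + modelGrad f L x y := by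
    rw [modelGrad]; abel
  have h2 : ‖gradient f y + N‖ ≤ L / 6 * ‖y - x‖ ^ 3 + 1 / 6 * ‖gradient f y‖ := by
    rw [e]; exact (norm_add_le _ _).trans (add_le_add h1 hy)
  have h3 : ‖gradient f y‖ ≤ ‖gradient f y + N‖ + ‖N‖ := by
    simpa using norm_sub_le (gradient f y + N) N
  constructor <;> linarith

/-- The step to an inexact stationary point is at most a multiple of the distance of the centre from
a minimizer of `f`. -/
lemma norm_sub_le_of_inexact (hf : Regular f L) {x y xs : Vec n} (hxs : ∀ x, f xs ≤ f x)
    (hy : ‖modelGrad f L x y‖ ≤ 1 / 6 * ‖gradient f y‖) :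
    ‖y - x‖ ≤ 7 / 3 * ‖x - xs‖ := by
  obtain ⟨h1, -⟩ := hf.norm_gradient_add_le hy
  have h2 := hf.sub_le_inner_gradient xs y
  have h0 := hxs y
  set h := y - x with hh
  set p := x - xs with hp
  have e : y - xs = h + p := by rw [hh, hp]; abel
  rw [e] at h2
  have h3 := (real_inner_le_norm (gradient f y + (L * ‖h‖ ^ 2) • h) (h + p)).trans
    (mul_le_mul h1 (norm_add_le h p) (norm_nonneg _) (by have := hf.pos; positivity))
  rw [inner_add_left, inner_smul_left, inner_add_right h, real_inner_self_eq_norm_sq] at h3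
  have h4 := (abs_le.1 (abs_real_inner_le_norm h p)).1
  simp only [RCLike.conj_to_real] at h3
  have hn := norm_nonneg h
  have hpn := norm_nonneg p
  by_contra hcon
  push Not at hcon
  have hpos : 0 < ‖h‖ := lt_of_le_of_lt (by positivity) hcon
  have h5 : L * ‖h‖ ^ 2 * (‖h‖ ^ 2 - ‖h‖ * ‖p‖) ≤ L * ‖h‖ ^ 2 * (‖h‖ ^ 2 + inner ℝ h p) :=
    mul_le_mul_of_nonneg_left (by linarith) (by have := hf.pos; positivity)
  have h6 : 0 < L * ‖h‖ ^ 3 := by have := hf.pos; positivity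
  nlinarith

lemma sub_le_of_inexact (hf : Regular f L) {x y xs : Vec n} (hxs : ∀ x, f xs ≤ f x)
    (hy : ‖modelGrad f L x y‖ ≤ 1 / 6 * ‖gradient f y‖) :
    f y - f xs ≤ 14 / 3 * (L * ‖y - x‖ ^ 3) * ‖x - xs‖ := by
  obtain ⟨-, h1⟩ := hf.norm_gradient_add_le hy
  have h2 := hf.sub_le_inner_gradient xs y
  have h3 := hf.norm_sub_le_of_inexact hxs hy
  have h4 : ‖y - xs‖ ≤ 10 / 3 * ‖x - xs‖ := by
    have := norm_add_le (y - x) (x - xs)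
    rw [sub_add_sub_cancel] at this
    linarith
  have h5 := (real_inner_le_norm (gradient f y) (y - xs)).trans
    (mul_le_mul h1 h4 (norm_nonneg _) (by have := hf.pos; positivity))
  linarith

end Regular

/-! ### Linear convergence of the inner method -/

/-- `InnerIter f L δ x j z`: the inner method at `x` can reach `z` after `j` iterations. -/
inductive InnerIter (f : Vec n → ℝ) (L δ : ℝ) (x : Vec n) : ℕ → Vec n → Prop
  | zero : InnerIter f L δ x 0 x
  | succ {j : ℕ} {z z' : Vec n} (h : InnerIter f L δ x j z) (hz : IsNext f L δ x z z') :
      InnerIter f L δ x (j + 1) z'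

lemma InnerIter.mem_feasible (hL : 0 < L) {δ : ℝ} {x z : Vec n} {j : ℕ}
    (h : InnerIter f L δ x j z) : z ∈ feasible f L x := by
  cases h with
  | zero => exact self_mem_feasible hL x
  | succ h hz => exact hz.1

namespace Regular

/-- The optimality condition of an inner iteration, combined with the three-point identity of the
Bregman distance. -/
lemma three_point (hf : Regular f L) {δ : ℝ} {x z z' w : Vec n} (hz : IsNext f L δ x z z')
    (hw : w ∈ feasible f L x) :
    inner ℝ (inexactGrad f L δ x z) (z' - w) ≤ 2 * (1 + 1 / Real.sqrt 2)
      * (bregman (scaling f L x) z w - bregman (scaling f L x) z z'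
        - bregman (scaling f L x) z' w) := by
  set M := 2 * (1 + 1 / Real.sqrt 2)
  set g := inexactGrad f L δ x z
  have hgrad : HasFDerivAt (fun y => inner ℝ g (y - z) + M * bregman (scaling f L x) z y)
      (innerSL ℝ (g + M • (scalingGrad f L x z' - scalingGrad f L x z))) z' := by
    have h1 : ∀ a : Vec n, HasFDerivAt (fun y => inner ℝ a (y - z)) (innerSL ℝ a) z' := by
      intro a
      have := (innerSL ℝ a).hasFDerivAt.comp z' (hasFDerivAt_sub_right z z')
      rwa [ContinuousLinearMap.comp_id] at this
    have h2 := (h1 g).add ((((hf.hasGradientAt_scaling x z').hasFDerivAt.sub_const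
      (scaling f L x z)).sub (h1 (scalingGrad f L x z))).const_mul M)
    have e : (fun y => inner ℝ g (y - z) + M * bregman (scaling f L x) z y)
        = fun y => inner ℝ g (y - z) + M * (scaling f L x y - scaling f L x z
          - inner ℝ (scalingGrad f L x z) (y - z)) := by
      funext y; rw [hf.bregman_scaling]
    rw [e]
    refine h2.congr_fderiv ?_
    ext v
    simp
  have hconv : Convex ℝ (feasible f L x) := by
    rw [feasible_eq_closedBall]; exact convex_closedBall _ _
  have h3 := hz.2.localize.hasFDerivWithinAt_nonneg hgrad.hasFDerivWithinAt
    (sub_mem_posTangentConeAt_of_segment_subset (hconv.segment_subset hz.1 hw))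
  rw [innerSL_apply_apply, inner_add_left, inner_smul_left, ← neg_sub z' w, inner_neg_right,
    inner_neg_right] at h3
  simp only [RCLike.conj_to_real] at h3
  have h4 : bregman (scaling f L x) z w - bregman (scaling f L x) z z'
      - bregman (scaling f L x) z' w
      = -inner ℝ (scalingGrad f L x z' - scalingGrad f L x z) (z' - w) := by
    simp only [hf.bregman_scaling, inner_sub_left, inner_sub_right]
    ring
  rw [h4]
  linarith

/-- One inner iteration contracts the Bregman distance to the minimizer `w` of the model. -/
lemma inner_step (hf : Regular f L) {δ : ℝ} (hδ : 0 < δ) {x z z' w : Vec n}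
    (hx : gradient f x ≠ 0) (hz : z ∈ feasible f L x) (hz' : IsNext f L δ x z z')
    (hw : w ∈ feasible f L x) (hmin : ∀ y, cubicModel f L x w ≤ cubicModel f L x y) :
    bregman (scaling f L x) z' w ≤ 11 / 12 * bregman (scaling f L x) z w
        + δ * radius L ‖gradient f x‖ / 2
      ∧ cubicModel f L x z' - cubicModel f L x w
        ≤ 4 * bregman (scaling f L x) z w + δ * radius L ‖gradient f x‖ := by
  have h1 := hf.three_point hz' hw
  have h2 := hf.model_le_bregman x z z'
  have h3 := hf.bregman_le_model x z w
  have h4 := hf.norm_inexactGrad_sub_le hδ hx hz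
  have h5 : ‖z' - w‖ ≤ 2 * radius L ‖gradient f x‖ := by
    have h51 := mem_feasible_iff.1 hz'.1
    have h52 := mem_feasible_iff.1 hw
    have := norm_sub_le (z' - x) (w - x)
    rw [sub_sub_sub_cancel_right] at this
    linarith
  have h6 := (abs_le.1 ((abs_real_inner_le_norm (inexactGrad f L δ x z - modelGrad f L x z)
    (z' - w)).trans (mul_le_mul h4 h5 (norm_nonneg _) (by positivity)))).1
  have h7 := hmin z'
  have b1 := hf.bregman_nonneg x z w
  have b2 := hf.bregman_nonneg x z z'
  have b3 := hf.bregman_nonneg x z' w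
  set r := radius L ‖gradient f x‖
  have hr : 0 ≤ r := radius_nonneg hf.pos (norm_nonneg _)
  set c := 1 / Real.sqrt 2 with hc
  have hc0 := inv_sqrt_two_bounds
  rw [← hc] at hc0
  have e : inner ℝ (modelGrad f L x z) (z' - z) - inner ℝ (modelGrad f L x z) (w - z)
      = inner ℝ (modelGrad f L x z) (z' - w) := by
    rw [← inner_sub_right, sub_sub_sub_cancel_right]
  rw [inner_sub_left] at h6
  have hδr : 0 ≤ δ * r := by positivity
  have hgap : cubicModel f L x z' - cubicModel f L x w
      ≤ (1 + 3 * c) * bregman (scaling f L x) z w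
        - 2 * (1 + c) * bregman (scaling f L x) z' w + δ * r := by
    nlinarith
  constructor
  · nlinarith
  · nlinarith

lemma innerIter_bregman_le (hf : Regular f L) {δ : ℝ} (hδ : 0 < δ) {x z w : Vec n} {j : ℕ}
    (hx : gradient f x ≠ 0) (hz : InnerIter f L δ x j z)
    (hw : w ∈ feasible f L x) (hmin : ∀ y, cubicModel f L x w ≤ cubicModel f L x y) :
    bregman (scaling f L x) z w ≤ (11 / 12) ^ j * bregman (scaling f L x) x w
        + 6 * (δ * radius L ‖gradient f x‖) := by
  induction hz with
  | zero =>
    have := radius_nonneg hf.pos (norm_nonneg (gradient f x))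
    have : 0 ≤ δ * radius L ‖gradient f x‖ := by positivity
    linarith
  | succ h hz ih =>
    have := (hf.inner_step hδ hx (h.mem_feasible hf.pos) hz hw hmin).1
    rw [pow_succ]
    linarith

lemma innerIter_gap_le (hf : Regular f L) {δ : ℝ} (hδ : 0 < δ) {x z w : Vec n} {j : ℕ}
    (hx : gradient f x ≠ 0) (hz : InnerIter f L δ x (j + 1) z)
    (hw : w ∈ feasible f L x) (hmin : ∀ y, cubicModel f L x w ≤ cubicModel f L x y) :
    cubicModel f L x z - cubicModel f L x w ≤ 4 * ((11 / 12) ^ j * bregman (scaling f L x) x w)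
        + 25 * (δ * radius L ‖gradient f x‖) := by
  cases hz with
  | succ h hz =>
    have h1 := (hf.inner_step hδ hx (h.mem_feasible hf.pos) hz hw hmin).2
    have h2 := hf.innerIter_bregman_le hδ hx h hw hmin
    linarith

/-- A point where the model is nearly minimal has a small model gradient: a step of length `t`
against the gradient decreases the model by at most its gap. -/
lemma norm_modelGrad_mul_le (hf : Regular f L) {x z w : Vec n} {r t : ℝ}
    (hmin : ∀ y, cubicModel f L x w ≤ cubicModel f L x y) (hz : ‖z - x‖ ≤ r) (ht : 0 ≤ t)
    (htr : t ≤ r) :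
    t * ‖modelGrad f L x z‖ ≤ cubicModel f L x z - cubicModel f L x w
      + (‖hess f x‖ + 11 / 2 * L * r ^ 2) * t ^ 2 := by
  set m := modelGrad f L x z with hm
  have hL := hf.pos
  rcases (norm_nonneg m).eq_or_lt with h0 | h0
  · rw [← h0]
    have := hmin z
    have : 0 ≤ (‖hess f x‖ + 11 / 2 * L * r ^ 2) * t ^ 2 := by positivity
    linarith
  set p := (-(t / ‖m‖)) • m with hp
  have hpn : ‖p‖ = t := by
    rw [hp, norm_smul, norm_neg, Real.norm_of_nonneg (by positivity)]
    field_simp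
  have h1 := hf.model_le_bregman x z (z + p)
  have h2 := hf.bregman_upper (x := x) (u := z) (z := z + p) hz
    (by rw [add_sub_cancel_left, hpn]; exact htr)
  rw [add_sub_cancel_left] at h1 h2
  rw [hpn] at h2
  have h3 : inner ℝ (modelGrad f L x z) p = -(t * ‖m‖) := by
    rw [hp, ← hm, inner_smul_right, real_inner_self_eq_norm_sq]
    field_simp
  rw [h3] at h1
  have h4 := hmin (z + p)
  have hc := inv_sqrt_two_bounds
  have h5 := hf.bregman_nonneg x z (z + p)
  nlinarith

/-- After logarithmically many iterations (the hypothesis `hj`) the inner method is close to the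
minimizer of the model, which itself is within a multiple of `R` of the centre. -/
lemma exists_minimizer_of_innerIter (hf : Regular f L) {δ ε R : ℝ} (hδ : 0 < δ) (hε : 0 < ε)
    (hR : 0 < R) {x z xs : Vec n} {j : ℕ} (hxs : ∀ x, f xs ≤ f x) (hxR : ‖x - xs‖ ≤ 9 / 4 * R)
    (hx : gradient f x ≠ 0)
    (hδr : 10 ^ 9 * (δ * radius L ‖gradient f x‖)
      * (1 + (‖hess f x‖ * R ^ 2 + L * R ^ 4) / ε) ≤ ε)
    (hz : InnerIter f L δ x (j + 1) z)
    (hj : 2 * 10 ^ 10 * (1 + (‖hess f x‖ * R ^ 2 + L * R ^ 4) / ε) ^ 2 * (11 / 12) ^ j ≤ 1) :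
    ∃ w, (∀ y, cubicModel f L x w ≤ cubicModel f L x y) ∧ ‖w - x‖ ≤ 21 / 4 * R ∧
      cubicModel f L x z - cubicModel f L x w
        ≤ ε / (1 + (‖hess f x‖ * R ^ 2 + L * R ^ 4) / ε) / 10 ^ 7 ∧
      bregman (scaling f L x) z w ≤ ε / 10 ^ 7 := by
  have hL := hf.pos
  obtain ⟨w, hw, hmin, hw0⟩ := hf.exists_minimizer x
  set h := ‖hess f x‖ with hh
  have hh0 : 0 ≤ h := norm_nonneg _
  set r := radius L ‖gradient f x‖
  have hr : 0 ≤ r := radius_nonneg hf.pos (norm_nonneg _)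
  set X := (h * R ^ 2 + L * R ^ 4) / ε with hX
  have hX0 : 0 < X := by positivity
  have hXε : h * R ^ 2 + L * R ^ 4 = X * ε := by rw [hX]; field_simp
  set q : ℝ := (11 / 12) ^ j with hq
  have hq0 : 0 < q := by positivity
  have hwx : ‖w - x‖ ≤ 21 / 4 * R := by
    have := hf.norm_sub_le_of_inexact hxs (x := x) (y := w) (by rw [hw0]; simp)
    linarith
  refine ⟨w, hmin, hwx, ?_⟩
  -- the initial Bregman distance is bounded by means of `R`, and not of the feasible ball
  have hβ : bregman (scaling f L x) x w ≤ 190 * (X * ε) := by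
    rw [hf.bregman_eq, sub_self, norm_zero, inner_zero_left, ← hXε]
    have h1 : inner ℝ (hess f x (w - x)) (w - x) ≤ h * (21 / 4 * R) ^ 2 := by
      refine (real_inner_le_norm _ _).trans ?_
      calc _ ≤ (h * ‖w - x‖) * ‖w - x‖ :=
            mul_le_mul_of_nonneg_right ((hess f x).le_opNorm _) (norm_nonneg _)
        _ = h * ‖w - x‖ ^ 2 := by ring
        _ ≤ _ := by gcongr
    have h2 : L * ‖w - x‖ ^ 4 ≤ L * (21 / 4 * R) ^ 4 := by gcongr
    have h3 : 0 ≤ h * R ^ 2 := by positivity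
    have h4 : 0 ≤ L * R ^ 4 := by positivity
    nlinarith
  have hqX : q * X * (1 + X) * (2 * 10 ^ 10) ≤ 1 := by
    refine le_trans ?_ hj
    have : 0 ≤ q * (1 + X) := by positivity
    nlinarith
  have hqX' : q * (X * ε) ≤ ε / (2 * 10 ^ 10 * (1 + X)) := by
    rw [le_div_iff₀ (by positivity)]
    nlinarith
  have hδr' : δ * r ≤ ε / (10 ^ 9 * (1 + X)) := by
    rw [le_div_iff₀ (by positivity)]
    linarith
  have hε1 : ε / (2 * 10 ^ 10 * (1 + X)) = ε / (1 + X) / (2 * 10 ^ 10) := by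
    field_simp
  have hε2 : ε / (10 ^ 9 * (1 + X)) = ε / (1 + X) / 10 ^ 9 := by
    field_simp
  rw [hε1] at hqX'
  rw [hε2] at hδr'
  have hε3 : ε / (1 + X) ≤ ε := div_le_self hε.le (by linarith)
  have hgap := hf.innerIter_gap_le hδ hx hz hw hmin
  have hbr := hf.innerIter_bregman_le hδ hx hz hw hmin
  have hqβ : q * bregman (scaling f L x) x w ≤ 190 * (q * (X * ε)) := by
    calc _ ≤ q * (190 * (X * ε)) := by gcongr
      _ = _ := by ring
  have hqj : (11 / 12 : ℝ) ^ (j + 1) * bregman (scaling f L x) x w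
      ≤ q * bregman (scaling f L x) x w := by
    refine mul_le_mul_of_nonneg_right ?_ (hf.bregman_nonneg x x w)
    rw [hq, pow_succ]
    linarith
  have h1 : 0 < ε / (1 + X) := by positivity
  constructor <;> linarith

/-- After logarithmically many iterations (the hypothesis `hj`), an inner iterate that is not
`ε`-accurate passes the stopping test.  If `L R⁴ ≪ ε`, a near minimizer of the model is
`ε`-accurate, because the model is close to `f` at `xs`; otherwise its model gradient is small
compared with `ε / R`, hence with the gradient of `f`. -/
lemma stops_of_innerIter (hf : Regular f L) {δ ε R : ℝ} (hδ : 0 < δ) (hε : 0 < ε) (hR : 0 < R)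
    {x z xs : Vec n} {j : ℕ} (hxs : ∀ x, f xs ≤ f x) (hxR : ‖x - xs‖ ≤ 9 / 4 * R)
    (hx : gradient f x ≠ 0)
    (hδR : 10 ^ 9 * (δ * R) ≤ ε)
    (hδr : 10 ^ 9 * (δ * radius L ‖gradient f x‖)
      * (1 + (‖hess f x‖ * R ^ 2 + L * R ^ 4) / ε) ≤ ε)
    (hz : InnerIter f L δ x (j + 1) z) (hacc : ε < f z - f xs)
    (hj : 2 * 10 ^ 10 * (1 + (‖hess f x‖ * R ^ 2 + L * R ^ 4) / ε) ^ 2 * (11 / 12) ^ j ≤ 1) :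
    Stops f L δ x z := by
  have hL := hf.pos
  obtain ⟨w, hmin, hwx, hgap', hbr⟩ :=
    hf.exists_minimizer_of_innerIter hδ hε hR hxs hxR hx hδr hz hj
  clear hj hδr
  set h := ‖hess f x‖ with hh
  have hh0 : 0 ≤ h := norm_nonneg _
  set X := (h * R ^ 2 + L * R ^ 4) / ε with hX
  have hX0 : 0 < X := by positivity
  have hXε : h * R ^ 2 + L * R ^ 4 = X * ε := by rw [hX]; field_simp
  have hε3 : ε / (1 + X) ≤ ε := div_le_self hε.le (by linarith)
  by_cases hsmall : 15 * (L * R ^ 4) ≤ ε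
  · exfalso
    have h1 := hf.le_cubicModel x z
    have h2 := hmin xs
    have h3 := hf.cubicModel_le x xs
    have h4 : L * ‖xs - x‖ ^ 4 ≤ L * (9 / 4 * R) ^ 4 := by
      rw [norm_sub_rev] at hxR
      gcongr
    rw [mul_pow] at h4
    linarith
  push Not at hsmall
  have hzw : ‖z - w‖ ≤ R := by
    have h1 := hf.bregman_lower x z w
    rw [norm_sub_rev] at h1
    by_contra hcon
    push Not at hcon
    have h2 : L * R ^ 4 ≤ L * ‖z - w‖ ^ 4 := by gcongr
    linarith
  have hzx : ‖z - x‖ ≤ 25 / 4 * R := by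
    have := norm_add_le (z - w) (w - x)
    rw [sub_add_sub_cancel] at this
    linarith
  have hzxs : ‖z - xs‖ ≤ 17 / 2 * R := by
    have := norm_add_le (z - x) (x - xs)
    rw [sub_add_sub_cancel] at this
    linarith
  have hF : ε < ‖gradient f z‖ * (17 / 2 * R) :=
    hacc.trans_le ((hf.sub_le_inner_gradient xs z).trans ((real_inner_le_norm _ _).trans
      (mul_le_mul_of_nonneg_left hzxs (norm_nonneg _))))
  -- a step of this length changes the model little compared with `ε / R` times the length
  set t := R / (43000 * (1 + X)) with ht
  have ht0 : 0 < t := by positivity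
  have htR : t ≤ R := div_le_self hR.le (by linarith)
  have hm := hf.norm_modelGrad_mul_le hmin hzx ht0.le (by linarith)
  have hR1 : (h + 11 / 2 * L * (25 / 4 * R) ^ 2) * t ^ 2 ≤ t * (ε / (200 * R)) := by
    have e1 : R * (h + 11 / 2 * L * (25 / 4 * R) ^ 2) * t ≤ ε / 200 := by
      have e2 : R * (h + 11 / 2 * L * (25 / 4 * R) ^ 2) * t
          = (h * R ^ 2 + 6875 / 32 * (L * R ^ 4)) / (43000 * (1 + X)) := by
        rw [ht]; field_simp; ring
      rw [e2, div_le_iff₀ (by positivity)]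
      have : 0 ≤ h * R ^ 2 := by positivity
      have e4 : ε / 200 * (43000 * (1 + X)) = 215 * ε + 215 * (X * ε) := by ring
      have : 0 ≤ L * R ^ 4 := by positivity
      linarith
    have e3 : (h + 11 / 2 * L * (25 / 4 * R) ^ 2) * t ≤ ε / (200 * R) := by
      rw [le_div_iff₀ (by positivity)]
      linarith
    calc _ = t * ((h + 11 / 2 * L * (25 / 4 * R) ^ 2) * t) := by ring
      _ ≤ _ := by gcongr
  have hR2 : cubicModel f L x z - cubicModel f L x w ≤ t * (ε / (200 * R)) := by
    refine hgap'.trans ?_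
    have : t * (ε / (200 * R)) = ε / (1 + X) / (43000 * 200) := by
      rw [ht]; field_simp
    rw [this]
    gcongr
    norm_num
  have hm' : ‖modelGrad f L x z‖ ≤ ε / (100 * R) := by
    have : t * ‖modelGrad f L x z‖ ≤ t * (ε / (100 * R)) := by
      have e : ε / (100 * R) = 2 * (ε / (200 * R)) := by field_simp; norm_num
      rw [e]
      linarith
    exact le_of_mul_le_mul_left this ht0
  have hg := hf.norm_inexactGrad_sub_le hδ hx (hz.mem_feasible hf.pos)
  have hg' : ‖inexactGrad f L δ x z‖ ≤ δ / 2 + ε / (100 * R) := by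
    have := norm_add_le (inexactGrad f L δ x z - modelGrad f L x z) (modelGrad f L x z)
    rw [sub_add_cancel] at this
    linarith
  have hδ' : δ ≤ ε / R / 10 ^ 9 := by
    rw [div_div, le_div_iff₀ (by positivity)]
    linarith
  have hF' : ε / R < 17 / 2 * ‖gradient f z‖ := by
    rw [div_lt_iff₀ hR]
    linarith
  have e : ε / (100 * R) = ε / R / 100 := by field_simp
  rw [e] at hg'
  have : 0 < ε / R := by positivity
  rw [Stops]
  linarith

end Regular

/-! ### Step lengths of inexact stationary points with neighbouring centres -/

/-- A residual of relative size `1/6` lies in a ball around a small negative multiple of `N`.  For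
`N` the cubic term of the model gradient, the norm of `r - N` is that of the gradient of `f` up to
the Taylor remainder, whence the constant `0.172 > 1/6`; the slack absorbs a small displacement of
the centre of the model. -/
lemma norm_add_smul_le_of_residual {r N : Vec n}
    (h : 6 * ‖r‖ ≤ ‖r - N‖ + 0.172 * ‖N‖) : ‖r + (1 / 30 : ℝ) • N‖ ≤ 0.2025 * ‖N‖ := by
  have hr := norm_nonneg r
  have hN := norm_nonneg N
  have e1 := norm_sub_sq_real r N
  have e2 := norm_add_sq_real r ((1 / 30 : ℝ) • N)
  rw [inner_smul_right, norm_smul, Real.norm_of_nonneg (by norm_num)] at e2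
  refine abs_le_of_sq_le_sq' ?_ (by positivity) |>.2
  rcases le_total (6 * ‖r‖) (0.172 * ‖N‖) with h1 | h1
  · have h2 := (abs_le.1 (abs_real_inner_le_norm r N)).2
    nlinarith
  · have h3 : (6 * ‖r‖ - 0.172 * ‖N‖) ^ 2 ≤ ‖r - N‖ ^ 2 :=
      pow_le_pow_left₀ (by linarith) (by linarith) 2
    nlinarith [sq_nonneg (‖r‖ - 1.2 * 0.172 * ‖N‖), sq_nonneg ‖N‖]

lemma inner_cube_sub (h₁ h₂ : Vec n) :
    inner ℝ (‖h₂‖ ^ 2 • h₂ - ‖h₁‖ ^ 2 • h₁) (h₂ - h₁)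
      = 1 / 2 * (‖h₂‖ ^ 2 - ‖h₁‖ ^ 2) ^ 2
        + 1 / 2 * (‖h₁‖ ^ 2 + ‖h₂‖ ^ 2) * ‖h₂ - h₁‖ ^ 2 := by
  rw [norm_sub_sq_real]
  simp only [inner_sub_left, inner_sub_right, inner_smul_left, real_inner_self_eq_norm_sq,
    RCLike.conj_to_real, real_inner_comm h₂ h₁]
  ring

/-- The quadratic inequality in `w` has no solution once `b` exceeds `a` by more than 22.25%: its
discriminant is negative. -/
lemma le_of_quadratic_le {a b w : ℝ} (ha : 0 ≤ a) (hb : 0 ≤ b)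
    (h : 31 / 60 * (b ^ 2 - a ^ 2) ^ 2 + 4 / 15 * (a ^ 2 + b ^ 2) * w ^ 2
      ≤ 0.2025 * (a ^ 3 + b ^ 3) * w) : b ≤ 1.2225 * a := by
  by_contra hcon
  push Not at hcon
  obtain ⟨d, hd, rfl⟩ : ∃ d, 0 < d ∧ b = 1.2225 * a + d := ⟨b - 1.2225 * a, by linarith, by ring⟩
  set b := 1.2225 * a + d with hbd
  have hb0 : 0 < b := by positivity
  have h1 : 4 * (31 / 60 * (b ^ 2 - a ^ 2) ^ 2) * (4 / 15 * (a ^ 2 + b ^ 2))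
      ≤ (0.2025 * (a ^ 3 + b ^ 3)) ^ 2 := by
    have hQ : 0 ≤ 4 / 15 * (a ^ 2 + b ^ 2) := by positivity
    nlinarith [sq_nonneg (0.2025 * (a ^ 3 + b ^ 3) - 2 * (4 / 15 * (a ^ 2 + b ^ 2)) * w),
      mul_le_mul_of_nonneg_left h hQ]
  have h2 : 4 * (31 / 60 * (b - a) ^ 2) * (4 / 15 * (a ^ 2 + b ^ 2))
      ≤ (0.2025 * (a ^ 2 - a * b + b ^ 2)) ^ 2 := by
    have hab : 0 < (a + b) ^ 2 := by positivity
    refine le_of_mul_le_mul_left ?_ hab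
    linarith
  have h3 : (0.2025 * (a ^ 2 - a * b + b ^ 2)) ^ 2
      < 4 * (31 / 60 * (b - a) ^ 2) * (4 / 15 * (a ^ 2 + b ^ 2)) := by
    rw [hbd]
    have := mul_nonneg (pow_nonneg ha 3) hd.le
    have := mul_nonneg (pow_nonneg ha 2) (pow_nonneg hd.le 2)
    have := mul_nonneg ha (pow_nonneg hd.le 3)
    have := pow_pos hd 4
    have := pow_nonneg ha 4
    nlinarith
  linarith

lemma perturbation_le {L c D : ℝ} (hL : 0 ≤ L) (hc : 0 ≤ c) (hD : 0 ≤ D)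
    (h : D ≤ 1 / 10 ^ 4 * c) :
    L / 6 * D ^ 3 + L / 2 * D ^ 2 * c + 1 / 2 * (L * D * c * c)
        + (L * (c + D) ^ 2 * D + L * ((2 * c + D) * D) * c) ≤ 4 / 10 ^ 4 * (L * c ^ 3) := by
  calc _ ≤ L / 6 * (1 / 10 ^ 4 * c) ^ 3 + L / 2 * (1 / 10 ^ 4 * c) ^ 2 * c
          + 1 / 2 * (L * (1 / 10 ^ 4 * c) * c * c)
        + (L * (c + 1 / 10 ^ 4 * c) ^ 2 * (1 / 10 ^ 4 * c)
          + L * ((2 * c + 1 / 10 ^ 4 * c) * (1 / 10 ^ 4 * c)) * c) := by gcongr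
    _ ≤ _ := by
      have : 0 ≤ L * c ^ 3 := by positivity
      linarith

namespace Regular

lemma hasFDerivAt_taylorGrad (hf : Regular f L) (x z : Vec n) :
    HasFDerivAt (taylorGrad f x) (hess f x + third f x (z - x)) z := by
  have h1 := (hasFDerivAt_bilinear (hf.third_symm x) x z).const_smul (1 / 2 : ℝ)
  refine (((hasFDerivAt_clm_sub (hess f x) x z).const_add (gradient f x)).add h1).congr_fderiv ?_
  rw [smul_smul]
  norm_num

/-- The Taylor remainder of the gradient is Lipschitz, with the trapezoidal mean of the constants
at the two end points. -/
lemma norm_remainder_sub_le (hf : Regular f L) (x y₁ y₂ : Vec n) :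
    ‖(gradient f y₂ - taylorGrad f x y₂) - (gradient f y₁ - taylorGrad f x y₁)‖
      ≤ L / 4 * (‖y₁ - x‖ ^ 2 + ‖y₂ - x‖ ^ 2) * ‖y₂ - y₁‖ := by
  have hL := hf.pos
  set v := y₂ - y₁ with hv
  set a := ‖y₁ - x‖
  set b := ‖y₂ - x‖
  have hd : ∀ s : ℝ, HasDerivAt (fun t : ℝ =>
      (gradient f (y₁ + t • v) - taylorGrad f x (y₁ + t • v)) - (gradient f y₁ - taylorGrad f x y₁))
      (hess f (y₁ + s • v) v - (hess f x + third f x (y₁ + s • v - x)) v) s := by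
    intro s
    have h1 : HasDerivAt (fun t : ℝ => gradient f (y₁ + t • v)) (hess f (y₁ + s • v) v) s := by
      have h0 := hf.hasFDerivAt_gradient (y₁ + s • v)
      exact HasFDerivAt.comp_hasDerivAt (l := gradient f) s h0 (hasDerivAt_line y₁ v s)
    have h2 := (hf.hasFDerivAt_taylorGrad x (y₁ + s • v)).comp_hasDerivAt s
      (hasDerivAt_line y₁ v s)
    exact (h1.sub h2).sub_const _
  have hconv : ∀ s : ℝ, 0 ≤ s → s ≤ 1 →
      ‖y₁ + s • v - x‖ ^ 2 ≤ a ^ 2 + s * (b ^ 2 - a ^ 2) := by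
    intro s hs hs1
    have e1 : y₁ + s • v - x = (y₁ - x) + s • v := by abel
    have e2 : y₂ - x = (y₁ - x) + v := by rw [hv]; abel
    have h1 := norm_add_sq_real (y₁ - x) (s • v)
    have h2 := norm_add_sq_real (y₁ - x) v
    rw [← e2] at h2
    rw [e1, h1, inner_smul_right, norm_smul, Real.norm_of_nonneg hs]
    change b ^ 2 = a ^ 2 + 2 * inner ℝ (y₁ - x) v + ‖v‖ ^ 2 at h2
    rw [h2]
    change a ^ 2 + _ + _ ≤ _
    nlinarith [mul_nonneg (mul_nonneg hs (sub_nonneg.2 hs1)) (sq_nonneg ‖v‖)]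
  have key := image_norm_le_of_norm_deriv_right_le_deriv_boundary
    (f := fun t : ℝ => (gradient f (y₁ + t • v) - taylorGrad f x (y₁ + t • v))
      - (gradient f y₁ - taylorGrad f x y₁))
    (f' := fun s => hess f (y₁ + s • v) v - (hess f x + third f x (y₁ + s • v - x)) v)
    (a := 0) (b := 1) (B := fun s => L / 2 * ‖v‖ * (s * a ^ 2 + s ^ 2 / 2 * (b ^ 2 - a ^ 2)))
    (B' := fun s => L / 2 * ‖v‖ * (a ^ 2 + s * (b ^ 2 - a ^ 2)))
    (fun s _ => (hd s).continuousAt.continuousWithinAt)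
    (fun s _ => (hd s).hasDerivWithinAt) (by simp)
    (fun s => by
      have := (((hasDerivAt_id s).mul_const (a ^ 2)).add
        (((hasDerivAt_pow 2 s).div_const 2).mul_const (b ^ 2 - a ^ 2))).const_mul (L / 2 * ‖v‖)
      refine this.congr_deriv ?_
      simp)
    (fun s hs => by
      have h1 := hf.norm_hess_sub_le x (y₁ + s • v - x) v
      rw [add_sub_cancel, sub_sub] at h1
      refine h1.trans ?_
      have h2 := hconv s hs.1 hs.2.le
      calc L / 2 * ‖y₁ + s • v - x‖ ^ 2 * ‖v‖ = L / 2 * ‖v‖ * ‖y₁ + s • v - x‖ ^ 2 := by ring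
        _ ≤ _ := by gcongr)
    (Set.right_mem_Icc.2 zero_le_one)
  have e : y₁ + (1 : ℝ) • v = y₂ := by rw [one_smul, hv]; abel
  simp only [e] at key
  refine key.trans (le_of_eq ?_)
  ring

/-- Two (slightly relaxed) inexact stationary points of the same model have steps of nearly the
same length.  The difference of the gradients of `f` at the two points is, up to Taylor remainders
and residuals, the difference of the Taylor gradients, that is, minus that of the cubic terms
`L ‖y - x‖² (y - x)`.  The gradient of `f` being monotone, the remainders and residuals must
outweigh the strong monotonicity of the cubic terms. -/
lemma norm_sub_le_of_inexact_of_inexact (hf : Regular f L) {x y₁ y₂ : Vec n}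
    (h₁ : 6 * ‖modelGrad f L x y₁‖ ≤ ‖gradient f y₁‖)
    (h₂ : 6 * ‖modelGrad f L x y₂‖ ≤ ‖gradient f y₂‖ + 0.0048 * (L * ‖y₂ - x‖ ^ 3)) :
    ‖y₂ - x‖ ≤ 1.2225 * ‖y₁ - x‖ := by
  have hL := hf.pos
  have hball : ∀ y : Vec n,
      6 * ‖modelGrad f L x y‖ ≤ ‖gradient f y‖ + 0.0048 * (L * ‖y - x‖ ^ 3) →
      ‖modelGrad f L x y + (1 / 30 : ℝ) • (L • (‖y - x‖ ^ 2 • (y - x)))‖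
        ≤ 0.2025 * (L * ‖y - x‖ ^ 3) := by
    intro y hy
    have hN : ‖L • (‖y - x‖ ^ 2 • (y - x))‖ = L * ‖y - x‖ ^ 3 := by
      rw [norm_smul, norm_smul, Real.norm_of_nonneg hL.le, Real.norm_of_nonneg (by positivity)]
      ring
    rw [← hN]
    refine norm_add_smul_le_of_residual ?_
    have e : gradient f y = (gradient f y - taylorGrad f x y)
        + (modelGrad f L x y - L • (‖y - x‖ ^ 2 • (y - x))) := by
      rw [modelGrad, mul_smul]; abel
    have h3 := norm_add_le (gradient f y - taylorGrad f x y)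
      (modelGrad f L x y - L • (‖y - x‖ ^ 2 • (y - x)))
    rw [← e] at h3
    have h4 := hf.norm_gradient_sub_taylorGrad_le x y
    have h5 : 0 ≤ L * ‖y - x‖ ^ 3 := by positivity
    rw [hN]
    linarith
  have b1 := hball y₁ (h₁.trans (le_add_of_nonneg_right (by positivity)))
  have b2 := hball y₂ h₂
  have hmono := hf.monotone y₁ y₂
  have hrem := hf.norm_remainder_sub_le x y₁ y₂
  have hcube := inner_cube_sub (y₁ - x) (y₂ - x)
  rw [sub_sub_sub_cancel_right] at hcube
  set v := y₂ - y₁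
  set a := ‖y₁ - x‖
  set b := ‖y₂ - x‖
  set c₁ := ‖y₁ - x‖ ^ 2 • (y₁ - x) with hc1
  set c₂ := ‖y₂ - x‖ ^ 2 • (y₂ - x) with hc2
  set B₁ := modelGrad f L x y₁ + (1 / 30 : ℝ) • (L • c₁) with hB1
  set B₂ := modelGrad f L x y₂ + (1 / 30 : ℝ) • (L • c₂) with hB2
  set E₁ := gradient f y₁ - taylorGrad f x y₁ with hE1
  set E₂ := gradient f y₂ - taylorGrad f x y₂ with hE2
  have e : gradient f y₂ - gradient f y₁
      = (B₂ - B₁) + (E₂ - E₁) - (31 / 30 * L) • (c₂ - c₁) := by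
    rw [hB1, hB2, hE1, hE2, modelGrad, modelGrad, mul_smul, mul_smul, ← hc1, ← hc2]
    module
  rw [e, inner_sub_left, inner_add_left, inner_smul_left] at hmono
  simp only [RCLike.conj_to_real] at hmono
  rw [hcube] at hmono
  have i1 : inner ℝ (B₂ - B₁) v ≤ 0.2025 * (L * a ^ 3 + L * b ^ 3) * ‖v‖ := by
    refine (real_inner_le_norm _ _).trans (mul_le_mul_of_nonneg_right ?_ (norm_nonneg v))
    exact (norm_sub_le _ _).trans (by linarith)
  have i2 := (real_inner_le_norm (E₂ - E₁) v).trans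
    (mul_le_mul_of_nonneg_right hrem (norm_nonneg v))
  refine le_of_quadratic_le (w := ‖v‖) (norm_nonneg _) (norm_nonneg _) ?_
  refine le_of_mul_le_mul_left ?_ hL
  linarith

/-- Moving the centre of the model by a small fraction of the step does not spoil inexact
stationarity.  No bound on the Hessian enters, as the Taylor polynomials at the two centres differ
only by remainders. -/
lemma inexact_of_near_center (hf : Regular f L) {x₁ x₂ y : Vec n}
    (h : 6 * ‖modelGrad f L x₂ y‖ ≤ ‖gradient f y‖)
    (hx : ‖x₂ - x₁‖ ≤ 1 / 10 ^ 4 * ‖y - x₂‖) :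
    6 * ‖modelGrad f L x₁ y‖ ≤ ‖gradient f y‖ + 0.0048 * (L * ‖y - x₁‖ ^ 3) := by
  have hL := hf.pos
  set d := x₂ - x₁ with hd
  set p := y - x₂ with hp
  have e1 : y - x₁ = p + d := by rw [hd, hp]; abel
  have e2 : x₂ = x₁ + d := by rw [hd]; abel
  have r1 := hf.norm_gradient_sub_le x₁ d
  have r2 := hf.norm_hess_sub_le x₁ d p
  have r3 := hf.lip x₂ x₁ p p
  rw [← e2] at r1 r2
  have hexp : third f x₁ (p + d) (p + d)
      = third f x₁ p p + (2 : ℝ) • third f x₁ d p + third f x₁ d d := by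
    simp only [map_add, add_apply]
    rw [hf.third_symm x₁ p d, two_smul]
    abel
  have e : modelGrad f L x₁ y - modelGrad f L x₂ y
      = -(gradient f x₂ - gradient f x₁ - hess f x₁ d - (1 / 2 : ℝ) • third f x₁ d d)
        - (hess f x₂ p - hess f x₁ p - third f x₁ d p)
        - (1 / 2 : ℝ) • (third f x₂ p p - third f x₁ p p)
        + ((L * ‖p + d‖ ^ 2) • d + (L * (‖p + d‖ ^ 2 - ‖p‖ ^ 2)) • p) := by
    rw [modelGrad, modelGrad, taylorGrad, taylorGrad, e1, ← hp, hexp, map_add]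
    module
  set c := ‖p‖
  set D := ‖d‖
  have hc0 : 0 ≤ c := norm_nonneg _
  have hD0 : 0 ≤ D := norm_nonneg _
  have n1 := norm_add_le p d
  have n2 : c - D ≤ ‖p + d‖ := by
    have := norm_sub_le (p + d) d
    rw [add_sub_cancel_right] at this
    change c ≤ _ + D at this
    linarith
  have n3 : |‖p + d‖ ^ 2 - c ^ 2| ≤ (2 * c + D) * D := by
    rw [abs_le]
    have := norm_nonneg (p + d)
    constructor <;> nlinarith
  have n4 : ‖p + d‖ ^ 2 ≤ (c + D) ^ 2 := pow_le_pow_left₀ (norm_nonneg _) n1 2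
  have b4 : ‖(L * ‖p + d‖ ^ 2) • d + (L * (‖p + d‖ ^ 2 - c ^ 2)) • p‖
      ≤ L * (c + D) ^ 2 * D + L * ((2 * c + D) * D) * c := by
    refine (norm_add_le _ _).trans (add_le_add ?_ ?_)
    · rw [norm_smul, Real.norm_of_nonneg (by positivity)]
      gcongr
    · rw [norm_smul, norm_mul, Real.norm_of_nonneg hL.le, Real.norm_eq_abs]
      gcongr
  have b3 : ‖(1 / 2 : ℝ) • (third f x₂ p p - third f x₁ p p)‖ ≤ 1 / 2 * (L * D * c * c) := by
    rw [norm_smul, Real.norm_of_nonneg (by norm_num)]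
    gcongr
  have htot : ‖modelGrad f L x₁ y - modelGrad f L x₂ y‖
      ≤ L / 6 * D ^ 3 + L / 2 * D ^ 2 * c + 1 / 2 * (L * D * c * c)
        + (L * (c + D) ^ 2 * D + L * ((2 * c + D) * D) * c) := by
    rw [e]
    refine (norm_add_le _ _).trans (add_le_add ((norm_sub_le _ _).trans (add_le_add
      ((norm_sub_le _ _).trans (add_le_add ?_ r2)) b3)) b4)
    rw [norm_neg]
    exact r1
  have hfin := perturbation_le hL.le hc0 hD0 hx
  have hlow : (0.9999 * c) ^ 3 ≤ ‖p + d‖ ^ 3 :=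
    pow_le_pow_left₀ (by positivity) (by linarith) 3
  have hlow' : 0.999 * (L * c ^ 3) ≤ L * ‖p + d‖ ^ 3 := by
    calc 0.999 * (L * c ^ 3) ≤ L * (0.9999 * c) ^ 3 := by
          have : 0 ≤ L * c ^ 3 := by positivity
          rw [mul_pow]
          linarith
      _ ≤ _ := by gcongr
  have hn := norm_add_le (modelGrad f L x₁ y - modelGrad f L x₂ y) (modelGrad f L x₂ y)
  rw [sub_add_cancel] at hn
  rw [e1]
  have : 0 ≤ L * c ^ 3 := by positivity
  linarith

/-- Inexact stationary points of the models at two neighbouring centres have steps whose squared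
lengths differ by a factor less than `3/2`.  This is the ratio of the two bounds of the acceptance
test, so that the line search cannot jump over the accepted range. -/
lemma sq_norm_sub_le_of_near_center (hf : Regular f L) {x₁ x₂ y₁ y₂ : Vec n}
    (h₁ : ‖modelGrad f L x₁ y₁‖ ≤ 1 / 6 * ‖gradient f y₁‖)
    (h₂ : ‖modelGrad f L x₂ y₂‖ ≤ 1 / 6 * ‖gradient f y₂‖)
    (hx : ‖x₂ - x₁‖ ≤ 1 / 10 ^ 4 * ‖y₂ - x₂‖) :
    ‖y₂ - x₂‖ ^ 2 ≤ 1.495 * ‖y₁ - x₁‖ ^ 2 := by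
  have h := hf.norm_sub_le_of_inexact_of_inexact (x := x₁) (y₁ := y₁) (y₂ := y₂) (by linarith)
    (hf.inexact_of_near_center (by linarith) hx)
  have h3 := norm_sub_le (y₂ - x₁) (x₂ - x₁)
  rw [sub_sub_sub_cancel_right] at h3
  have h4 : 0.9999 * ‖y₂ - x₂‖ ≤ 1.2225 * ‖y₁ - x₁‖ := by linarith
  have := pow_le_pow_left₀ (by positivity) h4 2
  nlinarith [norm_nonneg (y₁ - x₁)]

end Regular

/-! ### The accelerated outer scheme -/

lemma stepA_sq {lam A : ℝ} (hlam : 0 < lam) (hA : 0 ≤ A) :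
    stepA lam A ^ 2 = lam * (A + stepA lam A) := by
  have h : Real.sqrt (lam ^ 2 + 4 * lam * A) ^ 2 = lam ^ 2 + 4 * lam * A :=
    Real.sq_sqrt (by positivity)
  rw [stepA]
  linear_combination h / 4

lemma le_stepA {lam A : ℝ} (hlam : 0 < lam) (hA : 0 ≤ A) : lam ≤ stepA lam A := by
  have h : lam ≤ Real.sqrt (lam ^ 2 + 4 * lam * A) :=
    Real.le_sqrt_of_sq_le (le_add_of_nonneg_right (by positivity))
  rw [stepA]
  linarith

lemma stepA_pos {lam A : ℝ} (hlam : 0 < lam) (hA : 0 ≤ A) : 0 < stepA lam A :=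
  hlam.trans_le (le_stepA hlam hA)

lemma sqrt_add_le_sqrt_stepA {lam A : ℝ} (hlam : 0 < lam) (hA : 0 ≤ A) :
    Real.sqrt A + Real.sqrt lam / 2 ≤ Real.sqrt (A + stepA lam A) := by
  have h1 := Real.sq_sqrt hA
  have h2 := Real.sq_sqrt hlam.le
  refine Real.le_sqrt_of_sq_le ?_
  have h3 : 2 * (Real.sqrt lam * Real.sqrt A) ≤ Real.sqrt (lam ^ 2 + 4 * lam * A) := by
    refine Real.le_sqrt_of_sq_le ?_
    have : (2 * (Real.sqrt lam * Real.sqrt A)) ^ 2 = 4 * lam * A := by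
      rw [mul_pow, mul_pow, h1, h2]; ring
    rw [this]
    exact le_add_of_nonneg_left (by positivity)
  rw [stepA]
  nlinarith

/-- The weighted inequality of the means, free of roots. -/
lemma le_weighted_mean {s x y : ℝ} (hx : 0 ≤ x) (hy : 0 ≤ y) (h : s ^ 5 ≤ x * y ^ 4) :
    5 * s ≤ x + 4 * y := by
  have h1 := Real.geom_mean_le_arith_mean2_weighted (w₁ := 1 / 5) (w₂ := 4 / 5)
    (by norm_num) (by norm_num) hx hy (by norm_num)
  have h2 : (x ^ (1 / 5 : ℝ) * y ^ (4 / 5 : ℝ)) ^ 5 = x * y ^ 4 := by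
    rw [mul_pow, ← Real.rpow_natCast, ← Real.rpow_natCast, ← Real.rpow_mul hx, ← Real.rpow_mul hy]
    norm_num
  have h3 : s ≤ x ^ (1 / 5 : ℝ) * y ^ (4 / 5 : ℝ) := by
    by_contra hcon
    push Not at hcon
    have := pow_lt_pow_left₀ hcon (by positivity) (n := 5) (by norm_num)
    linarith
  linarith

/-- Hölder's inequality for two summands, with exponents `5` and `5/4`. -/
lemma holder_add {S b W w V v : ℝ} (hS : 0 ≤ S) (hb : 0 ≤ b) (hW : 0 ≤ W) (hw : 0 < w)
    (hV : 0 ≤ V) (hv : 0 < v) (h₁ : S ^ 5 ≤ W * V ^ 4) (h₂ : b ^ 5 ≤ w * v ^ 4) :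
    (S + b) ^ 5 ≤ (W + w) * (V + v) ^ 4 := by
  have hWw : 0 < W + w := by positivity
  have hVv : 0 < V + v := by positivity
  set t := ((W + w) * (V + v) ^ 4) ^ ((1 : ℝ) / 5) with ht
  have ht0 : 0 < t := by positivity
  have ht5 : t ^ 5 = (W + w) * (V + v) ^ 4 := by
    rw [ht, ← Real.rpow_natCast, ← Real.rpow_mul (by positivity)]
    norm_num
  have key : ∀ s x y : ℝ, 0 ≤ x → 0 ≤ y → s ^ 5 ≤ x * y ^ 4 →
      5 * (s / t) ≤ x / (W + w) + 4 * (y / (V + v)) := by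
    intro s x y hx hy h
    refine le_weighted_mean (by positivity) (by positivity) ?_
    rw [div_pow, ht5, div_pow, div_mul_div_comm]
    gcongr
  have k1 := key S W V hW hV h₁
  have k2 := key b w v hw.le hv.le h₂
  have e1 : W / (W + w) + w / (W + w) = 1 := by field_simp
  have e2 : V / (V + v) + v / (V + v) = 1 := by field_simp
  have h3 : (S + b) / t ≤ 1 := by
    rw [add_div]; linarith
  rw [div_le_one ht0] at h3
  rw [← ht5]
  exact pow_le_pow_left₀ (by positivity) h3 5

/-- The Cauchy–Schwarz inequality for two summands, with `a ^ 2 + A ^ 2` enlarged to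
`(A + a) ^ 2`. -/
lemma cauchy_add {Z z P p A a : ℝ} (hP : 0 ≤ P) (hp : 0 ≤ p) (hA : 0 ≤ A) (ha : 0 ≤ a)
    (h₁ : Z ^ 2 ≤ P * A ^ 2) (h₂ : z ^ 2 ≤ p * a ^ 2) :
    (Z + z) ^ 2 ≤ (P + p) * (A + a) ^ 2 := by
  have h3 : 2 * Z * z ≤ P * a ^ 2 + p * A ^ 2 := by
    refine (abs_le_of_sq_le_sq' (b := P * a ^ 2 + p * A ^ 2) ?_ (by positivity)).2
    have := mul_le_mul h₁ h₂ (sq_nonneg z) (by positivity)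
    nlinarith [sq_nonneg (P * a ^ 2 - p * A ^ 2)]
  have h4 : 0 ≤ (P + p) * (2 * A * a) := by positivity
  nlinarith

/-- One step of the growth estimate for `A_k`: here `b` is the fifth root of `A_{k+1}`. -/
lemma growth_step {S b κ : ℝ} {k : ℕ} (hS : 0 ≤ S) (hb : 0 < b) (hκ : 0 ≤ κ)
    (hk : (k : ℝ) ^ 2 ≤ 4 * κ * S) (h : S + b ≤ κ * b ^ 2) :
    ((k + 1 : ℕ) : ℝ) ^ 2 ≤ 4 * κ * (S + b) ∧ ((k + 1 : ℕ) : ℝ) ≤ 2 * κ * b := by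
  have hκ0 : 0 < κ := by
    rcases hκ.eq_or_lt with h0 | h0
    · rw [← h0] at h
      linarith
    · exact h0
  have hk0 : (0 : ℝ) ≤ k := k.cast_nonneg
  set u := 2 * κ * b with hu
  have hu0 : 0 < u := by positivity
  have h1 : (k : ℝ) ^ 2 + 2 * u ≤ u ^ 2 := by
    have := mul_le_mul_of_nonneg_left h (by positivity : 0 ≤ 4 * κ)
    calc (k : ℝ) ^ 2 + 2 * u ≤ 4 * κ * S + 2 * u := by linarith
      _ = 4 * κ * (S + b) := by rw [hu]; ring
      _ ≤ 4 * κ * (κ * b ^ 2) := this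
      _ = u ^ 2 := by rw [hu]; ring
  have hu2 : 2 ≤ u := by nlinarith
  have h2 : (k : ℝ) + 1 ≤ u := by nlinarith
  push_cast
  refine ⟨?_, h2⟩
  have : 4 * κ * (S + b) = 4 * κ * S + 2 * u := by rw [hu]; ring
  rw [this]
  nlinarith

/-- The decrease of the Lyapunov function
`A_k (f(y_k) - f(xs)) + ‖x_k - xs‖² / 2` in one outer iteration. -/
lemma Regular.energy_update (hf : Regular f L) {s : Main n} {lam : ℝ} {y xs : Vec n}
    (hlam : 0 < lam) (hA : 0 ≤ s.A)
    (hy : ‖y - center s lam + lam • gradient f y‖ ≤ 3 / 5 * ‖y - center s lam‖) :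
    (update f s lam y).A * (f (update f s lam y).y - f xs)
        + 1 / 2 * ‖(update f s lam y).x - xs‖ ^ 2
        + 8 / 25 * ((update f s lam y).A * ‖y - center s lam‖ ^ 2 / lam)
      ≤ s.A * (f s.y - f xs) + 1 / 2 * ‖s.x - xs‖ ^ 2 := by
  simp only [update]
  set a := stepA lam s.A with ha
  have ha0 : 0 < a := stepA_pos hlam hA
  have ha2 : a ^ 2 = lam * (s.A + a) := stepA_sq hlam hA
  set g := gradient f y with hg
  set c := center s lam with hc
  have hA' : 0 < s.A + a := by positivity
  have hcc : (s.A + a) • c = s.A • s.y + a • s.x := by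
    rw [hc, center, ← ha, smul_add, smul_smul, smul_smul, mul_div_cancel₀ _ hA'.ne',
      mul_div_cancel₀ _ hA'.ne']
  have h1 := mul_le_mul_of_nonneg_left (hf.convex y s.y) hA
  have h2 := mul_le_mul_of_nonneg_left (hf.convex y xs) ha0.le
  have h3 : ‖s.x - a • g - xs‖ ^ 2
      = ‖s.x - xs‖ ^ 2 - 2 * (a * inner ℝ g (s.x - xs)) + a ^ 2 * ‖g‖ ^ 2 := by
    have : s.x - a • g - xs = (s.x - xs) - a • g := by abel
    rw [this, norm_sub_sq_real, inner_smul_right, norm_smul, mul_pow, Real.norm_eq_abs, sq_abs,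
      real_inner_comm]
  have h4 : s.A * inner ℝ g (s.y - y) + a * inner ℝ g (xs - y) + a * inner ℝ g (s.x - xs)
      = -((s.A + a) * inner ℝ g (y - c)) := by
    have e : inner ℝ g ((s.A + a) • c) = inner ℝ g (s.A • s.y + a • s.x) := by rw [hcc]
    simp only [inner_add_right, inner_smul_right] at e
    simp only [inner_sub_right]
    linear_combination -e
  have h5 : ‖y - c + lam • g‖ ^ 2
      = ‖y - c‖ ^ 2 + 2 * lam * inner ℝ g (y - c) + lam ^ 2 * ‖g‖ ^ 2 := by
    rw [norm_add_sq_real, inner_smul_right, norm_smul, mul_pow, Real.norm_eq_abs, sq_abs,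
      real_inner_comm]
    ring
  have h6 : ‖y - c + lam • g‖ ^ 2 ≤ (3 / 5 * ‖y - c‖) ^ 2 :=
    pow_le_pow_left₀ (norm_nonneg _) hy 2
  rw [h5] at h6
  have h7 : (s.A + a) * (inner ℝ g (y - c) + lam / 2 * ‖g‖ ^ 2)
      ≤ -(8 / 25 * ((s.A + a) * ‖y - c‖ ^ 2 / lam)) := by
    have e1 : inner ℝ g (y - c) + lam / 2 * ‖g‖ ^ 2 ≤ -(8 / 25 * (‖y - c‖ ^ 2 / lam)) := by
      rw [← mul_div_assoc, ← neg_div, le_div_iff₀ hlam]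
      linarith
    calc _ ≤ (s.A + a) * (-(8 / 25 * (‖y - c‖ ^ 2 / lam))) :=
          mul_le_mul_of_nonneg_left e1 hA'.le
      _ = _ := by ring
  rw [← hg] at h1 h2
  rw [h3, ha2]
  linarith

/-- The constant in the growth estimate for `A_k`; its fifth power is `75 L R² / 2`. -/
def growthConst (L R : ℝ) : ℝ := (75 / 2 * L * R ^ 2) ^ ((1 : ℝ) / 5)

lemma growthConst_pow (hL : 0 ≤ L) (R : ℝ) : growthConst L R ^ 5 = 75 / 2 * L * R ^ 2 := by
  rw [growthConst, ← Real.rpow_natCast, ← Real.rpow_mul (by positivity)]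
  norm_num

/-- The invariant of the outer scheme after `k` iterations.  With `λ_i` the accepted values and
`d_i = ‖y_i - x̃_{i-1}‖`, the auxiliary quantities are `P = ∑ A_i d_i² / λ_i`, `V = ∑ √λ_i`,
`W = ∑ A_i / λ_i²`, `S = ∑ A_i^{1/5}` and `Z = ∑ A_i d_i`. -/
structure Progress (f : Vec n → ℝ) (L R : ℝ) (xs : Vec n) (k : ℕ) (s : Main n)
    (P V W S Z : ℝ) : Prop where
  A_nonneg : 0 ≤ s.A
  P_nonneg : 0 ≤ P
  V_nonneg : 0 ≤ V
  W_nonneg : 0 ≤ W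
  S_nonneg : 0 ≤ S
  energy : s.A * (f s.y - f xs) + 1 / 2 * ‖s.x - xs‖ ^ 2 + 8 / 25 * P ≤ 1 / 2 * R ^ 2
  V_le : V ≤ 2 * Real.sqrt s.A
  W_le : W ≤ 3 / 2 * L * P
  holder : S ^ 5 ≤ W * V ^ 4
  growth : (k : ℝ) ^ 2 ≤ 4 * growthConst L R * S
  Z_sq_le : Z ^ 2 ≤ P * s.A ^ 2
  dist_le_Z : s.A * ‖s.y - xs‖ ≤ s.A * R + Z
  dist_le : ‖s.y - xs‖ ≤ 9 / 4 * R
  pow_le : (k : ℝ) ^ 5 ≤ 1200 * L * R ^ 2 * s.A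

namespace Progress

variable {R : ℝ} {xs : Vec n} {k : ℕ} {s : Main n} {P V W S Z : ℝ}

lemma init {x₀ : Vec n} (hR : ‖x₀ - xs‖ ≤ R) :
    Progress f L R xs 0 ⟨0, x₀, x₀⟩ 0 0 0 0 0 where
  A_nonneg := le_rfl
  P_nonneg := le_rfl
  V_nonneg := le_rfl
  W_nonneg := le_rfl
  S_nonneg := le_rfl
  energy := by
    have := pow_le_pow_left₀ (norm_nonneg _) hR 2
    simp only
    linarith
  V_le := by simp
  W_le := by simp
  holder := by simp
  growth := by simp
  Z_sq_le := by simp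
  dist_le_Z := by simp
  dist_le := by
    have := (norm_nonneg _).trans hR
    simp only
    linarith
  pow_le := by simp

lemma dist_x_le (h : Progress f L R xs k s P V W S Z) (hR : 0 ≤ R) (hxs : ∀ x, f xs ≤ f x) :
    ‖s.x - xs‖ ≤ R := by
  have h1 := h.energy
  have h2 := mul_nonneg h.A_nonneg (sub_nonneg.2 (hxs s.y))
  have h3 := h.P_nonneg
  exact (abs_le_of_sq_le_sq' (by linarith) hR).2

lemma center_dist_le (h : Progress f L R xs k s P V W S Z) (hR : 0 ≤ R) (hxs : ∀ x, f xs ≤ f x)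
    {lam : ℝ} (hlam : 0 < lam) : ‖center s lam - xs‖ ≤ 9 / 4 * R := by
  have ha := stepA_pos hlam h.A_nonneg
  have hA := h.A_nonneg
  set a := stepA lam s.A with ha'
  have hA' : 0 < s.A + a := by positivity
  have e : center s lam - xs = (s.A / (s.A + a)) • (s.y - xs) + (a / (s.A + a)) • (s.x - xs) := by
    have : xs = (s.A / (s.A + a)) • xs + (a / (s.A + a)) • xs := by
      rw [← add_smul, ← add_div, div_self hA'.ne', one_smul]
    rw [center, ← ha']
    nth_rewrite 1 [this]
    module
  rw [e]
  refine (norm_add_le _ _).trans ?_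
  rw [norm_smul, norm_smul, Real.norm_of_nonneg (by positivity),
    Real.norm_of_nonneg (by positivity)]
  have h1 := h.dist_le
  have h2 : ‖s.x - xs‖ ≤ 9 / 4 * R := (h.dist_x_le hR hxs).trans (by linarith)
  calc _ ≤ s.A / (s.A + a) * (9 / 4 * R) + a / (s.A + a) * (9 / 4 * R) := by gcongr
    _ = 9 / 4 * R := by field_simp

lemma rate (h : Progress f L R xs k s P V W S Z) (hL : 0 < L) (hk : 1 ≤ k) :
    f s.y - f xs ≤ 600 * (L * R ^ 4) / (k : ℝ) ^ 5 := by
  have hk0 : (0 : ℝ) < (k : ℝ) ^ 5 := by positivity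
  have h1 := h.pow_le
  have hA : 0 < s.A := by
    rcases h.A_nonneg.eq_or_lt with h0 | h0
    · rw [← h0, mul_zero] at h1; linarith
    · exact h0
  have h2 : s.A * (f s.y - f xs) ≤ 1 / 2 * R ^ 2 := by
    have := h.energy
    have := h.P_nonneg
    nlinarith [sq_nonneg ‖s.x - xs‖]
  rw [le_div_iff₀ hk0]
  rcases le_total (f s.y - f xs) 0 with h3 | h3
  · have : (f s.y - f xs) * (k : ℝ) ^ 5 ≤ 0 := mul_nonpos_of_nonpos_of_nonneg h3 hk0.le
    have : 0 ≤ 600 * (L * R ^ 4) := by positivity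
    linarith
  · calc (f s.y - f xs) * (k : ℝ) ^ 5 ≤ (f s.y - f xs) * (1200 * L * R ^ 2 * s.A) := by gcongr
      _ = 1200 * L * R ^ 2 * (s.A * (f s.y - f xs)) := by ring
      _ ≤ 1200 * L * R ^ 2 * (1 / 2 * R ^ 2) := by gcongr
      _ = _ := by ring

end Progress

/-- At an accepted trial the outer iteration is an inexact proximal step with relative error
`3/5`. -/
lemma Regular.norm_proximal_le (hf : Regular f L) {x y : Vec n} {lam : ℝ} (hlam : 0 < lam)
    (hy : ‖modelGrad f L x y‖ ≤ 1 / 6 * ‖gradient f y‖)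
    (h1 : 1 / 2 ≤ lam * (3 * L * ‖y - x‖ ^ 2 / 4)) (h2 : lam * (3 * L * ‖y - x‖ ^ 2 / 4) ≤ 3 / 4) :
    ‖y - x + lam • gradient f y‖ ≤ 3 / 5 * ‖y - x‖ := by
  obtain ⟨h3, -⟩ := hf.norm_gradient_add_le hy
  set h := y - x
  have e : h + lam • gradient f y
      = (1 - lam * (L * ‖h‖ ^ 2)) • h + lam • (gradient f y + (L * ‖h‖ ^ 2) • h) := by
    module
  rw [e]
  refine (norm_add_le _ _).trans ?_
  rw [norm_smul, norm_smul, Real.norm_of_nonneg hlam.le, Real.norm_of_nonneg (by linarith)]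
  have h4 := mul_le_mul_of_nonneg_left h3 hlam.le
  have h5 : 2 / 3 * ‖h‖ ≤ lam * (L * ‖h‖ ^ 2) * ‖h‖ :=
    mul_le_mul_of_nonneg_right (by linarith) (norm_nonneg _)
  linarith

lemma Regular.progress_update (hf : Regular f L) {R : ℝ} {xs : Vec n} {k : ℕ} {s : Main n}
    {P V W S Z : ℝ} (h : Progress f L R xs k s P V W S Z) (hR : 0 ≤ R) (hxs : ∀ x, f xs ≤ f x)
    {lam : ℝ} {y : Vec n} (hlam : 0 < lam)
    (hy : ‖modelGrad f L (center s lam) y‖ ≤ 1 / 6 * ‖gradient f y‖)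
    (h1 : 1 / 2 ≤ lam * (3 * L * ‖y - center s lam‖ ^ 2 / 4))
    (h2 : lam * (3 * L * ‖y - center s lam‖ ^ 2 / 4) ≤ 3 / 4) :
    ∃ P V W S Z, Progress f L R xs (k + 1) (update f s lam y) P V W S Z := by
  have hL := hf.pos
  have hA := h.A_nonneg
  have hen := hf.energy_update (xs := xs) hlam hA (hf.norm_proximal_le hlam hy h1 h2)
  set d := ‖y - center s lam‖ with hd
  set a := stepA lam s.A with ha
  have hd0 : 0 ≤ d := norm_nonneg _
  have ha0 : 0 < a := stepA_pos hlam hA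
  have ha2 : a ^ 2 = lam * (s.A + a) := stepA_sq hlam hA
  have hA'e : (update f s lam y).A = s.A + a := rfl
  have hy'e : (update f s lam y).y = y := rfl
  rw [hA'e, hy'e] at hen
  have hA' : 0 < s.A + a := by positivity
  set p := (s.A + a) * d ^ 2 / lam with hp
  have hp0 : 0 ≤ p := by positivity
  set w := (s.A + a) / lam ^ 2 with hw
  have hw0 : 0 < w := by positivity
  set b := (s.A + a) ^ ((1 : ℝ) / 5) with hb
  have hb0 : 0 < b := by positivity
  have hb5 : b ^ 5 = s.A + a := by
    rw [hb, ← Real.rpow_natCast, ← Real.rpow_mul (by positivity)]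
    norm_num
  have hvs := Real.sq_sqrt hlam.le
  have hv0 : 0 < Real.sqrt lam := Real.sqrt_pos.2 hlam
  have hsA := sqrt_add_le_sqrt_stepA hlam hA
  rw [← ha] at hsA
  have hwp : w ≤ 3 / 2 * L * p := by
    have e : 3 / 2 * L * p = (s.A + a) / lam ^ 2 * (2 * (lam * (3 * L * d ^ 2 / 4))) := by
      rw [hp]; field_simp; ring
    rw [e, hw]
    exact le_mul_of_one_le_right (by positivity) (by linarith)
  have hbwv : b ^ 5 ≤ w * Real.sqrt lam ^ 4 := by
    have : Real.sqrt lam ^ 4 = lam ^ 2 := by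
      calc Real.sqrt lam ^ 4 = (Real.sqrt lam ^ 2) ^ 2 := by ring
        _ = lam ^ 2 := by rw [hvs]
    rw [hb5, this, hw]
    exact le_of_eq (by field_simp)
  have hholder := holder_add h.S_nonneg hb0.le h.W_nonneg hw0 h.V_nonneg hv0 h.holder hbwv
  have hV' : V + Real.sqrt lam ≤ 2 * Real.sqrt (s.A + a) := by
    have := h.V_le
    linarith
  have hfy := mul_nonneg hA'.le (sub_nonneg.2 (hxs y))
  have hP' : P + p ≤ 25 / 16 * R ^ 2 := by
    have h3 := h.energy
    have := sq_nonneg ‖(update f s lam y).x - xs‖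
    linarith
  have hW' : W + w ≤ 75 / 32 * L * R ^ 2 := by
    have h3 := h.W_le
    have h4 := mul_le_mul_of_nonneg_left hP' (by positivity : 0 ≤ 3 / 2 * L)
    linarith
  have hκ0 : 0 ≤ growthConst L R := by rw [growthConst]; positivity
  have hSb : S + b ≤ growthConst L R * b ^ 2 := by
    refine le_of_pow_le_pow_left₀ (n := 5) (by norm_num) (by positivity) ?_
    have hV4 : (V + Real.sqrt lam) ^ 4 ≤ 16 * (s.A + a) ^ 2 := by
      calc _ ≤ (2 * Real.sqrt (s.A + a)) ^ 4 :=
            pow_le_pow_left₀ (add_nonneg h.V_nonneg hv0.le) hV' 4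
        _ = 16 * (Real.sqrt (s.A + a) ^ 2) ^ 2 := by ring
        _ = _ := by rw [Real.sq_sqrt hA'.le]
    calc (S + b) ^ 5 ≤ (W + w) * (V + Real.sqrt lam) ^ 4 := hholder
      _ ≤ 75 / 32 * L * R ^ 2 * (16 * (s.A + a) ^ 2) := by
        gcongr
      _ = (growthConst L R * b ^ 2) ^ 5 := by
        rw [mul_pow, growthConst_pow hL.le, ← pow_mul, mul_comm 2 5, pow_mul, hb5]; ring
  obtain ⟨g1, g2⟩ := growth_step h.S_nonneg hb0 hκ0 h.growth hSb
  have hZ : (Z + (s.A + a) * d) ^ 2 ≤ (P + p) * (s.A + a) ^ 2 := by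
    refine cauchy_add h.P_nonneg hp0 hA ha0.le h.Z_sq_le (le_of_eq ?_)
    rw [ha2, hp]
    field_simp
  have hx := h.dist_x_le hR hxs
  have hdist : (s.A + a) * ‖y - xs‖ ≤ (s.A + a) * R + (Z + (s.A + a) * d) := by
    have e : (s.A + a) • (y - xs) = (s.A + a) • (y - center s lam) + (s.A • (s.y - xs)
        + a • (s.x - xs)) := by
      have hcc : (s.A + a) • center s lam = s.A • s.y + a • s.x := by
        rw [center, ← ha, smul_add, smul_smul, smul_smul, mul_div_cancel₀ _ hA'.ne',
          mul_div_cancel₀ _ hA'.ne']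
      rw [smul_sub, smul_sub, hcc]
      module
    have h3 : ‖(s.A + a) • (y - xs)‖ ≤ (s.A + a) * d + (s.A * ‖s.y - xs‖ + a * ‖s.x - xs‖) := by
      rw [e]
      refine (norm_add_le _ _).trans (add_le_add ?_ ((norm_add_le _ _).trans (add_le_add ?_ ?_)))
      · rw [norm_smul, Real.norm_of_nonneg hA'.le]
      · rw [norm_smul, Real.norm_of_nonneg hA]
      · rw [norm_smul, Real.norm_of_nonneg ha0.le]
    rw [norm_smul, Real.norm_of_nonneg hA'.le] at h3
    have h4 := h.dist_le_Z
    have h5 := mul_le_mul_of_nonneg_left hx ha0.le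
    linarith
  refine ⟨P + p, V + Real.sqrt lam, W + w, S + b, Z + (s.A + a) * d, ?_⟩
  exact
    { A_nonneg := hA'.le
      P_nonneg := add_nonneg h.P_nonneg hp0
      V_nonneg := add_nonneg h.V_nonneg hv0.le
      W_nonneg := add_nonneg h.W_nonneg hw0.le
      S_nonneg := add_nonneg h.S_nonneg hb0.le
      energy := by
        have := h.energy
        rw [hA'e, hy'e]
        linarith
      V_le := hV'
      W_le := by
        have := h.W_le
        linarith
      holder := hholder
      growth := g1
      Z_sq_le := hZ
      dist_le_Z := hdist
      dist_le := by
        have h3 : Z + (s.A + a) * d ≤ 5 / 4 * R * (s.A + a) := by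
          refine (abs_le_of_sq_le_sq' ?_ (by positivity)).2
          calc _ ≤ (P + p) * (s.A + a) ^ 2 := hZ
            _ ≤ 25 / 16 * R ^ 2 * (s.A + a) ^ 2 := by gcongr
            _ = _ := by ring
        rw [hy'e]
        refine le_of_mul_le_mul_left ?_ hA'
        linarith
      pow_le := by
        have h3 := pow_le_pow_left₀ (Nat.cast_nonneg _) g2 5
        rw [mul_pow, mul_pow, growthConst_pow hL.le, hb5] at h3
        rw [hA'e]
        linarith }

/-! ### The line search -/

/-- The bracket for `log λ` after the given rejected trials.  The initial one contains all values
that can be acceptable before accuracy `ε` is reached; a trial whose step is too short moves the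
lower end to the midpoint, any other one the upper end. -/
def bracket (L R ε : ℝ) : List (ℝ × ℝ) → ℝ × ℝ
  | [] => (Real.log (1 / (100 * (L * R ^ 2))),
      Real.log (10 * (1 + 11 * (L * R ^ 4 / ε)) ^ 2 / (L * R ^ 2)))
  | p :: l =>
    let b := bracket L R ε l
    if p.1 * (3 * L * p.2 ^ 2 / 4) < 1 / 2 then ((b.1 + b.2) / 2, b.2) else (b.1, (b.1 + b.2) / 2)

/-- The bisection rule for `λ`, on a logarithmic scale. -/
def bisection (L R ε : ℝ) (l : List (ℝ × ℝ)) : ℝ :=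
  Real.exp (((bracket L R ε l).1 + (bracket L R ε l).2) / 2)

lemma bisection_pos (L R ε : ℝ) (l : List (ℝ × ℝ)) : 0 < bisection L R ε l := Real.exp_pos _

lemma bracket_cons_of_lt {L R ε : ℝ} {p : ℝ × ℝ} {l : List (ℝ × ℝ)}
    (h : p.1 * (3 * L * p.2 ^ 2 / 4) < 1 / 2) :
    bracket L R ε (p :: l)
      = (((bracket L R ε l).1 + (bracket L R ε l).2) / 2, (bracket L R ε l).2) :=
  if_pos h

lemma bracket_cons_of_not_lt {L R ε : ℝ} {p : ℝ × ℝ} {l : List (ℝ × ℝ)}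
    (h : ¬ p.1 * (3 * L * p.2 ^ 2 / 4) < 1 / 2) :
    bracket L R ε (p :: l)
      = ((bracket L R ε l).1, ((bracket L R ε l).1 + (bracket L R ε l).2) / 2) :=
  if_neg h

lemma bracket_width (L R ε : ℝ) (l : List (ℝ × ℝ)) :
    (bracket L R ε l).2 - (bracket L R ε l).1
      = ((bracket L R ε []).2 - (bracket L R ε []).1) / 2 ^ l.length := by
  induction l with
  | nil => simp
  | cons p l ih =>
    rw [List.length_cons, pow_succ, ← div_div, ← ih, bracket]
    split_ifs <;> ring

/-- `StopsAt f L ε xs s lam y`: with the trial value `lam`, the inner method may stop at `y`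
without having reached accuracy `ε`. -/
def StopsAt (f : Vec n → ℝ) (L ε : ℝ) (xs : Vec n) (s : Main n) (lam : ℝ) (y : Vec n) : Prop :=
  ‖modelGrad f L (center s lam) y‖ ≤ 1 / 6 * ‖gradient f y‖ ∧ ε < f y - f xs

/-- The lists of rejected trials that can arise in an outer iteration from `s`, as long as accuracy
`ε` has not been reached. -/
inductive RejectedTrials (f : Vec n → ℝ) (L R ε : ℝ) (xs : Vec n) (s : Main n) :
    List (ℝ × ℝ) → Prop
  | nil : RejectedTrials f L R ε xs s []
  | cons {l : List (ℝ × ℝ)} {y : Vec n} (h : RejectedTrials f L R ε xs s l)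
      (hy : StopsAt f L ε xs s (bisection L R ε l) y)
      (hr : ¬ (1 / 2 ≤ bisection L R ε l
            * (3 * L * ‖y - center s (bisection L R ε l)‖ ^ 2 / 4) ∧
          bisection L R ε l * (3 * L * ‖y - center s (bisection L R ε l)‖ ^ 2 / 4) ≤ 3 / 4)) :
      RejectedTrials f L R ε xs s
        ((bisection L R ε l, ‖y - center s (bisection L R ε l)‖) :: l)

lemma RejectedTrials.lower {R ε : ℝ} {xs : Vec n} {s : Main n} {l : List (ℝ × ℝ)}
    (h : RejectedTrials f L R ε xs s l) :
    (bracket L R ε l).1 = (bracket L R ε []).1 ∨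
      ∃ y, StopsAt f L ε xs s (Real.exp (bracket L R ε l).1) y ∧
        Real.exp (bracket L R ε l).1
          * (3 * L * ‖y - center s (Real.exp (bracket L R ε l).1)‖ ^ 2 / 4) < 1 / 2 := by
  induction h with
  | nil => exact Or.inl rfl
  | @cons l y h hy hr ih =>
    by_cases hlow : bisection L R ε l
        * (3 * L * ‖y - center s (bisection L R ε l)‖ ^ 2 / 4) < 1 / 2
    · right
      rw [bracket_cons_of_lt hlow]
      exact ⟨y, hy, hlow⟩
    · rw [bracket_cons_of_not_lt hlow]
      exact ih

lemma RejectedTrials.upper {R ε : ℝ} {xs : Vec n} {s : Main n} {l : List (ℝ × ℝ)}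
    (h : RejectedTrials f L R ε xs s l) :
    (bracket L R ε l).2 = (bracket L R ε []).2 ∨
      ∃ y, StopsAt f L ε xs s (Real.exp (bracket L R ε l).2) y ∧
        3 / 4 < Real.exp (bracket L R ε l).2
          * (3 * L * ‖y - center s (Real.exp (bracket L R ε l).2)‖ ^ 2 / 4) := by
  induction h with
  | nil => exact Or.inl rfl
  | @cons l y h hy hr ih =>
    by_cases hlow : bisection L R ε l
        * (3 * L * ‖y - center s (bisection L R ε l)‖ ^ 2 / 4) < 1 / 2
    · rw [bracket_cons_of_lt hlow]
      exact ih
    · right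
      rw [bracket_cons_of_not_lt hlow]
      exact ⟨y, hy, lt_of_not_ge fun h => hr ⟨not_lt.1 hlow, h⟩⟩

lemma stepA_mono_ratio {lam₁ lam₂ A : ℝ} (h₁ : 0 < lam₁) (h : lam₁ ≤ lam₂) (hA : 0 ≤ A) :
    stepA lam₁ A ≤ stepA lam₂ A ∧ lam₁ * stepA lam₂ A ≤ lam₂ * stepA lam₁ A := by
  have h₂ := h₁.trans_le h
  constructor
  · rw [stepA, stepA]
    gcongr
  · have hs : lam₁ * Real.sqrt (lam₂ ^ 2 + 4 * lam₂ * A)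
        ≤ lam₂ * Real.sqrt (lam₁ ^ 2 + 4 * lam₁ * A) := by
      refine abs_le_of_sq_le_sq' ?_ (by positivity) |>.2
      rw [mul_pow, mul_pow, Real.sq_sqrt (by positivity), Real.sq_sqrt (by positivity)]
      have : 0 ≤ 4 * lam₁ * lam₂ * A * (lam₂ - lam₁) :=
        mul_nonneg (by positivity) (by linarith)
      linarith
    rw [stepA, stepA]
    linarith

/-- The centre is Lipschitz in `log λ`. -/
lemma norm_center_sub_le {s : Main n} (hA : 0 ≤ s.A) {lam₁ lam₂ : ℝ} (h₁ : 0 < lam₁)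
    (h : lam₁ ≤ lam₂) :
    ‖center s lam₂ - center s lam₁‖ ≤ (1 - lam₁ / lam₂) * ‖s.x - s.y‖ := by
  have h₂ := h₁.trans_le h
  have p₁ := stepA_pos h₁ hA
  have p₂ := stepA_pos h₂ hA
  obtain ⟨m1, m2⟩ := stepA_mono_ratio h₁ h hA
  set a₁ := stepA lam₁ s.A with ha1
  set a₂ := stepA lam₂ s.A with ha2
  have q₁ : 0 < s.A + a₁ := by positivity
  have q₂ : 0 < s.A + a₂ := by positivity
  have e : center s lam₂ - center s lam₁
      = (s.A * (a₂ - a₁) / ((s.A + a₁) * (s.A + a₂))) • (s.x - s.y) := by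
    rw [center, center, ← ha1, ← ha2]
    match_scalars <;> field_simp <;> ring
  rw [e, norm_smul, Real.norm_of_nonneg
    (div_nonneg (mul_nonneg hA (by linarith)) (by positivity))]
  refine mul_le_mul_of_nonneg_right ?_ (norm_nonneg _)
  have e1 : 1 - lam₁ / lam₂ = (lam₂ - lam₁) / lam₂ := by field_simp
  rw [e1, div_le_div_iff₀ (by positivity) h₂]
  have i1 : (a₂ - a₁) * lam₂ ≤ a₂ * (lam₂ - lam₁) := by linarith
  have i2 : s.A * a₂ ≤ (s.A + a₁) * (s.A + a₂) := by nlinarith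
  calc s.A * (a₂ - a₁) * lam₂ = s.A * ((a₂ - a₁) * lam₂) := by ring
    _ ≤ s.A * (a₂ * (lam₂ - lam₁)) := by gcongr
    _ = (lam₂ - lam₁) * (s.A * a₂) := by ring
    _ ≤ (lam₂ - lam₁) * ((s.A + a₁) * (s.A + a₂)) :=
      mul_le_mul_of_nonneg_left i2 (by linarith)

namespace Regular

/-- A step that ends at an inaccurate point is not too short. -/
lemma le_norm_sub_of_stopsAt (hf : Regular f L) {R ε : ℝ} {xs y : Vec n} {s : Main n} {lam : ℝ}
    (hR : 0 < R) (hε : 0 < ε) (hxs : ∀ x, f xs ≤ f x) (hc : ‖center s lam - xs‖ ≤ 9 / 4 * R)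
    (hy : StopsAt f L ε xs s lam y) :
    R / (1 + 11 * (L * R ^ 4 / ε)) ≤ ‖y - center s lam‖ := by
  have hL := hf.pos
  have h1 := hf.sub_le_of_inexact hxs hy.1
  set d := ‖y - center s lam‖
  have hd : 0 ≤ d := norm_nonneg _
  have h2 : ε < 21 / 2 * (L * R * d ^ 3) := by
    have : 14 / 3 * (L * d ^ 3) * ‖center s lam - xs‖ ≤ 14 / 3 * (L * d ^ 3) * (9 / 4 * R) := by
      gcongr
    linarith [hy.2]
  set u := 1 + 11 * (L * R ^ 4 / ε) with hu
  have hu1 : 1 ≤ u := le_add_of_nonneg_right (by positivity)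
  by_contra hcon
  push Not at hcon
  have h3 : d ^ 3 ≤ R ^ 3 / u := by
    calc d ^ 3 ≤ (R / u) ^ 3 := pow_le_pow_left₀ hd hcon.le 3
      _ = R ^ 3 / u ^ 3 := div_pow _ _ _
      _ ≤ R ^ 3 / u := by
        gcongr
        exact le_self_pow₀ hu1 (by norm_num)
  have h4 : L * R * d ^ 3 ≤ L * R * (R ^ 3 / u) := by gcongr
  have h5 : L * R * (R ^ 3 / u) = L * R ^ 4 / u := by ring
  have h6 : ε * u < 21 / 2 * (L * R ^ 4) := by
    have h7 : ε < 21 / 2 * (L * R ^ 4) / u := by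
      rw [mul_div_assoc]; linarith
    rwa [lt_div_iff₀ (by positivity)] at h7
  have h8 : ε * u = ε + 11 * (L * R ^ 4) := by rw [hu]; field_simp
  have : 0 < L * R ^ 4 := by positivity
  linarith

/-- Before accuracy `ε` is reached, the bracket of the line search cannot become short. -/
lemma lt_bracket_width (hf : Regular f L) {R ε : ℝ} {xs : Vec n} {s : Main n}
    {l : List (ℝ × ℝ)} (hR : 0 < R) (hε : 0 < ε) (hxs : ∀ x, f xs ≤ f x) (hA : 0 ≤ s.A)
    (hx : ‖s.x - xs‖ ≤ R) (hy : ‖s.y - xs‖ ≤ 9 / 4 * R)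
    (hc : ∀ lam, 0 < lam → ‖center s lam - xs‖ ≤ 9 / 4 * R)
    (h : RejectedTrials f L R ε xs s l) :
    1 / 10 ^ 5 / (1 + 11 * (L * R ^ 4 / ε)) < (bracket L R ε l).2 - (bracket L R ε l).1 := by
  have hL := hf.pos
  by_contra hcon
  push Not at hcon
  set u := 1 + 11 * (L * R ^ 4 / ε) with hu
  have hu1 : 1 ≤ u := le_add_of_nonneg_right (by positivity)
  have hLR : 0 < L * R ^ 2 := by positivity
  have hlow0 : (bracket L R ε []).1 = Real.log (1 / (100 * (L * R ^ 2))) := rfl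
  have hupp0 : (bracket L R ε []).2 = Real.log (10 * u ^ 2 / (L * R ^ 2)) := rfl
  have hw0 : 1 < (bracket L R ε []).2 - (bracket L R ε []).1 := by
    rw [hlow0, hupp0, ← Real.log_div (by positivity) (by positivity),
      Real.lt_log_iff_exp_lt (by positivity)]
    have e : 10 * u ^ 2 / (L * R ^ 2) / (1 / (100 * (L * R ^ 2))) = 1000 * u ^ 2 := by
      field_simp; norm_num
    rw [e]
    have := Real.exp_one_lt_three
    nlinarith
  have hw : 0 < (bracket L R ε l).2 - (bracket L R ε l).1 := by
    rw [bracket_width]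
    have : 0 < (bracket L R ε []).2 - (bracket L R ε []).1 := by linarith
    positivity
  have hwle : (bracket L R ε l).2 - (bracket L R ε l).1 ≤ 1 / 10 ^ 5 :=
    hcon.trans (div_le_self (by norm_num) hu1)
  set b₁ := (bracket L R ε l).1 with hb1
  set b₂ := (bracket L R ε l).2 with hb2
  have hratio : 1 - (b₂ - b₁) ≤ Real.exp b₁ / Real.exp b₂ := by
    rw [← Real.exp_sub]
    have := Real.add_one_le_exp (b₁ - b₂)
    linarith
  set lam₁ := Real.exp b₁ with hl1
  set lam₂ := Real.exp b₂ with hl2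
  have p₁ : 0 < lam₁ := Real.exp_pos _
  have p₂ : 0 < lam₂ := Real.exp_pos _
  have hlle : lam₁ ≤ lam₂ := Real.exp_le_exp.2 (by linarith)
  have hl : 0.9999 * lam₂ ≤ lam₁ := by
    rw [← le_div_iff₀ p₂]
    linarith
  rcases h.lower with h1 | ⟨y₁, hy₁, h1⟩ <;> rcases h.upper with h2 | ⟨y₂, hy₂, h2⟩
  · rw [← h1, ← h2] at hw0
    linarith
  · -- the lower end is the initial one: steps are never long enough for so small a value
    have e1 : lam₁ = 1 / (100 * (L * R ^ 2)) := by
      rw [hl1, hb1, h1, hlow0, Real.exp_log (by positivity)]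
    have h3 := hf.norm_sub_le_of_inexact hxs hy₂.1
    have h4 := hc lam₂ p₂
    have h5 : ‖y₂ - center s lam₂‖ ≤ 21 / 4 * R := by linarith
    have h6 : lam₂ * (3 * L * ‖y₂ - center s lam₂‖ ^ 2 / 4)
        ≤ lam₂ * (3 * L * (21 / 4 * R) ^ 2 / 4) := by gcongr
    have h7 : lam₁ * (100 * (L * R ^ 2)) = 1 := by rw [e1]; field_simp
    have h8 := mul_le_mul_of_nonneg_right hl hLR.le
    linarith
  · -- the upper end is the initial one: steps are never short enough for so large a value
    have e1 : lam₂ = 10 * u ^ 2 / (L * R ^ 2) := by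
      rw [hl2, hb2, h2, hupp0, Real.exp_log (by positivity)]
    have h3 := hf.le_norm_sub_of_stopsAt hR hε hxs (hc lam₁ p₁) hy₁
    rw [← hu] at h3
    have h4 : lam₁ * (3 * L * (R / u) ^ 2 / 4)
        ≤ lam₁ * (3 * L * ‖y₁ - center s lam₁‖ ^ 2 / 4) := by gcongr
    have h5 : lam₂ * (3 * L * (R / u) ^ 2 / 4) = 15 / 2 := by
      rw [e1]; field_simp; norm_num
    have h6 := mul_le_mul_of_nonneg_right hl (by positivity : 0 ≤ 3 * L * (R / u) ^ 2 / 4)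
    linarith
  · have h3 := hf.le_norm_sub_of_stopsAt hR hε hxs (hc lam₂ p₂) hy₂
    rw [← hu] at h3
    have h4 := norm_center_sub_le hA p₁ hlle
    have h5 : ‖s.x - s.y‖ ≤ 13 / 4 * R := by
      have := norm_sub_le (s.x - xs) (s.y - xs)
      rw [sub_sub_sub_cancel_right] at this
      linarith
    have h6 : ‖center s lam₂ - center s lam₁‖ ≤ 1 / 10 ^ 4 * ‖y₂ - center s lam₂‖ := by
      calc _ ≤ (1 - lam₁ / lam₂) * ‖s.x - s.y‖ := h4
        _ ≤ (1 / 10 ^ 5 / u) * (13 / 4 * R) := by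
          gcongr
          linarith
        _ = 13 / 40 * (1 / 10 ^ 4 * (R / u)) := by ring
        _ ≤ 1 / 10 ^ 4 * (R / u) := by
          have : 0 < R / u := by positivity
          linarith
        _ ≤ _ := by gcongr
    have h7 := hf.sq_norm_sub_le_of_near_center hy₁.1 hy₂.1 h6
    set d₁ := ‖y₁ - center s lam₁‖ ^ 2
    set d₂ := ‖y₂ - center s lam₂‖ ^ 2
    have hd1 : 0 ≤ d₁ := sq_nonneg _
    have i1 : L * lam₂ * d₂ ≤ L * lam₂ * (1.495 * d₁) := by gcongr
    have i2 : L * d₁ * (0.9999 * lam₂) ≤ L * d₁ * lam₁ := by gcongr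
    linarith

/-- Before accuracy `ε` is reached, the line search makes only logarithmically many trials. -/
lemma length_rejected_le (hf : Regular f L) {R ε : ℝ} {xs : Vec n} {s : Main n}
    {l : List (ℝ × ℝ)} (hR : 0 < R) (hε : 0 < ε) (hxs : ∀ x, f xs ≤ f x) (hA : 0 ≤ s.A)
    (hx : ‖s.x - xs‖ ≤ R) (hy : ‖s.y - xs‖ ≤ 9 / 4 * R)
    (hc : ∀ lam, 0 < lam → ‖center s lam - xs‖ ≤ 9 / 4 * R)
    (h : RejectedTrials f L R ε xs s l) :
    (l.length : ℝ) ≤ 48 * Real.log (Real.exp 1 + L * R ^ 4 / ε) := by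
  have hL := hf.pos
  have h1 := hf.lt_bracket_width hR hε hxs hA hx hy hc h
  rw [bracket_width] at h1
  have hlow0 : (bracket L R ε []).1 = Real.log (1 / (100 * (L * R ^ 2))) := rfl
  have hupp0 : (bracket L R ε []).2
    = Real.log (10 * (1 + 11 * (L * R ^ 4 / ε)) ^ 2 / (L * R ^ 2)) := rfl
  set q := L * R ^ 4 / ε with hq
  have hq0 : 0 < q := by positivity
  have he := Real.exp_one_gt_d9
  set v := Real.exp 1 + q with hv
  have hv1 : 1 ≤ v := by linarith
  have huv : 1 + 11 * q ≤ 11 * v := by linarith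
  have hwid : (bracket L R ε []).2 - (bracket L R ε []).1 ≤ 1000 * (1 + 11 * q) ^ 2 := by
    rw [hlow0, hupp0, ← Real.log_div (by positivity) (by positivity)]
    have e : 10 * (1 + 11 * q) ^ 2 / (L * R ^ 2) / (1 / (100 * (L * R ^ 2)))
        = 1000 * (1 + 11 * q) ^ 2 := by
      field_simp; norm_num
    rw [e]
    exact Real.log_le_self (by positivity)
  have h2 : (2 : ℝ) ^ l.length ≤ Real.exp 30 * v ^ 3 := by
    rw [div_lt_div_iff₀ (by positivity) (by positivity)] at h1
    have h3 : (2 : ℝ) ^ l.length ≤ 10 ^ 5 * (1000 * (1 + 11 * q) ^ 2 * (1 + 11 * q)) := by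
      have := mul_le_mul_of_nonneg_right hwid (by positivity : 0 ≤ 1 + 11 * q)
      linarith
    have h4 : (1 + 11 * q) ^ 3 ≤ (11 * v) ^ 3 := pow_le_pow_left₀ (by positivity) huv 3
    have h5 : (133100000000 : ℝ) ≤ Real.exp 30 := by
      have e : Real.exp 30 = Real.exp 1 ^ 30 := by
        rw [← Real.exp_nat_mul]; norm_num
      rw [e]
      calc (133100000000 : ℝ) ≤ (2.7 : ℝ) ^ 30 := by norm_num
        _ ≤ _ := pow_le_pow_left₀ (by norm_num) (by linarith) 30
    have h6 := mul_le_mul_of_nonneg_right h5 (by positivity : 0 ≤ v ^ 3)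
    rw [mul_pow] at h4
    linarith
  have hlv : 1 ≤ Real.log v := by
    rw [Real.le_log_iff_exp_le (by positivity)]
    linarith
  have h3 := Real.log_le_log (by positivity) h2
  rw [Real.log_mul (Real.exp_pos _).ne' (by positivity), Real.log_exp, Real.log_pow,
    Real.log_pow] at h3
  have h4 := Real.log_two_gt_d9
  have h5 : (0 : ℝ) ≤ l.length := Nat.cast_nonneg _
  push_cast at h3
  nlinarith

/-- An inner iterate that passes the stopping test is an inexact stationary point of the model.  The
test cannot be passed if the gradient at the centre vanishes. -/
lemma norm_modelGrad_le_of_stops (hf : Regular f L) {δ : ℝ} (hδ : 0 < δ) {x z : Vec n}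
    (hz : z ∈ feasible f L x) (hs : Stops f L δ x z) :
    ‖modelGrad f L x z‖ ≤ 1 / 6 * ‖gradient f z‖ := by
  rw [Stops] at hs
  by_cases hx : gradient f x = 0
  · exfalso
    rw [mem_feasible_iff, hx, norm_zero, radius, mul_zero,
      Real.zero_rpow (by norm_num), mul_zero] at hz
    have e : z = x := sub_eq_zero.1 (norm_le_zero_iff.1 hz)
    rw [e, hx, norm_zero] at hs
    linarith [norm_nonneg (inexactGrad f L δ x x)]
  · have h1 := hf.norm_inexactGrad_sub_le hδ hx hz
    have h2 := norm_sub_le (inexactGrad f L δ x z) (inexactGrad f L δ x z - modelGrad f L x z)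
    rw [sub_sub_cancel] at h2
    linarith

end Regular

/-! ### The tolerance and the number of inner iterations -/

/-- The tolerance of the inner method.  It enters the complexity only through the condition to be
small, so that no attempt is made to take it large; the value `1` for meaningless arguments is
never used. -/
def tolerance (L R ε g h : ℝ) : ℝ :=
  if 0 < ε / (10 ^ 9 * (1 + (h * R ^ 2 + L * R ^ 4) / ε) * (1 + R + radius L g)) then
    ε / (10 ^ 9 * (1 + (h * R ^ 2 + L * R ^ 4) / ε) * (1 + R + radius L g))
  else 1

lemma tolerance_pos (L R ε g h : ℝ) : 0 < tolerance L R ε g h := by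
  rw [tolerance]
  split_ifs with h0
  · exact h0
  · exact one_pos

lemma tolerance_le {R ε g h : ℝ} (hL : 0 < L) (hR : 0 ≤ R) (hε : 0 < ε) (hg : 0 ≤ g) (hh : 0 ≤ h) :
    10 ^ 9 * (tolerance L R ε g h * R) ≤ ε ∧
      10 ^ 9 * (tolerance L R ε g h * radius L g) * (1 + (h * R ^ 2 + L * R ^ 4) / ε) ≤ ε := by
  have hr := radius_nonneg hL hg
  set r := radius L g with hr'
  set U := 1 + (h * R ^ 2 + L * R ^ 4) / ε with hU
  have hU1 : 1 ≤ U := le_add_of_nonneg_right (by positivity)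
  have ht : tolerance L R ε g h = ε / (10 ^ 9 * U * (1 + R + r)) := by
    rw [tolerance, if_pos]
    positivity
  rw [ht]
  have e1 : 10 ^ 9 * (ε / (10 ^ 9 * U * (1 + R + r)) * R) = ε * (R / (U * (1 + R + r))) := by
    field_simp
  have e2 : 10 ^ 9 * (ε / (10 ^ 9 * U * (1 + R + r)) * r) * U = ε * (r / (1 + R + r)) := by
    field_simp
  rw [e1, e2]
  constructor
  · refine mul_le_of_le_one_right hε.le ?_
    rw [div_le_one (by positivity)]
    nlinarith
  · refine mul_le_of_le_one_right hε.le ?_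
    rw [div_le_one (by positivity)]
    linarith

/-- A bound for the number of inner iterations in one trial, where `h` bounds the Hessian at the
centre. -/
def innerBound (L R ε h : ℝ) : ℝ := 290 + 24 * Real.log (1 + (h * R ^ 2 + L * R ^ 4) / ε)

lemma one_le_innerBound {R ε h : ℝ} (hL : 0 ≤ L) (hε : 0 < ε) (hh : 0 ≤ h) :
    1 ≤ innerBound L R ε h := by
  have : 0 ≤ Real.log (1 + (h * R ^ 2 + L * R ^ 4) / ε) :=
    Real.log_nonneg (le_add_of_nonneg_right (by positivity))
  rw [innerBound]
  linarith

lemma add_two_le_of_one_lt_geometric {U : ℝ} (hU : 1 ≤ U) {j : ℕ}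
    (h : 1 < 2 * 10 ^ 10 * U ^ 2 * (11 / 12) ^ j) : (j : ℝ) + 2 ≤ 290 + 24 * Real.log U := by
  have h1 := Real.log_le_log one_pos h.le
  rw [Real.log_one, Real.log_mul (by positivity) (by positivity),
    Real.log_mul (by positivity) (by positivity), Real.log_pow, Real.log_pow] at h1
  have h2 : Real.log (2 * 10 ^ 10) ≤ 24 := by
    rw [Real.log_le_iff_le_exp (by norm_num)]
    have e : Real.exp 24 = Real.exp 1 ^ 24 := by
      rw [← Real.exp_nat_mul]; norm_num
    rw [e]
    have he := Real.exp_one_gt_d9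
    calc (2 * 10 ^ 10 : ℝ) ≤ (2.7 : ℝ) ^ 24 := by norm_num
      _ ≤ _ := pow_le_pow_left₀ (by norm_num) (by linarith) 24
  have h3 : Real.log (11 / 12) ≤ -(1 / 12) := by
    have := Real.log_le_sub_one_of_pos (show (0 : ℝ) < 11 / 12 by norm_num)
    linarith
  have h4 := mul_le_mul_of_nonneg_left h3 (Nat.cast_nonneg j : (0 : ℝ) ≤ j)
  push_cast at h1
  generalize Real.log (2 * 10 ^ 10) = a at h1 h2
  generalize (j : ℝ) * Real.log (11 / 12) = b at h1 h4
  linarith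

lemma Regular.gradient_center_ne_zero (hf : Regular f L) {ε : ℝ} {x z xs : Vec n} (hε : 0 < ε)
    (hz : z ∈ feasible f L x) (hacc : ε < f z - f xs) : gradient f x ≠ 0 := by
  intro hx
  rw [mem_feasible_iff, hx, norm_zero, radius, mul_zero, Real.zero_rpow (by norm_num),
    mul_zero] at hz
  have e : z = x := sub_eq_zero.1 (norm_le_zero_iff.1 hz)
  have := hf.sub_le_inner_gradient xs z
  rw [e, hx, inner_zero_left] at this
  rw [e] at hacc
  linarith

/-- An inner method that has neither stopped nor reached accuracy `ε` is at one of its first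
iterations. -/
lemma Regular.succ_le_innerBound (hf : Regular f L) {R ε h : ℝ} {x z xs : Vec n} {j : ℕ}
    (hR : 0 < R) (hε : 0 < ε) (hxs : ∀ x, f xs ≤ f x) (hxR : ‖x - xs‖ ≤ 9 / 4 * R)
    (hh : ‖hess f x‖ ≤ h)
    (hz : InnerIter f L (tolerance L R ε ‖gradient f x‖ ‖hess f x‖) x j z)
    (hacc : ε < f z - f xs)
    (hs : ¬ Stops f L (tolerance L R ε ‖gradient f x‖ ‖hess f x‖) x z) :
    ((j + 1 : ℕ) : ℝ) ≤ innerBound L R ε h := by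
  have hL := hf.pos
  have hh0 := (norm_nonneg _).trans hh
  cases j with
  | zero =>
    have := one_le_innerBound (R := R) hL.le hε hh0
    push_cast
    linarith
  | succ j =>
    have hx := hf.gradient_center_ne_zero hε (hz.mem_feasible hL) hacc
    obtain ⟨t1, t2⟩ := tolerance_le hL hR.le hε (norm_nonneg (gradient f x))
      (norm_nonneg (hess f x))
    have hU : 1 + (‖hess f x‖ * R ^ 2 + L * R ^ 4) / ε ≤ 1 + (h * R ^ 2 + L * R ^ 4) / ε := by
      gcongr
    have h1 : 1 < 2 * 10 ^ 10 * (1 + (h * R ^ 2 + L * R ^ 4) / ε) ^ 2 * (11 / 12) ^ j := by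
      by_contra hcon
      push Not at hcon
      refine hs (hf.stops_of_innerIter (tolerance_pos _ _ _ _ _) hε hR hxs hxR hx t1 t2 hz hacc
        (le_trans ?_ hcon))
      gcongr
    have h2 := add_two_le_of_one_lt_geometric (le_add_of_nonneg_right (by positivity)) h1
    rw [innerBound]
    push_cast
    linarith

/-! ### Invariants of the executions -/

/-- Properties that hold in every execution. -/
structure Valid (f : Vec n → ℝ) (L R ε : ℝ) (xs : Vec n) (c : Config n) : Prop where
  lam_eq : c.lam = bisection L R ε c.rejected
  mem : c.z ∈ feasible f L c.center
  progress : ∃ P V W S Z, Progress f L R xs c.iter c.main P V W S Z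

/-- Properties that hold as long as accuracy `ε` has not been reached. -/
structure Counted (f : Vec n → ℝ) (L R ε : ℝ) (xs : Vec n) (c : Config n) : Prop where
  rejected : RejectedTrials f L R ε xs c.main c.rejected
  main : 1 ≤ c.iter → ε < f c.main.y - f xs
  hessians_le : (c.hessians : ℝ)
    ≤ c.iter * (48 * Real.log (Real.exp 1 + L * R ^ 4 / ε) + 1) + c.rejected.length + 1

/-- The bound for the number of gradients in terms of the number of Hessians, as long as accuracy
`ε` has not been reached; `h` bounds the Hessians at the centres.  With `K = innerBound L R ε h`,
the current trial has cost `4 + 3 j` gradients, and each of the `hessians - 1` earlier ones at most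
`4 + 3 K`. -/
def GradientsCounted (f : Vec n → ℝ) (L R ε h : ℝ) (c : Config n) : Prop :=
  ∃ j : ℕ, InnerIter f L (c.delta (tolerance L R ε) f) c.center j c.z ∧
    (j : ℝ) ≤ innerBound L R ε h ∧
    (c.gradients : ℝ) + (4 + 3 * innerBound L R ε h)
      ≤ c.hessians * (4 + 3 * innerBound L R ε h) + 4 + 3 * j

section Steps

variable {R ε h : ℝ} {xs : Vec n} {c c' : Config n}

lemma Valid.lam_pos (hv : Valid f L R ε xs c) : 0 < c.lam := by
  rw [hv.lam_eq]
  exact bisection_pos _ _ _ _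

lemma Regular.valid_initial (hf : Regular f L) {x₀ : Vec n} (hR : ‖x₀ - xs‖ ≤ R) :
    Valid f L R ε xs (initial (bisection L R ε) x₀) where
  lam_eq := rfl
  mem := self_mem_feasible hf.pos _
  progress := ⟨0, 0, 0, 0, 0, Progress.init hR⟩

lemma Regular.inexact_of_valid (hf : Regular f L) (hv : Valid f L R ε xs c)
    (hs : Stops f L (c.delta (tolerance L R ε) f) c.center c.z) :
    ‖modelGrad f L c.center c.z‖ ≤ 1 / 6 * ‖gradient f c.z‖ :=
  hf.norm_modelGrad_le_of_stops (tolerance_pos _ _ _ _ _) hv.mem hs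

lemma Regular.valid_step (hf : Regular f L) (hR : 0 ≤ R) (hxs : ∀ x, f xs ≤ f x)
    (hv : Valid f L R ε xs c) (hc : Step (bisection L R ε) (tolerance L R ε) f L c c') :
    Valid f L R ε xs c' := by
  cases hc with
  | inner z' hs hz => exact ⟨hv.lam_eq, hz.1, hv.progress⟩
  | accept hs ha =>
    obtain ⟨P, V, W, S, Z, hp⟩ := hv.progress
    exact ⟨rfl, self_mem_feasible hf.pos _, hf.progress_update hp hR hxs hv.lam_pos
      (hf.inexact_of_valid hv hs) ha.1 ha.2⟩
  | reject hs ha => exact ⟨rfl, self_mem_feasible hf.pos _, hv.progress⟩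

lemma Regular.natmiStep_of_step (hf : Regular f L) (hfc : ContDiff ℝ 3 f)
    (hv : Valid f L R ε xs c) (hc : Step (bisection L R ε) (tolerance L R ε) f L c c')
    (hne : c'.iter ≠ c.iter) : NatmiStep 3 (1 / 6) (3 / 2 * L) f c.main c'.main := by
  cases hc with
  | inner z' hs hz => exact absurd rfl hne
  | reject hs ha => exact absurd rfl hne
  | accept hs ha =>
    refine ⟨c.lam, c.z, hv.lam_pos, ?_, ?_, ?_, rfl⟩
    · rw [inexactSol, Set.mem_ofPred_eq, model_eq_cubicModel hfc,
        (hf.hasGradientAt_cubicModel _ _).gradient]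
      exact hf.inexact_of_valid hv hs
    · refine ha.1.trans (le_of_eq ?_)
      rw [Config.center]
      norm_num [Nat.factorial]
      left
      ring
    · refine (le_of_eq ?_).trans (ha.2.trans (le_of_eq ?_))
      · rw [Config.center]
        norm_num [Nat.factorial]
        left
        ring
      · norm_num

lemma Regular.length_le_of_counted (hf : Regular f L) (hR : 0 < R) (hε : 0 < ε)
    (hxs : ∀ x, f xs ≤ f x) (hv : Valid f L R ε xs c) (hc : Counted f L R ε xs c) :
    (c.rejected.length : ℝ) ≤ 48 * Real.log (Real.exp 1 + L * R ^ 4 / ε) := by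
  obtain ⟨P, V, W, S, Z, hp⟩ := hv.progress
  exact hf.length_rejected_le hR hε hxs hp.A_nonneg (hp.dist_x_le hR.le hxs) hp.dist_le
    (fun lam hlam => hp.center_dist_le hR.le hxs hlam) hc.rejected

lemma counted_initial {x₀ : Vec n} :
    Counted f L R ε xs (initial (bisection L R ε) x₀) where
  rejected := RejectedTrials.nil
  main h := by simp [initial, startTrial] at h
  hessians_le := by simp [initial, startTrial]

lemma Regular.counted_step (hf : Regular f L) (hR : 0 < R) (hε : 0 < ε) (hxs : ∀ x, f xs ≤ f x)
    (hv : Valid f L R ε xs c) (hk : Counted f L R ε xs c) (hacc : ε < f c.z - f xs)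
    (hc : Step (bisection L R ε) (tolerance L R ε) f L c c') : Counted f L R ε xs c' := by
  have hlen := hf.length_le_of_counted hR hε hxs hv hk
  have hh := hk.hessians_le
  cases hc with
  | inner z' hs hz => exact ⟨hk.rejected, hk.main, hk.hessians_le⟩
  | accept hs ha =>
    refine ⟨RejectedTrials.nil, fun _ => hacc, ?_⟩
    simp only [startTrial, List.length_nil]
    push_cast
    linarith
  | reject hs ha =>
    refine ⟨?_, hk.main, ?_⟩
    · have hat : StopsAt f L ε xs c.main (bisection L R ε c.rejected) c.z := by
        have := hf.inexact_of_valid hv hs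
        rw [Config.center, hv.lam_eq] at this
        exact ⟨this, hacc⟩
      rw [Config.Accepts, Config.center, hv.lam_eq] at ha
      simp only [startTrial, Config.center]
      rw [hv.lam_eq]
      exact RejectedTrials.cons hk.rejected hat ha
    · simp only [startTrial, List.length_cons]
      push_cast
      linarith

lemma gradientsCounted_initial {x₀ : Vec n} (hL : 0 ≤ L) (hε : 0 < ε) (hh : 0 ≤ h) :
    GradientsCounted f L R ε h (initial (bisection L R ε) x₀) := by
  refine ⟨0, InnerIter.zero, ?_, ?_⟩
  · have := one_le_innerBound (R := R) hL hε hh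
    push_cast
    linarith
  · simp [initial, startTrial]
    linarith

lemma Valid.center_dist_le (hv : Valid f L R ε xs c) (hR : 0 ≤ R) (hxs : ∀ x, f xs ≤ f x) :
    ‖c.center - xs‖ ≤ 9 / 4 * R := by
  obtain ⟨P, V, W, S, Z, hp⟩ := hv.progress
  exact hp.center_dist_le hR hxs hv.lam_pos

lemma Regular.gradientsCounted_step (hf : Regular f L) (hR : 0 < R) (hε : 0 < ε)
    (hxs : ∀ x, f xs ≤ f x) (hv : Valid f L R ε xs c) (hk : GradientsCounted f L R ε h c)
    (hh : ‖hess f c.center‖ ≤ h) (hacc : ε < f c.z - f xs)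
    (hc : Step (bisection L R ε) (tolerance L R ε) f L c c') : GradientsCounted f L R ε h c' := by
  obtain ⟨j, hj, hjK, hg⟩ := hk
  have hK := one_le_innerBound (R := R) hf.pos.le hε ((norm_nonneg _).trans hh)
  cases hc with
  | inner z' hs hz =>
    refine ⟨j + 1, InnerIter.succ hj hz, ?_, ?_⟩
    · exact hf.succ_le_innerBound hR hε hxs (hv.center_dist_le hR.le hxs) hh hj hacc hs
    · push_cast
      linarith
  | accept hs ha =>
    refine ⟨0, InnerIter.zero, ?_, ?_⟩
    · push_cast
      linarith
    · simp only [startTrial]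
      push_cast
      linarith
  | reject hs ha =>
    refine ⟨0, InnerIter.zero, ?_, ?_⟩
    · push_cast
      linarith
    · simp only [startTrial]
      push_cast
      linarith

/-- Every configuration has a successor: the inner step minimizes a continuous function on a
compact ball. -/
lemma Regular.exists_step (hf : Regular f L) (search : List (ℝ × ℝ) → ℝ) (tol : ℝ → ℝ → ℝ)
    (c : Config n) : ∃ c', Step search tol f L c c' := by
  by_cases hs : Stops f L (c.delta tol f) c.center c.z
  · by_cases ha : c.Accepts L
    · exact ⟨_, Step.accept c hs ha⟩
    · exact ⟨_, Step.reject c hs ha⟩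
  · have hcomp : IsCompact (feasible f L c.center) := by
      rw [feasible_eq_closedBall]; exact isCompact_closedBall _ _
    have hcont : Continuous (scaling f L c.center) :=
      continuous_iff_continuousAt.2 fun z => (hf.hasGradientAt_scaling c.center z).continuousAt
    obtain ⟨z', hz', hmin⟩ := hcomp.exists_isMinOn ⟨_, self_mem_feasible hf.pos c.center⟩
      (f := fun w => inner ℝ (inexactGrad f L (c.delta tol f) c.center c.z) (w - c.z)
        + 2 * (1 + 1 / Real.sqrt 2) * bregman (scaling f L c.center) c.z w) (by
        unfold bregman
        fun_prop)
    exact ⟨_, Step.inner c z' hs ⟨hz', hmin⟩⟩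

lemma Regular.exists_execution (hf : Regular f L) (search : List (ℝ × ℝ) → ℝ) (tol : ℝ → ℝ → ℝ)
    (x₀ : Vec n) : ∃ c, IsExecution search tol f L x₀ c := by
  choose next hnext using hf.exists_step search tol
  exact ⟨fun i => next^[i] (initial search x₀), rfl, fun i => by
    simp only [Function.iterate_succ_apply']; exact hnext _⟩

lemma gradients_add_three_le {search : List (ℝ × ℝ) → ℝ} {tol : ℝ → ℝ → ℝ}
    (hc : Step search tol f L c c') : c.gradients + 3 ≤ c'.gradients := by
  cases hc with
  | inner z' hs hz => exact le_rfl
  | accept hs ha => exact Nat.add_le_add_left (by norm_num) _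
  | reject hs ha => exact Nat.add_le_add_left (by norm_num) _

end Steps

/-! ### Complexity -/

/-- The number of Hessians as long as accuracy `ε` has not been reached: the rate of convergence
bounds the number of outer iterations, the line search that of trials in each of them. -/
lemma Regular.hessians_le (hf : Regular f L) {R ε : ℝ} {xs : Vec n} {c : Config n} (hR : 0 < R)
    (hε : 0 < ε) (hxs : ∀ x, f xs ≤ f x) (hv : Valid f L R ε xs c) (hk : Counted f L R ε xs c) :
    (c.hessians : ℝ) ≤ 196 * (1 + (L * R ^ 4 / ε) ^ ((1 : ℝ) / 5))
      * Real.log (Real.exp 1 + L * R ^ 4 / ε) := by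
  have hL := hf.pos
  have hlen := hf.length_le_of_counted hR hε hxs hv hk
  have hh := hk.hessians_le
  obtain ⟨P, V, W, S, Z, hp⟩ := hv.progress
  set q := L * R ^ 4 / ε with hq
  have hq0 : 0 < q := by positivity
  set Q := q ^ ((1 : ℝ) / 5) with hQ
  have hQ0 : 0 < Q := by positivity
  have hQ5 : Q ^ 5 = q := by
    rw [hQ, ← Real.rpow_natCast, ← Real.rpow_mul hq0.le]
    norm_num
  have hiter : (c.iter : ℝ) ≤ 4 * Q := by
    rcases Nat.eq_zero_or_pos c.iter with h0 | h0
    · rw [h0]; push_cast; positivity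
    · have h1 := hp.rate hL h0
      have h2 := hk.main h0
      have hk0 : (0 : ℝ) < (c.iter : ℝ) ^ 5 := by positivity
      refine le_of_pow_le_pow_left₀ (n := 5) (by norm_num) (by positivity) ?_
      have h3 := h2.trans_le h1
      rw [lt_div_iff₀ hk0] at h3
      have h4 : q * ε = L * R ^ 4 := by rw [hq]; field_simp
      rw [mul_pow, hQ5]
      refine le_of_mul_le_mul_left ?_ hε
      have : 0 < L * R ^ 4 := by positivity
      linarith
  set l := Real.log (Real.exp 1 + q) with hl
  have hl1 : 1 ≤ l := by
    rw [hl, Real.le_log_iff_exp_le (by positivity)]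
    linarith
  calc (c.hessians : ℝ) ≤ c.iter * (48 * l + 1) + 48 * l + 1 := by linarith
    _ ≤ 4 * Q * (48 * l + 1) + 48 * l + 1 := by gcongr
    _ = (1 + 4 * Q) * (48 * l + 1) := by ring
    _ ≤ (4 + 4 * Q) * (49 * l) := by gcongr <;> linarith
    _ = 196 * (1 + Q) * l := by ring

/-- The number of gradients as long as accuracy `ε` has not been reached: the number of trials
times the cost of a trial. -/
lemma Regular.gradients_le (hf : Regular f L) {R ε G h : ℝ} {xs : Vec n} {c : Config n} (hR : 0 < R)
    (hε : 0 < ε) (hxs : ∀ x, f xs ≤ f x) (hG : 0 ≤ G) (hh : 0 ≤ h) (hv : Valid f L R ε xs c)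
    (hk : Counted f L R ε xs c) (hg : GradientsCounted f L R ε h c) :
    (c.gradients : ℝ) ≤ 10 ^ 6 * (1 + (L * R ^ 4 / ε) ^ ((1 : ℝ) / 5))
      * Real.log (Real.exp 1 + (G + h) / ε)
      * Real.log (Real.exp 1 + R + L * R ^ 4 / ε) ^ 2 := by
  have hL := hf.pos
  have hhess := hf.hessians_le hR hε hxs hv hk
  obtain ⟨j, -, hjK, hgr⟩ := hg
  have hK1 := one_le_innerBound (R := R) hL.le hε hh
  have hg1 : (c.gradients : ℝ) ≤ c.hessians * (4 + 3 * innerBound L R ε h) := by linarith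
  set q := L * R ^ 4 / ε with hq
  have hq0 : 0 < q := by positivity
  set Q := q ^ ((1 : ℝ) / 5)
  have hQ0 : 0 < Q := by positivity
  have he := Real.exp_one_gt_d9
  set γ := Real.log (Real.exp 1 + (G + h) / ε) with hγ
  set r := Real.log (Real.exp 1 + R + q) with hr
  have hγ1 : 1 ≤ γ := by
    rw [hγ, Real.le_log_iff_exp_le (by positivity)]
    exact le_add_of_nonneg_right (by positivity)
  have hr1 : 1 ≤ r := by
    rw [hr, Real.le_log_iff_exp_le (by positivity)]
    linarith
  have hlr : Real.log (Real.exp 1 + q) ≤ r := Real.log_le_log (by positivity) (by linarith)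
  have hU : Real.log (1 + (h * R ^ 2 + L * R ^ 4) / ε) ≤ γ + 2 * r := by
    have e : γ + 2 * r = Real.log ((Real.exp 1 + (G + h) / ε) * (Real.exp 1 + R + q) ^ 2) := by
      rw [Real.log_mul (by positivity) (by positivity), Real.log_pow]
      push_cast
      rw [hγ, hr]
    rw [e]
    refine Real.log_le_log (by positivity) ?_
    have e1 : 1 + (h * R ^ 2 + L * R ^ 4) / ε = 1 + h / ε * R ^ 2 + q := by
      rw [hq]; field_simp; ring
    have h1 : h / ε * R ^ 2 ≤ (G + h) / ε * (Real.exp 1 + R + q) ^ 2 := by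
      gcongr <;> linarith
    have h2 : 1 + q ≤ Real.exp 1 * (Real.exp 1 + R + q) ^ 2 := by
      nlinarith
    rw [e1]
    linarith
  have hK : 4 + 3 * innerBound L R ε h ≤ 1090 * (γ * r) := by
    rw [innerBound]
    nlinarith
  calc (c.gradients : ℝ) ≤ c.hessians * (4 + 3 * innerBound L R ε h) := hg1
    _ ≤ (196 * (1 + Q) * Real.log (Real.exp 1 + q)) * (1090 * (γ * r)) :=
      mul_le_mul hhess hK (by linarith) ((Nat.cast_nonneg _).trans hhess)
    _ ≤ (196 * (1 + Q) * r) * (1090 * (γ * r)) := by gcongr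
    _ = 213640 * ((1 + Q) * γ * r ^ 2) := by ring
    _ ≤ 10 ^ 6 * ((1 + Q) * γ * r ^ 2) := by gcongr; norm_num
    _ = _ := by ring

section Execution

variable {R ε : ℝ} {xs x₀ : Vec n} {c : ℕ → Config n}

lemma Regular.valid_execution (hf : Regular f L) (hR : ‖x₀ - xs‖ ≤ R) (hxs : ∀ x, f xs ≤ f x)
    (hc : IsExecution (bisection L R ε) (tolerance L R ε) f L x₀ c) (i : ℕ) :
    Valid f L R ε xs (c i) := by
  induction i with
  | zero => rw [hc.1]; exact hf.valid_initial hR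
  | succ i ih => exact hf.valid_step ((norm_nonneg _).trans hR) hxs ih (hc.2 i)

lemma Regular.counted_execution (hf : Regular f L) (hR0 : 0 < R) (hε : 0 < ε)
    (hR : ‖x₀ - xs‖ ≤ R) (hxs : ∀ x, f xs ≤ f x)
    (hc : IsExecution (bisection L R ε) (tolerance L R ε) f L x₀ c) (i : ℕ)
    (hi : ∀ j < i, ε < f (c j).z - f xs) : Counted f L R ε xs (c i) := by
  induction i with
  | zero => rw [hc.1]; exact counted_initial
  | succ i ih =>
    exact hf.counted_step hR0 hε hxs (hf.valid_execution hR hxs hc i)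
      (ih fun j hj => hi j (hj.trans i.lt_succ_self)) (hi i i.lt_succ_self) (hc.2 i)

lemma Regular.gradientsCounted_execution (hf : Regular f L) (hR0 : 0 < R) (hε : 0 < ε)
    (hR : ‖x₀ - xs‖ ≤ R) (hxs : ∀ x, f xs ≤ f x)
    (hc : IsExecution (bisection L R ε) (tolerance L R ε) f L x₀ c) {h : ℝ} (hh : 0 ≤ h) (i : ℕ)
    (hi : ∀ j < i, ε < f (c j).z - f xs ∧ ‖hess f (c j).center‖ ≤ h) :
    GradientsCounted f L R ε h (c i) := by
  induction i with
  | zero => rw [hc.1]; exact gradientsCounted_initial hf.pos.le hε hh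
  | succ i ih =>
    exact hf.gradientsCounted_step hR0 hε hxs (hf.valid_execution hR hxs hc i)
      (ih fun j hj => hi j (hj.trans i.lt_succ_self)) (hi i i.lt_succ_self).2
      (hi i i.lt_succ_self).1 (hc.2 i)

/-- Accuracy `ε` is reached: otherwise the number of gradients would stay bounded, since the
Hessian is bounded on the ball that contains all centres. -/
lemma Regular.exists_accurate (hf : Regular f L) (hfc : ContDiff ℝ 3 f) (hR0 : 0 < R) (hε : 0 < ε)
    (hR : ‖x₀ - xs‖ ≤ R) (hxs : ∀ x, f xs ≤ f x)
    (hc : IsExecution (bisection L R ε) (tolerance L R ε) f L x₀ c) :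
    ∃ i, f (c i).z - f xs ≤ ε := by
  by_contra hcon
  push Not at hcon
  obtain ⟨h, hh⟩ := (isCompact_closedBall xs (9 / 4 * R)).exists_bound_of_continuousOn
    (contDiff_hess hfc).continuous.continuousOn
  have hcen : ∀ j, ‖hess f (c j).center‖ ≤ h := fun j => by
    refine hh _ ?_
    rw [Metric.mem_closedBall, dist_eq_norm]
    exact (hf.valid_execution hR hxs hc j).center_dist_le hR0.le hxs
  have hh0 : 0 ≤ h := (norm_nonneg _).trans (hcen 0)
  have hgrow : ∀ i, 3 * i ≤ (c i).gradients := by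
    intro i
    induction i with
    | zero => exact Nat.zero_le _
    | succ i ih => have := gradients_add_three_le (hc.2 i); omega
  obtain ⟨N, hN⟩ := exists_nat_gt (10 ^ 6 * (1 + (L * R ^ 4 / ε) ^ ((1 : ℝ) / 5))
      * Real.log (Real.exp 1 + (0 + h) / ε)
      * Real.log (Real.exp 1 + R + L * R ^ 4 / ε) ^ 2)
  have h1 := hf.gradients_le hR0 hε hxs le_rfl hh0 (hf.valid_execution hR hxs hc N)
    (hf.counted_execution hR0 hε hR hxs hc N fun j _ => hcon j)
    (hf.gradientsCounted_execution hR0 hε hR hxs hc hh0 N fun j _ => ⟨hcon j, hcen j⟩)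
  have h2 : (N : ℝ) ≤ (c N).gradients := by
    have := hgrow N
    exact_mod_cast (by omega : N ≤ (c N).gradients)
  linarith

lemma Regular.complexity (hf : Regular f L) (hfc : ContDiff ℝ 3 f) (hε : 0 < ε)
    (hR : ‖x₀ - xs‖ ≤ R) (hxs : ∀ x, f xs ≤ f x)
    (hc : IsExecution (bisection L R ε) (tolerance L R ε) f L x₀ c) :
    ∃ i, f (c i).z - f xs ≤ ε ∧
      ((c i).hessians : ℝ) ≤
        10 ^ 6 * (1 + (L * R ^ 4 / ε) ^ ((1 : ℝ) / 5))
          * Real.log (Real.exp 1 + L * R ^ 4 / ε) ^ 2 ∧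
      ∀ G H : ℝ,
        (∀ j ≤ i, ‖gradient f (c j).center‖ ≤ G ∧ ‖hess f (c j).center‖ ≤ H) →
        ((c i).gradients : ℝ) ≤
          10 ^ 6 * (1 + (L * R ^ 4 / ε) ^ ((1 : ℝ) / 5))
            * Real.log (Real.exp 1 + (G + H) / ε)
            * Real.log (Real.exp 1 + R + L * R ^ 4 / ε) ^ 2 := by
  have hL := hf.pos
  have hR' : 0 ≤ R := (norm_nonneg _).trans hR
  have hq : 0 ≤ L * R ^ 4 / ε := by positivity
  have hQ : 1 ≤ 1 + (L * R ^ 4 / ε) ^ ((1 : ℝ) / 5) := le_add_of_nonneg_right (by positivity)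
  have hl : 1 ≤ Real.log (Real.exp 1 + L * R ^ 4 / ε) := by
    rw [Real.le_log_iff_exp_le (by positivity)]
    linarith
  by_cases h0 : f (c 0).z - f xs ≤ ε
  · refine ⟨0, h0, ?_, fun G H hGH => ?_⟩
    · have e : ((c 0).hessians : ℝ) = 1 := by rw [hc.1]; simp [initial, startTrial]
      rw [e]
      have h1 := one_le_mul_of_one_le_of_one_le hQ (one_le_pow₀ hl (n := 2))
      linarith
    · have e : ((c 0).gradients : ℝ) = 4 := by rw [hc.1]; simp [initial, startTrial]
      rw [e]
      have hG := (norm_nonneg _).trans (hGH 0 le_rfl).1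
      have hH := (norm_nonneg _).trans (hGH 0 le_rfl).2
      have hγ : 1 ≤ Real.log (Real.exp 1 + (G + H) / ε) := by
        rw [Real.le_log_iff_exp_le (by positivity)]
        exact le_add_of_nonneg_right (by positivity)
      have hr : 1 ≤ Real.log (Real.exp 1 + R + L * R ^ 4 / ε) := by
        rw [Real.le_log_iff_exp_le (by positivity)]
        linarith
      have h1 := one_le_mul_of_one_le_of_one_le
        (one_le_mul_of_one_le_of_one_le hQ hγ) (one_le_pow₀ hr (n := 2))
      linarith
  · push Not at h0
    have hR0 : 0 < R := by
      refine lt_of_le_of_ne hR' fun hR0 => ?_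
      have h1 := (hf.valid_execution hR hxs hc 0).center_dist_le hR' hxs
      rw [← hR0, mul_zero] at h1
      have h2 : (c 0).z = (c 0).center := by rw [hc.1]; rfl
      rw [h2, sub_eq_zero.1 (norm_le_zero_iff.1 h1), sub_self] at h0
      linarith
    classical
    have hex := hf.exists_accurate hfc hR0 hε hR hxs hc
    have hmin : ∀ j < Nat.find hex, ε < f (c j).z - f xs := fun j hj =>
      not_le.1 (Nat.find_min hex hj)
    have hv := hf.valid_execution (ε := ε) hR hxs hc (Nat.find hex)
    have hk := hf.counted_execution hR0 hε hR hxs hc _ hmin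
    refine ⟨Nat.find hex, Nat.find_spec hex, ?_, fun G H hGH => ?_⟩
    · refine (hf.hessians_le hR0 hε hxs hv hk).trans ?_
      have h1 : Real.log (Real.exp 1 + L * R ^ 4 / ε)
          ≤ Real.log (Real.exp 1 + L * R ^ 4 / ε) ^ 2 := le_self_pow₀ hl (by norm_num)
      gcongr
      norm_num
    · have hG := (norm_nonneg _).trans (hGH _ le_rfl).1
      have hH := (norm_nonneg _).trans (hGH _ le_rfl).2
      exact hf.gradients_le hR0 hε hxs hG hH hv hk
        (hf.gradientsCounted_execution hR0 hε hR hxs hc hH _ fun j hj =>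
          ⟨hmin j hj, (hGH j hj.le).2⟩)

end Execution

end Hyperfast

end

theorem theorem2 :
    ∃ (search : ℝ → ℝ → ℝ → List (ℝ × ℝ) → ℝ) (tol : ℝ → ℝ → ℝ → ℝ → ℝ → ℝ) (C : ℝ) (m : ℕ),
      (∀ L R ε l, 0 < search L R ε l) ∧ (∀ L R ε g h, 0 < tol L R ε g h) ∧ 0 < C ∧
      ∀ (n : ℕ) (f : Vec n → ℝ) (L R ε : ℝ) (x₀ xs : Vec n),
        ConvexOn ℝ Set.univ f →
        ContDiff ℝ 3 f →
        0 < L →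
        (∀ x y, ‖iteratedFDeriv ℝ 3 f x - iteratedFDeriv ℝ 3 f y‖ ≤ L * ‖x - y‖) →
        (∀ x, f xs ≤ f x) →
        ‖x₀ - xs‖ ≤ R →
        0 < ε →
        (∃ c, Hyperfast.IsExecution (search L R ε) (tol L R ε) f L x₀ c) ∧
        ∀ c, Hyperfast.IsExecution (search L R ε) (tol L R ε) f L x₀ c →
          -- the outer iterations are iterations of NATMI with p = 3, γ = 1/6, ξ = 3/2
          (∀ i, (c (i + 1)).iter ≠ (c i).iter →
            Hyperfast.NatmiStep 3 (1 / 6) (3 / 2 * L) f (c i).main (c (i + 1)).main) ∧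
          -- rate of convergence of the outer iterates
          (∀ i, 1 ≤ (c i).iter →
            f (c i).main.y - f xs ≤ C * (L * R ^ 4) / ((c i).iter : ℝ) ^ 5) ∧
          -- oracle complexity of reaching accuracy ε
          ∃ i, f (c i).z - f xs ≤ ε ∧
            ((c i).hessians : ℝ) ≤
              C * (1 + (L * R ^ 4 / ε) ^ ((1 : ℝ) / 5))
                * Real.log (Real.exp 1 + L * R ^ 4 / ε) ^ m ∧
            ∀ G H : ℝ,
              (∀ j ≤ i, ‖gradient f (c j).center‖ ≤ G ∧ ‖Hyperfast.hess f (c j).center‖ ≤ H) →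
              ((c i).gradients : ℝ) ≤
                C * (1 + (L * R ^ 4 / ε) ^ ((1 : ℝ) / 5))
                  * Real.log (Real.exp 1 + (G + H) / ε)
                  * Real.log (Real.exp 1 + R + L * R ^ 4 / ε) ^ m := by
  refine ⟨Hyperfast.bisection, Hyperfast.tolerance, 10 ^ 6, 2, Hyperfast.bisection_pos,
    Hyperfast.tolerance_pos, by norm_num, ?_⟩
  intro n f L R ε x₀ xs hconv hfc hL hlip hxs hR hε
  have hf := Hyperfast.Regular.of_contDiff hconv hfc hL hlip
  refine ⟨hf.exists_execution _ _ x₀, fun c hc => ⟨fun i hi => ?_, fun i hi => ?_, ?_⟩⟩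
  · exact hf.natmiStep_of_step hfc (hf.valid_execution hR hxs hc i) (hc.2 i) hi
  · obtain ⟨P, V, W, S, Z, hp⟩ := (hf.valid_execution hR hxs hc i).progress
    refine (hp.rate hL hi).trans ?_
    have hR' : 0 ≤ R := (norm_nonneg _).trans hR
    gcongr
    norm_num
  · exact hf.complexity hfc hε hR hxs hc
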